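/- Let $R=\mathbb{C}[x_1,x_2,x_3,x_4]$ with $\deg x_i=2$, and for a composition $(i_1,\dots,i_k)$ of $4$ let $R_{i_1\cdots i_k}\subseteq R$ be the subring of polynomials invariant under $S_{i_1}\times\cdots\times S_{i_k}$; write $\otimes_{i_1\cdots i_k}$ for $\otimes_{R_{i_1\cdots i_k}}$. All bimodules are $\mathbb{Z}$-graded, all maps of complexes and all homotopies are degree-preserving bimodule maps, and $M\{k\}$ denotes the shift $M\{k\}_n=M_{n-k}$. Let $\Delta_{21}=\sum_{j=0}^{2}(-1)^j x_3^{2-j}\otimes e_j(x_1,x_2)\in R_{211}\otimes_{31}R_{211}$, $\Delta_{31}=\sum_{j=0}^{3}(-1)^j x_4^{3-j}\otimes e_j(x_1,x_2,x_3)\in R_{31}\otimes_4R_{31}$ and $\Delta'_{21}=\sum_{j=0}^{2}(-1)^j x_4^{2-j}\otimes e_j(x_2,x_3)\in R_{121}\otimes_{13}R_{121}$. For consecutive $p,q=p+1$ let $\partial_p$ be the divided difference $\partial_p f=(f-f|_{x_p\leftrightarrow x_q})/(x_p-x_q)$, i.e. $\partial_p(g+x_ph)=h$ for $g,h$ symmetric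 in $x_p,x_q$. * To a positive crossing of two strands labelled $2$ associate the complex of $R_{22}$-bimodules $$C_{22}\colon\quad R_{22}\{6\}\xrightarrow{\ d_1\ }(R_{211}\otimes_{31}R_{211})\{2\}\xrightarrow{\ d_2\ }R_{22}\otimes_4R_{22},$$ $d_1(f)=f\,\Delta_{21}$, $d_2(a\otimes b)=(\partial_3\otimes\partial_3)(a\,\Delta_{31}\,b)$, with $R_{22}\otimes_4 R_{22}$ in cohomological degree $0$. * To a positive crossing of a $2$-labelled strand (from bottom left to top right) with a $1$-labelled strand, next to a vertical $1$-labelled strand on the right, respectively on the left, associate the complexes $$C_{21|1}\colon\ R_{1111}\{2\}\to R_{121}\otimes_{31}R_{211},\quad f\mapsto(\partial_2\otimes 1)(f\Delta_{21}),\qquad C_{1|21}\colon\ R_{1111}\{2\}\to R_{112}\otimes_{13}R_{121},\quad f\mapsto(\partial_3\otimes1)(f\Delta'_{21}),$$ of $R_{121}$-$R_{211}$-bimodules and of $R_{112}$-$R_{121}$-bimodules respectively, with the right-hand terms in cohomological degree $0$. Consider a positive crossing of two $2$-labelled strands whose upper left end is split into two $1$-labelled strands; its complex is $R_{112}\otimes_{22}C_{22}$.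 Sliding the splitting below the crossing gives the diagram in which the lower right $2$-labelled strand first splits into two $1$-labelled strands, which then both cross the other $2$-labelled strand positively; its complex is $C_{1|21}\otimes_{121}C_{21|1}\otimes_{211}R_{211}$, where $R_{211}$ is regarded as an $R_{211}$-$R_{22}$-bimodule. These two complexes of graded $R_{112}$-$R_{22}$-bimodules are homotopy equivalent: $$R_{112}\otimes_{22}C_{22}\;\simeq\;C_{1|21}\otimes_{121}C_{21|1}\otimes_{211}R_{211}.$$ -/

import Mathlib

noncomputable section

namespace ColouredWeb

open CategoryTheory MvPolynomial

/-- The polynomial ring `ℂ[x₁, x₂, x₃, x₄]`; the variable `xᵢ` is `X (i - 1)`. -/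
abbrev Poly : Type := MvPolynomial (Fin 4) ℂ

/-- The ring `R_{i₁⋯iₖ}` of polynomials invariant under `S_{i₁} × ⋯ × S_{iₖ}`. The composition is
given by the map `c` sending (the index of) a variable to its block: `R₂₁₁` is
`Inv ![0, 0, 1, 2]`. -/
def Inv (c : Fin 4 → ℕ) : Subalgebra ℂ Poly where
  carrier := {p | ∀ σ : Equiv.Perm (Fin 4), (∀ i, c (σ i) = c i) → rename σ p = p}
  mul_mem' := fun hp hq σ h => by rw [map_mul, hp σ h, hq σ h]
  add_mem' := fun hp hq σ h => by rw [map_add, hp σ h, hq σ h]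
  algebraMap_mem' := fun r σ _ => by simp [MvPolynomial.algebraMap_eq]

/-- The composition `s` refines the composition `a`. -/
def Refines (s a : Fin 4 → ℕ) : Prop := ∀ i j, s i = s j → a i = a j

instance (s a : Fin 4 → ℕ) : Decidable (Refines s a) := by unfold Refines; infer_instance

theorem Refines.refl (a : Fin 4 → ℕ) : Refines a a := fun _ _ h => h

theorem Refines.trans {s a b : Fin 4 → ℕ} (h : Refines s a) (h' : Refines a b) : Refines s b :=
  fun i j e => h' i j (h i j e)

theorem Refines.le {s a : Fin 4 → ℕ} (h : Refines s a) : Inv a ≤ Inv s :=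
  fun _ hp σ hσ => hp σ fun i => h _ _ (hσ i)

/-- Homogeneous elements of `Inv c` of `q`-degree `n`, where `deg xᵢ = 2`. -/
def Inv.piece (c : Fin 4 → ℕ) (n : ℤ) : AddSubgroup (Inv c) :=
  (weightedHomogeneousSubmodule ℂ (fun _ : Fin 4 => (2 : ℤ)) n).toAddSubgroup.comap
    (Inv c).val.toLinearMap.toAddMonoidHom

theorem Inv.mem_piece {c : Fin 4 → ℕ} {n : ℤ} {p : Inv c} :
    p ∈ Inv.piece c n ↔ IsWeightedHomogeneous (fun _ : Fin 4 => (2 : ℤ)) (p : Poly) n := Iff.rfl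

theorem rename_isWH {σ : Equiv.Perm (Fin 4)} {p : Poly} {n : ℤ}
    (h : IsWeightedHomogeneous (fun _ : Fin 4 => (2 : ℤ)) p n) :
    IsWeightedHomogeneous (fun _ : Fin 4 => (2 : ℤ)) (rename σ p) n := by
  intro d hd
  obtain ⟨u, hu, hu'⟩ := coeff_rename_ne_zero _ _ _ hd
  rw [← h hu', ← hu]
  rw [Finsupp.weight_apply, Finsupp.weight_apply, Finsupp.sum_mapDomain_index (by simp)
    (fun _ _ _ => add_smul _ _ _)]

theorem rename_component (σ : Equiv.Perm (Fin 4)) (p : Poly) (n : ℤ) :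
    rename σ (weightedHomogeneousComponent (fun _ : Fin 4 => (2 : ℤ)) n p) =
      weightedHomogeneousComponent (fun _ : Fin 4 => (2 : ℤ)) n (rename σ p) := by
  induction p using MvPolynomial.induction_on' with
  | monomial d a =>
    have h := isWeightedHomogeneous_monomial (R := ℂ) (fun _ : Fin 4 => (2 : ℤ)) d a rfl
    by_cases hn : Finsupp.weight (fun _ : Fin 4 => (2 : ℤ)) d = n
    · subst hn
      rw [h.weightedHomogeneousComponent_same, (rename_isWH h).weightedHomogeneousComponent_same]
    · rw [h.weightedHomogeneousComponent_ne _ (Ne.symm hn), map_zero,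
        (rename_isWH h).weightedHomogeneousComponent_ne _ (Ne.symm hn)]
  | add p q hp hq => simp only [map_add, hp, hq]

theorem component_mem {c : Fin 4 → ℕ} {p : Poly} (hp : p ∈ Inv c) (n : ℤ) :
    weightedHomogeneousComponent (fun _ : Fin 4 => (2 : ℤ)) n p ∈ Inv c := fun σ h => by
  rw [rename_component, hp σ h]

/-- The elementary symmetric polynomial `e_j` in the variables `x_t`, `t ∈ T`. -/
def esymmOn (T : Finset (Fin 4)) (j : ℕ) : Poly := ∑ S ∈ T.powersetCard j, ∏ i ∈ S, X i

theorem esymmOn_zero (T : Finset (Fin 4)) : esymmOn T 0 = 1 := by simp [esymmOn]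

theorem esymmOn_insert {T : Finset (Fin 4)} {k : Fin 4} (hk : k ∉ T) (j : ℕ) :
    esymmOn (insert k T) (j + 1) = esymmOn T (j + 1) + X k * esymmOn T j := by
  unfold esymmOn
  rw [Finset.powersetCard_succ_insert hk, Finset.sum_union, Finset.sum_image, Finset.mul_sum]
  · congr 1
    refine Finset.sum_congr rfl fun S hS => ?_
    rw [Finset.prod_insert fun h => hk ((Finset.mem_powersetCard.1 hS).1 h)]
  · intro S hS S' hS' h
    have h1 : k ∉ S := fun h => hk ((Finset.mem_powersetCard.1 hS).1 h)
    have h2 : k ∉ S' := fun h => hk ((Finset.mem_powersetCard.1 hS').1 h)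
    rw [← Finset.erase_insert h1, h, Finset.erase_insert h2]
  · rw [Finset.disjoint_left]
    intro S hS hS'
    obtain ⟨S', _, rfl⟩ := Finset.mem_image.1 hS'
    exact hk ((Finset.mem_powersetCard.1 hS).1 (Finset.mem_insert_self _ _))

theorem esymmOn_of_card_lt {T : Finset (Fin 4)} {j : ℕ} (h : T.card < j) : esymmOn T j = 0 := by
  simp [esymmOn, Finset.powersetCard_eq_empty.2 h]

theorem rename_esymmOn (σ : Equiv.Perm (Fin 4)) (T : Finset (Fin 4)) (j : ℕ) :
    rename σ (esymmOn T j) = esymmOn (T.map σ.toEmbedding) j := by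
  simp [esymmOn, Finset.powersetCard_map, Finset.sum_map, Finset.prod_map]

theorem esymmOn_isWH (T : Finset (Fin 4)) (j : ℕ) :
    IsWeightedHomogeneous (fun _ : Fin 4 => (2 : ℤ)) (esymmOn T j) (2 * j) := by
  refine IsWeightedHomogeneous.sum _ _ _ fun S hS => ?_
  have := IsWeightedHomogeneous.prod S (fun i => (X i : Poly)) (fun _ => (2 : ℤ))
    (w := fun _ : Fin 4 => (2 : ℤ)) fun i _ => isWeightedHomogeneous_X _ _ _
  simpa [(Finset.mem_powersetCard.1 hS).2, mul_comm] using this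

/-- The composition `s` arises from `a` by splitting the block `T ∪ {k}` of `a` into the blocks `T`
and `{k}`, all the other blocks being single variables. -/
def Splits (a s : Fin 4 → ℕ) (T : Finset (Fin 4)) (k : Fin 4) : Prop :=
  k ∉ T ∧
  (∀ i j, s i = s j ↔ i = j ∨ i ∈ T ∧ j ∈ T) ∧
  (∀ i j, a i = a j ↔ i = j ∨ i ∈ insert k T ∧ j ∈ insert k T)

instance (a s : Fin 4 → ℕ) (T : Finset (Fin 4)) (k : Fin 4) : Decidable (Splits a s T k) := by
  unfold Splits; infer_instance

section Splits

variable {a s : Fin 4 → ℕ} {T : Finset (Fin 4)} {k : Fin 4}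

theorem Splits.refines (h : Splits a s T k) : Refines s a := fun i j e =>
  (h.2.2 i j).2 (((h.2.1 i j).1 e).imp id fun ⟨x, y⟩ =>
    ⟨Finset.mem_insert_of_mem x, Finset.mem_insert_of_mem y⟩)

theorem map_eq_of_block {c : Fin 4 → ℕ} {U : Finset (Fin 4)}
    (h : ∀ i j, c i = c j ↔ i = j ∨ i ∈ U ∧ j ∈ U)
    {σ : Equiv.Perm (Fin 4)} (hσ : ∀ i, c (σ i) = c i) : U.map σ.toEmbedding = U := by
  refine Finset.eq_of_subset_of_card_le (fun x hx => ?_) (by simp)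
  obtain ⟨y, hy, rfl⟩ := Finset.mem_map.1 hx
  rcases (h _ _).1 (hσ y) with e | e
  · simpa [e] using hy
  · exact e.1

theorem esymmOn_mem {c : Fin 4 → ℕ} {U : Finset (Fin 4)}
    (h : ∀ i j, c i = c j ↔ i = j ∨ i ∈ U ∧ j ∈ U) (j : ℕ) : esymmOn U j ∈ Inv c := fun σ hσ => by
  rw [rename_esymmOn, map_eq_of_block h hσ]

theorem X_mem {c : Fin 4 → ℕ} {U : Finset (Fin 4)}
    (h : ∀ i j, c i = c j ↔ i = j ∨ i ∈ U ∧ j ∈ U) {i : Fin 4} (hi : i ∉ U) :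
    (X i : Poly) ∈ Inv c := fun σ hσ => by
  rw [rename_X]
  rcases (h _ _).1 (hσ i) with e | e
  · rw [e]
  · exact absurd e.2 hi

theorem symm_mem_adjoin {τ B : Type} [Fintype τ] [CommRing B] {p : MvPolynomial τ B}
    (hp : p.IsSymmetric) : p ∈ Algebra.adjoin B (Set.range (esymm τ B)) := by
  obtain ⟨q, hq⟩ := esymmAlgHom_surjective (σ := τ) B le_rfl ⟨p, hp⟩
  have hq' : (esymmAlgHom τ B _ q).1 = p := by rw [hq]
  rw [← hq', esymmAlgHom_apply]
  have := AlgHom.mem_range_self (aeval fun i : Fin (Fintype.card τ) => esymm τ B (i + 1)) q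
  rw [aeval_range] at this
  refine Algebra.adjoin_mono ?_ this
  rintro _ ⟨i, rfl⟩
  exact ⟨_, rfl⟩

/-- A polynomial symmetric in the variables indexed by `T` is a polynomial in the other variables
and the elementary symmetric polynomials in the variables indexed by `T`. -/
theorem mem_adjoin_of_block {c : Fin 4 → ℕ} {T : Finset (Fin 4)}
    (h : ∀ i j, c i = c j ↔ i = j ∨ i ∈ T ∧ j ∈ T) {f : Poly} (hf : f ∈ Inv c) :
    f ∈ Algebra.adjoin ℂ ({p : Poly | ∃ i ∉ T, p = X i} ∪ {p : Poly | ∃ j, p = esymmOn T j}) := by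
  classical
  let B : Subalgebra ℂ Poly := Algebra.adjoin ℂ {p : Poly | ∃ i ∉ T, p = X i}
  have hB : ∀ i ∉ T, (X i : Poly) ∈ B := fun i hi => Algebra.subset_adjoin ⟨i, hi, rfl⟩
  let φ : Poly →ₐ[ℂ] MvPolynomial T B := aeval fun i =>
    if hi : i ∈ T then X ⟨i, hi⟩ else C ⟨X i, hB i hi⟩
  let ψ : MvPolynomial T B →ₐ[B] Poly := aeval fun t => X t.1
  have hψφ : ∀ p, ψ (φ p) = p := by
    intro p
    have : (ψ.restrictScalars ℂ).comp φ = AlgHom.id ℂ Poly := by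
      ext i
      by_cases hi : i ∈ T
      · simp [φ, ψ, hi]
      · simp [φ, ψ, hi]
    exact DFunLike.congr_fun this p
  have hsym : (φ f).IsSymmetric := by
    intro e
    have key : ∀ p, rename e (φ p) = φ (rename (Equiv.Perm.ofSubtype e) p) := by
      intro p
      have : ((rename e : MvPolynomial T B →ₐ[B] _).restrictScalars ℂ).comp φ =
          φ.comp (rename (Equiv.Perm.ofSubtype e)) := by
        ext i : 1
        by_cases hi : i ∈ T
        · have h1 : Equiv.Perm.ofSubtype e i ∈ T := by
            rw [Equiv.Perm.ofSubtype_apply_of_mem e hi]; exact (e ⟨i, hi⟩).2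
          simp only [AlgHom.comp_apply, AlgHom.restrictScalars_apply, rename_X, φ, aeval_X, dif_pos hi,
            dif_pos h1]
          congr 1
          apply Subtype.ext
          simp [Equiv.Perm.ofSubtype_apply_of_mem e hi]
        · simp [φ, Equiv.Perm.ofSubtype_apply_of_not_mem e hi, hi]
      exact DFunLike.congr_fun this p
    rw [key, hf _ fun i => ?_]
    by_cases hi : i ∈ T
    · exact (h _ _).2 (Or.inr ⟨by
        rw [Equiv.Perm.ofSubtype_apply_of_mem e hi]; exact (e ⟨i, hi⟩).2, hi⟩)
    · rw [Equiv.Perm.ofSubtype_apply_of_not_mem e hi]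
  have hmem := symm_mem_adjoin hsym
  rw [← hψφ f]
  set A := Algebra.adjoin ℂ
    ({p : Poly | ∃ i ∉ T, p = X i} ∪ {p : Poly | ∃ j, p = esymmOn T j}) with hA
  have hBA : B ≤ A := Algebra.adjoin_mono Set.subset_union_left
  refine Algebra.adjoin_induction (p := fun p _ => ψ p ∈ A) ?_ ?_ ?_ ?_ hmem
  · rintro _ ⟨j, rfl⟩
    refine Algebra.subset_adjoin (Or.inr ⟨j, ?_⟩)
    have h1 : T.powersetCard j = ((Finset.univ : Finset T).map
        (Function.Embedding.subtype _)).powersetCard j := by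
      rw [Finset.univ_eq_attach]; exact congrArg _ Finset.attach_map_val.symm
    rw [esymmOn, h1, Finset.powersetCard_map, esymm, map_sum]
    simp [Finset.sum_map, Finset.prod_map, ψ]
  · intro r
    rw [AlgHom.commutes]
    exact hBA r.2
  · intro x y _ _ hx hy
    rw [map_add]; exact add_mem hx hy
  · intro x y _ _ hx hy
    rw [map_mul]; exact mul_mem hx hy

/-- If `s` splits the block `T ∪ {k}` of `a` into `T` and `{k}`, then `R_s` is generated by `x_k`
over `R_a`. -/
theorem Splits.mem_adjoin (h : Splits a s T k) {f : Poly} (hf : f ∈ Inv s) :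
    f ∈ Algebra.adjoin ℂ ((Inv a : Set Poly) ∪ {X k}) := by
  have hle : Algebra.adjoin ℂ
      ({p : Poly | ∃ i ∉ T, p = X i} ∪ {p : Poly | ∃ j, p = esymmOn T j}) ≤
      Algebra.adjoin ℂ ((Inv a : Set Poly) ∪ {X k}) := by
    have hk : (X k : Poly) ∈ Algebra.adjoin ℂ ((Inv a : Set Poly) ∪ {X k}) :=
      Algebra.subset_adjoin (Or.inr rfl)
    refine Algebra.adjoin_le ?_
    rintro p (⟨i, hi, rfl⟩ | ⟨j, rfl⟩)
    · by_cases hik : i = k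
      · subst hik; exact hk
      · exact Algebra.subset_adjoin (Or.inl (X_mem h.2.2 (by simp [hik, hi])))
    · induction j with
      | zero => rw [esymmOn_zero]; exact one_mem _
      | succ j ih =>
        have := esymmOn_insert h.1 j
        rw [eq_comm, ← eq_sub_iff_add_eq] at this
        rw [this]
        exact sub_mem (Algebra.subset_adjoin (Or.inl (esymmOn_mem h.2.2 _))) (mul_mem hk ih)
  exact hle (mem_adjoin_of_block h.2.1 hf)

end Splits

theorem dvd_sub_swap (p q : Fin 4) (f : Poly) :
    (X p - X q : Poly) ∣ f - rename (Equiv.swap p q) f := by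
  induction f using MvPolynomial.induction_on with
  | C r => simp
  | add f g hf hg =>
    rw [map_add, add_sub_add_comm]; exact dvd_add hf hg
  | mul_X f i hf =>
    have : f * X i - rename (Equiv.swap p q) (f * X i) =
        (f - rename (Equiv.swap p q) f) * X i +
          rename (Equiv.swap p q) f * (X i - X (Equiv.swap p q i)) := by
      rw [map_mul, rename_X]; ring
    rw [this]
    refine dvd_add (hf.mul_right _) (Dvd.dvd.mul_left ?_ _)
    rcases eq_or_ne i p with rfl | hp
    · simp
    · rcases eq_or_ne i q with rfl | hq
      · rw [Equiv.swap_apply_right, ← neg_sub, neg_dvd]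
      · simp [Equiv.swap_apply_of_ne_of_ne hp hq]

/-- The divided difference `(f - f(x_p ↔ x_q)) / (x_p - x_q)`. -/
def divDiff (p q : Fin 4) (f : Poly) : Poly := Classical.choose (dvd_sub_swap p q f)

theorem divDiff_spec (p q : Fin 4) (f : Poly) :
    (X p - X q) * divDiff p q f = f - rename (Equiv.swap p q) f :=
  (Classical.choose_spec (dvd_sub_swap p q f)).symm

theorem X_sub_ne {p q : Fin 4} (h : p ≠ q) : (X p - X q : Poly) ≠ 0 :=
  sub_ne_zero.2 fun e => h (X_injective e)

/-- The composition `t` arises from `s` by merging the two single-variable blocks `{p}`, `{q}`. -/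
def Merges (s t : Fin 4 → ℕ) (p q : Fin 4) : Prop :=
  p ≠ q ∧ (∀ i, s i = s p → i = p) ∧ (∀ i, s i = s q → i = q) ∧
  (∀ i j, t i = t j ↔ s i = s j ∨ (i = p ∨ i = q) ∧ (j = p ∨ j = q))

instance (s t : Fin 4 → ℕ) (p q : Fin 4) : Decidable (Merges s t p q) := by
  unfold Merges; infer_instance

section Merges

variable {s t : Fin 4 → ℕ} {p q : Fin 4}

theorem Merges.refines (h : Merges s t p q) : Refines s t := fun i j e =>
  (h.2.2.2 i j).2 (Or.inl e)

theorem Merges.rename_swap (h : Merges s t p q) {f : Poly} (hf : f ∈ Inv t) :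
    rename (Equiv.swap p q) f = f := hf _ fun i => by
  rcases eq_or_ne i p with rfl | hp
  · rw [Equiv.swap_apply_left]; exact (h.2.2.2 _ _).2 (Or.inr ⟨Or.inr rfl, Or.inl rfl⟩)
  · rcases eq_or_ne i q with rfl | hq
    · rw [Equiv.swap_apply_right]; exact (h.2.2.2 _ _).2 (Or.inr ⟨Or.inl rfl, Or.inr rfl⟩)
    · rw [Equiv.swap_apply_of_ne_of_ne hp hq]

theorem Merges.divDiff_mul (h : Merges s t p q) {f : Poly} (hf : f ∈ Inv t) (g : Poly) :
    divDiff p q (f * g) = f * divDiff p q g := by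
  apply mul_left_cancel₀ (X_sub_ne h.1)
  rw [divDiff_spec, map_mul, h.rename_swap hf, mul_left_comm, divDiff_spec, mul_sub]

theorem divDiff_add (h : p ≠ q) (f g : Poly) :
    divDiff p q (f + g) = divDiff p q f + divDiff p q g := by
  apply mul_left_cancel₀ (X_sub_ne h)
  rw [mul_add, divDiff_spec, divDiff_spec, divDiff_spec, map_add]; ring

theorem rename_divDiff_swap (h : p ≠ q) (f : Poly) :
    rename (Equiv.swap p q) (divDiff p q f) = divDiff p q f := by
  apply mul_left_cancel₀ (X_sub_ne h)
  have h1 := congrArg (rename (Equiv.swap p q)) (divDiff_spec p q f)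
  rw [map_mul, map_sub, map_sub, rename_X, rename_X, Equiv.swap_apply_left,
    Equiv.swap_apply_right, rename_rename, ← Equiv.coe_trans, Equiv.swap_swap] at h1
  simp only [Equiv.coe_refl, rename_id, AlgHom.id_apply] at h1
  rw [divDiff_spec, ← neg_sub (rename _ f), ← h1]; ring

theorem Merges.divDiff_mem (h : Merges s t p q) {f : Poly} (hf : f ∈ Inv s) :
    divDiff p q f ∈ Inv t := by
  have fixed : ∀ τ : Equiv.Perm (Fin 4), (∀ i, s (τ i) = s i) →
      rename τ (divDiff p q f) = divDiff p q f := by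
    intro τ hτ
    have hp : τ p = p := h.2.1 _ (hτ p)
    have hq : τ q = q := h.2.2.1 _ (hτ q)
    apply mul_left_cancel₀ (X_sub_ne h.1)
    have h1 := congrArg (rename τ) (divDiff_spec p q f)
    rw [map_mul, map_sub, map_sub, rename_X, rename_X, hp, hq, hf τ hτ, rename_rename] at h1
    rw [divDiff_spec, h1]
    have hcomm : (τ ∘ Equiv.swap p q : Fin 4 → Fin 4) = Equiv.swap p q ∘ τ := by
      funext i
      have := Equiv.swap_apply_apply τ p q
      have h2 := congrArg (fun e : Equiv.Perm (Fin 4) => e (τ i)) this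
      simp [hp, hq] at h2
      exact h2.symm
    rw [hcomm, ← rename_rename, hf τ hτ]
  intro σ hσ
  by_cases hp : σ p = p
  · refine fixed σ fun i => ?_
    rcases (h.2.2.2 _ _).1 (hσ i) with e | ⟨e1, e2⟩
    · exact e
    · rcases e2 with rfl | rfl
      · rw [hp]
      · rcases e1 with e | e
        · exact absurd (σ.injective (hp.trans e.symm)) h.1
        · rw [e]
  · have hσp : σ p = q := by
      rcases (h.2.2.2 _ _).1 (hσ p) with e | ⟨e1, _⟩
      · exact absurd (h.2.1 _ e) hp
      · exact e1.resolve_left hp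
    have hσq : σ q = p := by
      rcases (h.2.2.2 _ _).1 (hσ q) with e | ⟨e1, _⟩
      · exact absurd (σ.injective (hσp.trans (h.2.2.1 _ e).symm)) h.1
      · exact e1.resolve_right fun e => h.1 (σ.injective (hσp.trans e.symm))
    have h1 := fixed (σ.trans (Equiv.swap p q)) fun i => by
      rw [Equiv.trans_apply]
      rcases eq_or_ne i p with rfl | hip
      · rw [hσp, Equiv.swap_apply_right]
      rcases eq_or_ne i q with rfl | hiq
      · rw [hσq, Equiv.swap_apply_left]
      have a1 : σ i ≠ p := fun e => hiq (σ.injective (e.trans hσq.symm))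
      have a2 : σ i ≠ q := fun e => hip (σ.injective (e.trans hσp.symm))
      rw [Equiv.swap_apply_of_ne_of_ne a1 a2]
      rcases (h.2.2.2 _ _).1 (hσ i) with e | ⟨e1, _⟩
      · exact e
      · exact absurd e1 (by simp [a1, a2])
    rw [Equiv.coe_trans, ← rename_rename] at h1
    have h2 := congrArg (rename (Equiv.swap p q)) h1
    rw [rename_rename, ← Equiv.coe_trans, Equiv.swap_swap, rename_divDiff_swap h.1] at h2
    simpa using h2

theorem isWH_of_mul {f g : Poly} {m n : ℤ} (hf : f ≠ 0)
    (h : IsWeightedHomogeneous (fun _ : Fin 4 => (2 : ℤ)) f m)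
    (hfg : IsWeightedHomogeneous (fun _ : Fin 4 => (2 : ℤ)) (f * g) (m + n)) :
    IsWeightedHomogeneous (fun _ : Fin 4 => (2 : ℤ)) g n := by
  classical
  let _ := weightedGradedAlgebra ℂ (fun _ : Fin 4 => (2 : ℤ))
  have h1 := DirectSum.coe_decompose_mul_add_of_left_mem
    (weightedHomogeneousSubmodule ℂ (fun _ : Fin 4 => (2 : ℤ))) (i := m) (j := n) (a := f) (b := g) h
  rw [DirectSum.decompose_of_mem_same _ hfg] at h1
  rw [mul_left_cancel₀ hf h1]
  exact (DirectSum.decompose (weightedHomogeneousSubmodule ℂ (fun _ : Fin 4 => (2 : ℤ))) g n).2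

theorem divDiff_isWH (h : p ≠ q) {f : Poly} {n : ℤ}
    (hf : IsWeightedHomogeneous (fun _ : Fin 4 => (2 : ℤ)) f n) :
    IsWeightedHomogeneous (fun _ : Fin 4 => (2 : ℤ)) (divDiff p q f) (n + -2) := by
  refine isWH_of_mul (X_sub_ne h)
    ((isWeightedHomogeneous_X _ _ p).sub (isWeightedHomogeneous_X _ _ q)) (n := n + -2) ?_
  rw [divDiff_spec]
  have := hf.sub (rename_isWH (σ := Equiv.swap p q) hf)
  simpa using this

end Merges

/-! Graded bimodules -/

section Grading

variable {M : Type} [AddCommGroup M] {𝓜 : ℤ → AddSubgroup M}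

/-- A family of subgroups is a grading if it generates and the homogeneous components of an
element can be read off. -/
theorem isInternal_of (hspan : ∀ m, m ∈ ⨆ i, 𝓜 i) (ρ : M →+ (ℤ →₀ M))
    (hρ : ∀ i, ∀ m ∈ 𝓜 i, ρ m = Finsupp.single i m) : DirectSum.IsInternal 𝓜 := by
  have key : ∀ (x : DirectSum ℤ fun i => 𝓜 i) (j : ℤ),
      ρ (DirectSum.coeAddMonoidHom 𝓜 x) j = x j := by
    intro x j
    induction x using DirectSum.induction_on with
    | zero => simp
    | of i m =>
      rw [DirectSum.coeAddMonoidHom_of, hρ i m m.2, DirectSum.coe_of_apply, Finsupp.single_apply]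
      split_ifs <;> rfl
    | add x y hx hy => simp [hx, hy]
  constructor
  · intro x y h
    refine DFinsupp.ext fun j => Subtype.ext ?_
    rw [← key x j, ← key y j, h]
  · intro m
    have : (⨆ i, 𝓜 i) ≤ (DirectSum.coeAddMonoidHom 𝓜).range :=
      iSup_le fun i m hm => ⟨DirectSum.of (fun i => 𝓜 i) i ⟨m, hm⟩, by
        rw [DirectSum.coeAddMonoidHom_of]⟩
    exact this (hspan m)

theorem span_of_isInternal (h : DirectSum.IsInternal 𝓜) (m : M) : m ∈ ⨆ i, 𝓜 i := by
  obtain ⟨x, rfl⟩ := h.2 m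
  induction x using DirectSum.induction_on with
  | zero => simp
  | of i m =>
    rw [DirectSum.coeAddMonoidHom_of]
    exact (le_iSup 𝓜 i) m.2
  | add x y hx hy => rw [map_add]; exact add_mem hx hy

theorem exists_of_isInternal (h : DirectSum.IsInternal 𝓜) :
    ∃ ρ : M →+ (ℤ →₀ M), ∀ i, ∀ m ∈ 𝓜 i, ρ m = Finsupp.single i m := by
  let e := AddEquiv.ofBijective (DirectSum.coeAddMonoidHom 𝓜) h
  refine ⟨(DirectSum.toAddMonoid fun i =>
    (Finsupp.singleAddHom i).comp (𝓜 i).subtype).comp e.symm.toAddMonoidHom, fun i m hm => ?_⟩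
  have : e.symm m = DirectSum.of (fun i => 𝓜 i) i ⟨m, hm⟩ := by
    rw [AddEquiv.symm_apply_eq]
    exact (DirectSum.coeAddMonoidHom_of 𝓜 i ⟨m, hm⟩).symm
  simp [this]

theorem grading_induction (hspan : ∀ m, m ∈ ⨆ i, 𝓜 i) {p : M → Prop}
    (hp : ∀ i, ∀ m ∈ 𝓜 i, p m) (hz : p 0) (hadd : ∀ x y, p x → p y → p (x + y)) (m : M) : p m :=
  AddSubgroup.iSup_induction 𝓜 (C := p) (hspan m) hp hz hadd

end Grading

theorem Inv.isInternal (c : Fin 4 → ℕ) : DirectSum.IsInternal (Inv.piece c) := by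
  classical
  let w : Fin 4 → ℤ := fun _ => 2
  let comp (n : ℤ) : Inv c →+ Inv c :=
    { toFun := fun f => ⟨weightedHomogeneousComponent w n f, component_mem f.2 n⟩
      map_zero' := by ext1; simp
      map_add' := fun x y => by ext1; simp }
  have hfin : ∀ f : Inv c, {n | comp n f ≠ 0}.Finite := fun f =>
    (weightedHomogeneousComponent_finsupp (w := w) f.1).subset fun n hn h =>
      hn (Subtype.ext h)
  refine isInternal_of (fun f => ?_)
    { toFun := fun f => Finsupp.ofSupportFinite (fun n => comp n f) (hfin f)
      map_zero' := by ext1 n; exact map_zero (comp n)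
      map_add' := fun x y => by ext1 n; exact map_add (comp n) x y } fun i f hf => ?_
  · have h1 : f = ∑ n ∈ (hfin f).toFinset, comp n f := by
      apply Subtype.ext
      have h2 := sum_weightedHomogeneousComponent w f.1
      rw [finsum_eq_sum_of_support_subset (s := (hfin f).toFinset)] at h2
      · rw [← h2]; simp [comp]
      · intro n hn
        simp only [Set.Finite.coe_toFinset, Set.mem_ofPred_eq]
        exact fun h => hn (congrArg Subtype.val h)
    rw [h1]
    exact sum_mem fun n _ => (le_iSup (Inv.piece c) n)
      (weightedHomogeneousComponent_isWeightedHomogeneous (w := w) n f.1)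
  · ext1 n
    rw [Finsupp.single_apply]
    apply Subtype.ext
    split_ifs with h
    · subst h
      exact IsWeightedHomogeneous.weightedHomogeneousComponent_same hf
    · exact IsWeightedHomogeneous.weightedHomogeneousComponent_ne n hf (Ne.symm h)

/-- A graded `R_a`-`R_b`-bimodule (an `R_a ⊗_ℂ R_b`-module with a compatible `ℤ`-grading, the
`q`-grading). The right action of `R_b` is, as usual, an action of the opposite ring. -/
structure GBimod (a b : Fin 4 → ℕ) : Type 1 where
  /-- the underlying abelian group -/
  carrier : Type
  [addCommGroup : AddCommGroup carrier]
  [left : Module (Inv a) carrier]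
  [right : Module (Inv b)ᵐᵒᵖ carrier]
  [smulComm : SMulCommClass (Inv a) (Inv b)ᵐᵒᵖ carrier]
  central : ∀ (z : ℂ) (m : carrier),
    algebraMap ℂ (Inv a) z • m = MulOpposite.op (algebraMap ℂ (Inv b) z) • m
  /-- the homogeneous elements of degree `n` -/
  piece : ℤ → AddSubgroup carrier
  isInternal : DirectSum.IsInternal piece
  left_mem : ∀ {i j : ℤ} {r : Inv a} {m : carrier},
    r ∈ Inv.piece a i → m ∈ piece j → r • m ∈ piece (i + j)
  right_mem : ∀ {i j : ℤ} {r : Inv b} {m : carrier},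
    r ∈ Inv.piece b i → m ∈ piece j → MulOpposite.op r • m ∈ piece (i + j)

attribute [instance] GBimod.addCommGroup GBimod.left GBimod.right GBimod.smulComm

open MulOpposite

variable {a b c : Fin 4 → ℕ}

/-- A homomorphism of bimodules that raises the degree by `d`. -/
@[ext]
structure DHom (M N : GBimod a b) (d : ℤ) where
  /-- the underlying additive map -/
  toFun : M.carrier →+ N.carrier
  map_left : ∀ (r : Inv a) (m : M.carrier), toFun (r • m) = r • toFun m
  map_right : ∀ (r : Inv b) (m : M.carrier), toFun (op r • m) = op r • toFun m
  map_piece : ∀ (i : ℤ) (m : M.carrier), m ∈ M.piece i → toFun m ∈ N.piece (i + d)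

namespace DHom

variable {M N K : GBimod a b} {d e : ℤ}

/-- Composition, in diagrammatic order. -/
def comp (f : DHom M N d) (g : DHom N K e) : DHom M K (d + e) where
  toFun := g.toFun.comp f.toFun
  map_left r m := by simp [f.map_left, g.map_left]
  map_right r m := by simp [f.map_right, g.map_right]
  map_piece i m h := by
    have := g.map_piece _ _ (f.map_piece i m h)
    rwa [add_assoc] at this

instance : Zero (DHom M N d) := ⟨⟨0, by simp, by simp, by simp [zero_mem]⟩⟩

instance : Add (DHom M N d) := ⟨fun f g => ⟨f.toFun + g.toFun,
  by simp [f.map_left, g.map_left], by simp [f.map_right, g.map_right],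
  fun i m h => add_mem (f.map_piece i m h) (g.map_piece i m h)⟩⟩

instance : Neg (DHom M N d) := ⟨fun f => ⟨-f.toFun,
  by simp [f.map_left], by simp [f.map_right], fun i m h => neg_mem (f.map_piece i m h)⟩⟩

instance : AddCommGroup (DHom M N d) where
  add_assoc f g h := DHom.ext (add_assoc _ _ _)
  zero_add f := DHom.ext (zero_add _)
  add_zero f := DHom.ext (add_zero _)
  add_comm f g := DHom.ext (add_comm _ _)
  neg_add_cancel f := DHom.ext (neg_add_cancel _)
  nsmul := nsmulRec
  zsmul := zsmulRec

@[simp] theorem add_toFun (f g : DHom M N d) : (f + g).toFun = f.toFun + g.toFun := rfl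
@[simp] theorem neg_toFun (f : DHom M N d) : (-f).toFun = -f.toFun := rfl
@[simp] theorem zero_toFun : (0 : DHom M N d).toFun = 0 := rfl

end DHom

/-- The category of graded `R_a`-`R_b`-bimodules and degree-preserving bimodule maps. -/
instance : Category (GBimod a b) where
  Hom M N := DHom M N 0
  id M := ⟨AddMonoidHom.id _, fun _ _ => rfl, fun _ _ => rfl, fun i m h => by simpa using h⟩
  comp f g := ⟨g.toFun.comp f.toFun, fun r m => by simp [DHom.map_left],
    fun r m => by simp [DHom.map_right], fun i m h => by
      have := g.map_piece _ _ (f.map_piece i m h)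
      simpa using this⟩

theorem GBimod.hom_ext {M N : GBimod a b} {f g : M ⟶ N} (h : ∀ m, f.toFun m = g.toFun m) : f = g :=
  DHom.ext (AddMonoidHom.ext h)

@[simp] theorem GBimod.comp_toFun {M N K : GBimod a b} (f : M ⟶ N) (g : N ⟶ K) :
    DHom.toFun (f ≫ g) = g.toFun.comp f.toFun := rfl

@[simp] theorem GBimod.id_toFun (M : GBimod a b) :
    DHom.toFun (𝟙 M) = AddMonoidHom.id M.carrier := rfl

instance : Preadditive (GBimod a b) where
  homGroup M N := inferInstanceAs (AddCommGroup (DHom M N 0))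
  add_comp _ _ _ f f' g := GBimod.hom_ext fun m => map_add g.toFun (f.toFun m) (f'.toFun m)
  comp_add _ _ _ _ _ _ := rfl

namespace GBimod

/-- The shift `M{k}`: the component of degree `n` of `M{k}` is the component of degree `n - k` of
`M`. -/
def shift (k : ℤ) (M : GBimod a b) : GBimod a b where
  carrier := M.carrier
  central := M.central
  piece n := M.piece (n - k)
  isInternal := by
    obtain ⟨ρ, hρ⟩ := exists_of_isInternal M.isInternal
    refine isInternal_of (fun m => ?_)
      ((Finsupp.mapDomain.addMonoidHom fun i => i + k).comp ρ) fun i m hm => ?_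
    · have : (⨆ i, M.piece i) ≤ ⨆ i, M.piece (i - k) := iSup_le fun i => by
        have := le_iSup (fun i => M.piece (i - k)) (i + k)
        simpa using this
      exact this (span_of_isInternal M.isInternal m)
    · rw [AddMonoidHom.comp_apply, hρ _ _ hm]
      simp [Finsupp.mapDomain_single]
  left_mem {i j r m} hr hm := by rw [add_sub_assoc]; exact M.left_mem hr hm
  right_mem {i j r m} hr hm := by rw [add_sub_assoc]; exact M.right_mem hr hm

/-- The zero bimodule. -/
def zero (a b : Fin 4 → ℕ) : GBimod a b where
  carrier := PUnit
  central _ _ := rfl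
  piece _ := ⊤
  isInternal := isInternal_of (fun _ => zero_mem _) 0 fun i m _ => by ext
  left_mem _ _ := trivial
  right_mem _ _ := trivial

/-- The direct sum of two bimodules. -/
def prod (M N : GBimod a b) : GBimod a b where
  carrier := M.carrier × N.carrier
  central z m := Prod.ext (M.central z m.1) (N.central z m.2)
  piece n := (M.piece n).prod (N.piece n)
  isInternal := by
    obtain ⟨ρ, hρ⟩ := exists_of_isInternal M.isInternal
    obtain ⟨ρ', hρ'⟩ := exists_of_isInternal N.isInternal
    refine isInternal_of (fun m => ?_)
      (AddMonoidHom.coprod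
        ((Finsupp.mapRange.addMonoidHom (AddMonoidHom.inl M.carrier N.carrier)).comp ρ)
        ((Finsupp.mapRange.addMonoidHom (AddMonoidHom.inr M.carrier N.carrier)).comp ρ'))
      fun i m hm => ?_
    · have h1 : ∀ x : M.carrier, (x, (0 : N.carrier)) ∈
          ⨆ i, (M.piece i).prod (N.piece i) := fun x =>
        grading_induction (span_of_isInternal M.isInternal)
          (p := fun x : M.carrier => (x, (0 : N.carrier)) ∈ ⨆ i, (M.piece i).prod (N.piece i))
          (fun i x hx => (le_iSup (fun i => (M.piece i).prod (N.piece i)) i) ⟨hx, zero_mem _⟩)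
          (zero_mem _) (fun x y hx hy => by simpa using add_mem hx hy) x
      have h2 : ∀ x : N.carrier, ((0 : M.carrier), x) ∈
          ⨆ i, (M.piece i).prod (N.piece i) := fun x =>
        grading_induction (span_of_isInternal N.isInternal)
          (p := fun x : N.carrier => ((0 : M.carrier), x) ∈ ⨆ i, (M.piece i).prod (N.piece i))
          (fun i x hx => (le_iSup (fun i => (M.piece i).prod (N.piece i)) i) ⟨zero_mem _, hx⟩)
          (zero_mem _) (fun x y hx hy => by simpa using add_mem hx hy) x
      simpa using add_mem (h1 m.1) (h2 m.2)
    · rw [AddMonoidHom.coprod_apply, AddMonoidHom.comp_apply, AddMonoidHom.comp_apply,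
        hρ _ _ hm.1, hρ' _ _ hm.2]
      simp [← Finsupp.single_add]
  left_mem hr hm := ⟨M.left_mem hr hm.1, N.left_mem hr hm.2⟩
  right_mem hr hm := ⟨M.right_mem hr hm.1, N.right_mem hr hm.2⟩

/-- `R_s` as a left `R_a`-module, for `s` refining `a`. -/
abbrev regLeft {s a : Fin 4 → ℕ} (h : Refines s a) : Module (Inv a) (Inv s) :=
  Module.compHom (Inv s) (Subalgebra.inclusion h.le).toRingHom

/-- `R_s` as a right `R_b`-module, for `s` refining `b`. -/
abbrev regRight {s b : Fin 4 → ℕ} (h : Refines s b) : Module (Inv b)ᵐᵒᵖ (Inv s) :=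
  Module.compHom (Inv s) ((Subalgebra.inclusion h.le).toRingHom.comp
    (RingEquiv.toOpposite (Inv b)).symm.toRingHom)

theorem regComm {s a b : Fin 4 → ℕ} (ha : Refines s a) (hb : Refines s b) :
    letI := regLeft ha
    letI := regRight hb
    SMulCommClass (Inv a) (Inv b)ᵐᵒᵖ (Inv s) := by
  let _ := regLeft ha
  let _ := regRight hb
  exact ⟨fun x y m =>
    mul_left_comm (Subalgebra.inclusion ha.le x) (Subalgebra.inclusion hb.le y.unop) m⟩

/-- The ring `R_s` as an `R_a`-`R_b`-bimodule, for `s` refining `a` and `b`. -/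
def reg (a s b : Fin 4 → ℕ) (ha : Refines s a) (hb : Refines s b) : GBimod a b where
  carrier := Inv s
  left := regLeft ha
  right := regRight hb
  smulComm := regComm ha hb
  central _ _ := rfl
  piece := Inv.piece s
  isInternal := Inv.isInternal s
  left_mem hr hm := IsWeightedHomogeneous.mul hr hm
  right_mem hr hm := IsWeightedHomogeneous.mul hr hm

end GBimod

open MulOpposite TensorProduct

namespace GBimod

variable {a b c : Fin 4 → ℕ}

/-- The underlying group of an `R_a`-`R_b`-bimodule, as a module over the commutative ring `R_b`
acting on the right. -/
def Right (M : GBimod a b) : Type := M.carrier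

instance (M : GBimod a b) : AddCommGroup M.Right := M.addCommGroup

instance (M : GBimod a b) : Module (Inv b) M.Right :=
  @Module.compHom (Inv b)ᵐᵒᵖ (Inv b) M.carrier _ _ M.right _ (RingEquiv.toOpposite (Inv b)).toRingHom

theorem Right.smul_def (M : GBimod a b) (r : Inv b) (m : M.carrier) :
    (r • (show M.Right from m) : M.Right) = (op r • m : M.carrier) := rfl

/-- The left action of `R_a` on an `R_a`-`R_b`-bimodule commutes with the right action. -/
def lact (M : GBimod a b) : Inv a →+* Module.End (Inv b) M.Right where
  toFun r :=
    { toFun := fun m => (r • (show M.carrier from m) : M.carrier)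
      map_add' := fun x y => smul_add r (show M.carrier from x) (show M.carrier from y)
      map_smul' := fun s m => smul_comm r (op s) (show M.carrier from m) }
  map_zero' := LinearMap.ext fun m => zero_smul (Inv a) (show M.carrier from m)
  map_one' := LinearMap.ext fun m => one_smul (Inv a) (show M.carrier from m)
  map_add' x y := LinearMap.ext fun m => add_smul x y (show M.carrier from m)
  map_mul' x y := LinearMap.ext fun m => mul_smul x y (show M.carrier from m)

/-- The right action of `R_c` on an `R_b`-`R_c`-bimodule commutes with the left action. -/
def ract (N : GBimod b c) : (Inv c)ᵐᵒᵖ →+* Module.End (Inv b) N.carrier where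
  toFun r :=
    { toFun := fun m => r • m
      map_add' := fun x y => smul_add r x y
      map_smul' := fun s m => (smul_comm s r m).symm }
  map_zero' := LinearMap.ext fun m => zero_smul (Inv c)ᵐᵒᵖ m
  map_one' := LinearMap.ext fun m => one_smul (Inv c)ᵐᵒᵖ m
  map_add' x y := LinearMap.ext fun m => add_smul x y m
  map_mul' x y := LinearMap.ext fun m => mul_smul x y m

/-- The underlying group of `M ⊗_{R_b} N`. -/
def TensorCarrier (M : GBimod a b) (N : GBimod b c) : Type := M.Right ⊗[Inv b] N.carrier

instance (M : GBimod a b) (N : GBimod b c) : AddCommGroup (TensorCarrier M N) :=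
  inferInstanceAs (AddCommGroup (M.Right ⊗[Inv b] N.carrier))

/-- The pure tensor `m ⊗ n`. -/
def tmul {M : GBimod a b} {N : GBimod b c} (m : M.carrier) (n : N.carrier) : TensorCarrier M N :=
  TensorProduct.tmul (Inv b) (show M.Right from m) n

/-- The additive map `M ⊗_{R_b} N → P` given by a balanced biadditive map. -/
def tlift {M : GBimod a b} {N : GBimod b c} {P : Type} [AddCommGroup P]
    (f : M.carrier →+ N.carrier →+ P)
    (hf : ∀ (r : Inv b) (m : M.carrier) (n : N.carrier), f (op r • m) n = f m (r • n)) :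
    TensorCarrier M N →+ P :=
  TensorProduct.liftAddHom (R := Inv b) (M := M.Right) (N := N.carrier) f hf

section

variable {M : GBimod a b} {N : GBimod b c}

@[simp] theorem tlift_tmul {P : Type} [AddCommGroup P] (f : M.carrier →+ N.carrier →+ P)
    (hf : ∀ (r : Inv b) (m : M.carrier) (n : N.carrier), f (op r • m) n = f m (r • n))
    (m : M.carrier) (n : N.carrier) : tlift f hf (tmul m n) = f m n := rfl

theorem add_tmul (m m' : M.carrier) (n : N.carrier) : tmul (m + m') n = tmul m n + tmul m' n :=
  TensorProduct.add_tmul (R := Inv b) (M := M.Right) m m' n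

theorem tmul_add (m : M.carrier) (n n' : N.carrier) : tmul m (n + n') = tmul m n + tmul m n' :=
  TensorProduct.tmul_add (R := Inv b) (M := M.Right) m n n'

theorem smul_tmul (r : Inv b) (m : M.carrier) (n : N.carrier) :
    tmul (op r • m) n = tmul m (r • n) :=
  TensorProduct.smul_tmul (R := Inv b) (M := M.Right) r m n

/-- `tmul` as a biadditive map. -/
def tmulHom (M : GBimod a b) (N : GBimod b c) : M.carrier →+ N.carrier →+ TensorCarrier M N :=
  AddMonoidHom.mk' (fun m => AddMonoidHom.mk' (tmul m) (tmul_add m))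
    fun m m' => AddMonoidHom.ext (add_tmul m m')

@[simp] theorem tmulHom_apply (m : M.carrier) (n : N.carrier) : tmulHom M N m n = tmul m n := rfl

theorem tensor_induction {p : TensorCarrier M N → Prop}
    (hp : ∀ (m : M.carrier) (n : N.carrier), p (tmul m n)) (hadd : ∀ x y, p x → p y → p (x + y))
    (t : TensorCarrier M N) : p t :=
  TensorProduct.induction_on (motive := p) t
    (by have := hp 0 0; rwa [show (tmul 0 0 : TensorCarrier M N) = 0 from TensorProduct.zero_tmul _ _] at this)
    hp hadd

theorem tensor_hom_ext {P : Type} [AddCommGroup P] {f g : TensorCarrier M N →+ P}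
    (h : ∀ (m : M.carrier) (n : N.carrier), f (tmul m n) = g (tmul m n)) : f = g :=
  AddMonoidHom.ext fun t => tensor_induction (p := fun t => f t = g t) h
    (fun x y hx hy => by rw [map_add, map_add, hx, hy]) t

instance : Module (Inv a) (TensorCarrier M N) where
  smul r := LinearMap.rTensor N.carrier (M.lact r)
  one_smul t := by
    change LinearMap.rTensor N.carrier (M.lact 1) t = t
    rw [map_one]; exact DFunLike.congr_fun (LinearMap.rTensor_id N.carrier M.Right) t
  mul_smul x y t := by
    change LinearMap.rTensor N.carrier (M.lact (x * y)) t = _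
    rw [map_mul]; rw [LinearMap.rTensor_mul]; rfl
  smul_zero r := map_zero (LinearMap.rTensor N.carrier (M.lact r))
  smul_add r := map_add (LinearMap.rTensor N.carrier (M.lact r))
  add_smul x y t := by
    change LinearMap.rTensor N.carrier (M.lact (x + y)) t = _
    rw [map_add, LinearMap.rTensor_add]; rfl
  zero_smul t := by
    change LinearMap.rTensor N.carrier (M.lact 0) t = _
    rw [map_zero, LinearMap.rTensor_zero]; rfl

instance : Module (Inv c)ᵐᵒᵖ (TensorCarrier M N) where
  smul r := LinearMap.lTensor M.Right (N.ract r)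
  one_smul t := by
    change LinearMap.lTensor M.Right (N.ract 1) t = t
    rw [map_one]; exact DFunLike.congr_fun (LinearMap.lTensor_id M.Right N.carrier) t
  mul_smul x y t := by
    change LinearMap.lTensor M.Right (N.ract (x * y)) t = _
    rw [map_mul]; rw [LinearMap.lTensor_mul]; rfl
  smul_zero r := map_zero (LinearMap.lTensor M.Right (N.ract r))
  smul_add r := map_add (LinearMap.lTensor M.Right (N.ract r))
  add_smul x y t := by
    change LinearMap.lTensor M.Right (N.ract (x + y)) t = _
    rw [map_add, LinearMap.lTensor_add]; rfl
  zero_smul t := by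
    change LinearMap.lTensor M.Right (N.ract 0) t = _
    rw [map_zero, LinearMap.lTensor_zero]; rfl

theorem left_tmul (r : Inv a) (m : M.carrier) (n : N.carrier) : r • tmul m n = tmul (r • m) n := rfl

theorem right_tmul (r : Inv c) (m : M.carrier) (n : N.carrier) :
    op r • tmul m n = tmul m (op r • n) := rfl

instance : SMulCommClass (Inv a) (Inv c)ᵐᵒᵖ (TensorCarrier M N) where
  smul_comm x y t := tensor_induction (p := fun t => x • y • t = y • x • t) (fun _ _ => rfl)
    (fun s t hs ht => by rw [smul_add, smul_add, hs, ht, smul_add, smul_add]) t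

/-- The degree `n` part of `M ⊗ N` is generated by the tensors `x ⊗ y` of homogeneous elements with
`deg x + deg y = n`. -/
def tensorPiece (M : GBimod a b) (N : GBimod b c) (n : ℤ) : AddSubgroup (TensorCarrier M N) :=
  AddSubgroup.closure {t | ∃ i j, i + j = n ∧ ∃ x ∈ M.piece i, ∃ y ∈ N.piece j, tmul x y = t}

theorem tmul_mem {i j : ℤ} {x : M.carrier} {y : N.carrier} (hx : x ∈ M.piece i)
    (hy : y ∈ N.piece j) : tmul x y ∈ tensorPiece M N (i + j) :=
  AddSubgroup.subset_closure ⟨i, j, rfl, x, hx, y, hy, rfl⟩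

theorem tensor_isInternal : DirectSum.IsInternal (tensorPiece M N) := by
  obtain ⟨ρ, hρ⟩ := exists_of_isInternal M.isInternal
  obtain ⟨ρ', hρ'⟩ := exists_of_isInternal N.isInternal
  let f : M.carrier →+ N.carrier →+ (ℤ →₀ TensorCarrier M N) :=
    ((Finsupp.liftAddHom fun i => (AddMonoidHom.flip (Finsupp.liftAddHom fun j =>
      AddMonoidHom.flip ((AddMonoidHom.compHom (Finsupp.singleAddHom (i + j))).comp
        (tmulHom M N))))).comp ρ).compr₂ (AddMonoidHom.id _) |>.compl₂ ρ'
  have hf : ∀ i j, ∀ m ∈ M.piece i, ∀ n ∈ N.piece j,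
      f m n = Finsupp.single (i + j) (tmul m n) := by
    intro i j m hm n hn
    simp [f, hρ i m hm, hρ' j n hn]
  have hbal : ∀ (r : Inv b) (m : M.carrier) (n : N.carrier), f (op r • m) n = f m (r • n) := by
    intro r m n
    induction m using grading_induction (span_of_isInternal M.isInternal) with
    | hz => simp
    | hadd x y hx hy => rw [smul_add, map_add, map_add, AddMonoidHom.add_apply, hx, hy]; rfl
    | hp i m hm =>
    induction n using grading_induction (span_of_isInternal N.isInternal) with
    | hz => simp
    | hadd x y hx hy => rw [smul_add, map_add, map_add, hx, hy]
    | hp j n hn =>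
    induction r using grading_induction (span_of_isInternal (Inv.isInternal b)) with
    | hz => simp
    | hadd x y hx hy => rw [MulOpposite.op_add, add_smul, add_smul, map_add, map_add, ← hx, ← hy]; rfl
    | hp k r hr =>
    rw [hf _ _ _ (M.right_mem hr hm) _ hn, hf _ _ _ hm _ (N.left_mem hr hn), smul_tmul]
    congr 1; ring
  refine isInternal_of (fun t => ?_) (tlift f hbal) fun n t ht => ?_
  · induction t using tensor_induction with
    | hadd x y hx hy => exact add_mem hx hy
    | hp m n =>
    induction m using grading_induction (span_of_isInternal M.isInternal) with
    | hz => rw [← tmulHom_apply, map_zero]; exact zero_mem _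
    | hadd x y hx hy => rw [add_tmul]; exact add_mem hx hy
    | hp i m hm =>
    induction n using grading_induction (span_of_isInternal N.isInternal) with
    | hz => rw [← tmulHom_apply, map_zero]; exact zero_mem _
    | hadd x y hx hy => rw [tmul_add]; exact add_mem hx hy
    | hp j n hn => exact (le_iSup (tensorPiece M N) (i + j)) (tmul_mem hm hn)
  · induction ht using AddSubgroup.closure_induction with
    | mem t ht =>
      obtain ⟨i, j, rfl, x, hx, y, hy, rfl⟩ := ht
      rw [tlift_tmul, hf _ _ _ hx _ hy]
    | zero => simp
    | add x y _ _ hx hy => rw [map_add, hx, hy, Finsupp.single_add]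
    | neg x _ hx => rw [map_neg, hx, Finsupp.single_neg]

/-- The tensor product `M ⊗_{R_b} N` of graded bimodules. -/
def tensor (M : GBimod a b) (N : GBimod b c) : GBimod a c where
  carrier := TensorCarrier M N
  central z t := tensor_induction (p := fun t => algebraMap ℂ (Inv a) z • t =
      op (algebraMap ℂ (Inv c) z) • t)
    (fun m n => by rw [left_tmul, right_tmul, M.central, smul_tmul, N.central])
    (fun x y hx hy => by rw [smul_add, smul_add, hx, hy]) t
  piece := tensorPiece M N
  isInternal := tensor_isInternal
  left_mem {i n r t} hr ht := by
    induction ht using AddSubgroup.closure_induction with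
    | mem t ht =>
      obtain ⟨j, k, rfl, x, hx, y, hy, rfl⟩ := ht
      rw [← add_assoc]
      exact tmul_mem (M.left_mem hr hx) hy
    | zero => rw [smul_zero]; exact zero_mem _
    | add x y _ _ hx hy => rw [smul_add]; exact add_mem hx hy
    | neg x _ hx => rw [smul_neg]; exact neg_mem hx
  right_mem {i n r t} hr ht := by
    induction ht using AddSubgroup.closure_induction with
    | mem t ht =>
      obtain ⟨j, k, rfl, x, hx, y, hy, rfl⟩ := ht
      rw [add_left_comm]
      exact tmul_mem hx (N.right_mem hr hy)
    | zero => rw [smul_zero]; exact zero_mem _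
    | add x y _ _ hx hy => rw [smul_add]; exact add_mem hx hy
    | neg x _ hx => rw [smul_neg]; exact neg_mem hx

theorem tlift_mem {P : GBimod a c} {d : ℤ} (f : M.carrier →+ N.carrier →+ P.carrier)
    (hf : ∀ (r : Inv b) (m : M.carrier) (n : N.carrier), f (op r • m) n = f m (r • n))
    (h : ∀ i j, ∀ m ∈ M.piece i, ∀ n ∈ N.piece j, f m n ∈ P.piece (i + j + d))
    (n : ℤ) (t : TensorCarrier M N) (ht : t ∈ tensorPiece M N n) :
    tlift f hf t ∈ P.piece (n + d) := by
  induction ht using AddSubgroup.closure_induction with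
  | mem t ht =>
    obtain ⟨i, j, rfl, x, hx, y, hy, rfl⟩ := ht
    exact h i j x hx y hy
  | zero => rw [map_zero]; exact zero_mem _
  | add x y _ _ hx hy => rw [map_add]; exact add_mem hx hy
  | neg x _ hx => rw [map_neg]; exact neg_mem hx

end

end GBimod

namespace DHom

open GBimod

variable {a b c : Fin 4 → ℕ} {d : ℤ}

/-- The bimodule map `M ⊗_{R_b} N → P` given by a balanced biadditive bilinear map. -/
def lift {M : GBimod a b} {N : GBimod b c} {P : GBimod a c}
    (f : M.carrier →+ N.carrier →+ P.carrier)
    (hf : ∀ (r : Inv b) (m : M.carrier) (n : N.carrier), f (op r • m) n = f m (r • n))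
    (hl : ∀ (r : Inv a) (m : M.carrier) (n : N.carrier), f (r • m) n = r • f m n)
    (hr : ∀ (r : Inv c) (m : M.carrier) (n : N.carrier), f m (op r • n) = op r • f m n)
    (h : ∀ i j, ∀ m ∈ M.piece i, ∀ n ∈ N.piece j, f m n ∈ P.piece (i + j + d)) :
    DHom (M.tensor N) P d where
  toFun := tlift f hf
  map_left r t := tensor_induction
    (p := fun t : TensorCarrier M N => tlift f hf (r • t) = r • tlift f hf t) (fun m n => hl r m n)
    (fun x y hx hy => by rw [smul_add, map_add, map_add, hx, hy, smul_add]) t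
  map_right r t := tensor_induction
    (p := fun t : TensorCarrier M N => tlift f hf (op r • t) = op r • tlift f hf t)
    (fun m n => hr r m n)
    (fun x y hx hy => by rw [smul_add, map_add, map_add, hx, hy, smul_add]) t
  map_piece := tlift_mem f hf h

/-- The map `f ⊗ id : M ⊗ N → M' ⊗ N`. -/
def tensorRight {M M' : GBimod a b} (f : DHom M M' d) (N : GBimod b c) :
    DHom (M.tensor N) (M'.tensor N) d :=
  lift (M := M) (N := N) (P := M'.tensor N) ((tmulHom M' N).comp f.toFun)
    (fun r m n => by
      change tmul (f.toFun (op r • m)) n = tmul (f.toFun m) (r • n)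
      rw [f.map_right, smul_tmul])
    (fun r m n => by
      change tmul (f.toFun (r • m)) n = r • tmul (f.toFun m) n
      rw [f.map_left, left_tmul])
    (fun r m n => rfl)
    (fun i j m hm n hn => by
      rw [add_right_comm]
      exact tmul_mem (f.map_piece _ _ hm) hn)

/-- The map `id ⊗ f : M ⊗ N → M ⊗ N'`. -/
def tensorLeft {N N' : GBimod b c} (M : GBimod a b) (f : DHom N N' d) :
    DHom (M.tensor N) (M.tensor N') d :=
  lift (M := M) (N := N) (P := M.tensor N') ((tmulHom M N').compl₂ f.toFun)
    (fun r m n => by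
      change tmul (op r • m) (f.toFun n) = tmul m (f.toFun (r • n))
      rw [f.map_left, smul_tmul])
    (fun r m n => rfl)
    (fun r m n => by
      change tmul m (f.toFun (op r • n)) = op r • tmul m (f.toFun n)
      rw [f.map_right, right_tmul])
    (fun i j m hm n hn => by
      rw [add_assoc]
      exact tmul_mem hm (f.map_piece _ _ hn))

/-- A map raising the degree by `d` is a degree-preserving map `M{i} → N{j}` for `i = j + d`. -/
def toShift {M N : GBimod a b} (f : DHom M N d) (i j : ℤ) (h : i = j + d) :
    M.shift i ⟶ N.shift j :=
  (⟨f.toFun, f.map_left, f.map_right, fun n m hm => by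
    have := f.map_piece _ m hm
    have e : n - i + d = n + 0 - j := by rw [h]; ring
    rwa [e] at this⟩ : DHom (M.shift i) (N.shift j) 0)

@[simp] theorem tensorRight_tmul {M M' : GBimod a b} (f : DHom M M' d) (N : GBimod b c)
    (m : M.carrier) (n : N.carrier) :
    (f.tensorRight N).toFun (tmul m n) = tmul (f.toFun m) n := rfl

@[simp] theorem tensorLeft_tmul {N N' : GBimod b c} (M : GBimod a b) (f : DHom N N' d)
    (m : M.carrier) (n : N.carrier) :
    (f.tensorLeft M).toFun (tmul m n) = tmul m (f.toFun n) := rfl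

end DHom

namespace GBimod

variable {a b c : Fin 4 → ℕ}

/-- The functor `M ⊗_{R_b} -`. -/
def tensorLeft (M : GBimod a b) (c : Fin 4 → ℕ) : GBimod b c ⥤ GBimod a c where
  obj N := M.tensor N
  map f := DHom.tensorLeft M f
  map_id _ := DHom.ext (tensor_hom_ext fun _ _ => rfl)
  map_comp _ _ := DHom.ext (tensor_hom_ext fun _ _ => rfl)

/-- The functor `- ⊗_{R_b} N`. -/
def tensorRight (a : Fin 4 → ℕ) (N : GBimod b c) : GBimod a b ⥤ GBimod a c where
  obj M := M.tensor N
  map f := DHom.tensorRight f N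
  map_id _ := DHom.ext (tensor_hom_ext fun _ _ => rfl)
  map_comp _ _ := DHom.ext (tensor_hom_ext fun _ _ => rfl)

instance (M : GBimod a b) : (tensorLeft M c).Additive where
  map_add := DHom.ext (tensor_hom_ext fun _ _ => tmul_add _ _ _)

instance (N : GBimod b c) : (tensorRight a N).Additive where
  map_add := DHom.ext (tensor_hom_ext fun _ _ => add_tmul _ _ _)

end GBimod

/-! Elementary bimodule maps -/

open MulOpposite

section Maps

open GBimod

variable {x y a s t u : Fin 4 → ℕ}

/-- The inclusion `R_s ⊆ R_t`, for `t` refining `s` (the creation of a digon). -/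
def inclHom (hx : Refines s x) (hy : Refines s y) (h : Refines t s) :
    DHom (reg x s y hx hy) (reg x t y (h.trans hx) (h.trans hy)) 0 where
  toFun := (Subalgebra.inclusion h.le : Inv s →+ Inv t)
  map_left _ _ := rfl
  map_right _ _ := rfl
  map_piece _ _ hm := by rw [add_zero]; exact hm

/-- The projection `R_u → R_t{2}` onto the second summand of the decomposition
`R_u = R_t ⊕ x_p R_t`, where `t` arises from `u` by merging the blocks `{p}` and `{q}`. It is the
divided difference: for `g, h ∈ R_t` the divided difference of `g + x_p h` is `h`. -/
def projHom {p q : Fin 4} (h : Merges u t p q) (hx : Refines t x) (hy : Refines t y) :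
    DHom (reg x u y (h.refines.trans hx) (h.refines.trans hy)) (reg x t y hx hy) (-2) where
  toFun := AddMonoidHom.mk' (fun f : Inv u => (⟨divDiff p q f, h.divDiff_mem f.2⟩ : Inv t))
    fun f g => Subtype.ext (divDiff_add h.1 f.1 g.1)
  map_left r f := Subtype.ext (h.divDiff_mul (hx.le r.2) f.1)
  map_right r f := Subtype.ext (h.divDiff_mul (hy.le r.2) f.1)
  map_piece _ _ hf := divDiff_isWH h.1 hf

/-- The pure tensor `m ⊗ n ∈ R_u ⊗_{R_a} R_t`, as a biadditive map. -/
def regTmul (hx : Refines u x) (hu : Refines u a) (ht : Refines t a) (hy : Refines t y) :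
    Inv u →+ Inv t →+ TensorCarrier (reg x u a hx hu) (reg a t y ht hy) :=
  tmulHom (reg x u a hx hu) (reg a t y ht hy)

section RegTmul

variable (hx : Refines u x) (hu : Refines u a) (ht : Refines t a) (hy : Refines t y)

theorem regTmul_balanced (r : Inv a) (m : Inv u) (n : Inv t) :
    regTmul hx hu ht hy (m * Subalgebra.inclusion hu.le r) n =
      regTmul hx hu ht hy m (Subalgebra.inclusion ht.le r * n) := by
  rw [mul_comm]
  exact smul_tmul (M := reg x u a hx hu) (N := reg a t y ht hy) r m n

theorem smul_regTmul (r : Inv x) (m : Inv u) (n : Inv t) :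
    r • regTmul hx hu ht hy m n = regTmul hx hu ht hy (Subalgebra.inclusion hx.le r * m) n := rfl

theorem op_smul_regTmul (r : Inv y) (m : Inv u) (n : Inv t) :
    op r • regTmul hx hu ht hy m n = regTmul hx hu ht hy m (Subalgebra.inclusion hy.le r * n) := rfl

theorem regTmul_mem {i j : ℤ} {m : Inv u} {n : Inv t} (hm : m ∈ Inv.piece u i)
    (hn : n ∈ Inv.piece t j) :
    regTmul hx hu ht hy m n ∈ tensorPiece (reg x u a hx hu) (reg a t y ht hy) (i + j) :=
  tmul_mem (M := reg x u a hx hu) (N := reg a t y ht hy) hm hn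

end RegTmul

/-- The canonical map `R_u → R_u ⊗_{R_s} R_s`, `f ↦ f ⊗ 1`, for `u` refining `s`. -/
def unitHom (hx : Refines u x) (hu : Refines u s) (hy : Refines s y) :
    DHom (reg x u y hx (hu.trans hy))
      ((reg x u s hx hu).tensor (reg s s y (Refines.refl s) hy)) 0 where
  toFun := (regTmul hx hu (Refines.refl s) hy).flip 1
  map_left r f := rfl
  map_right r (f : Inv u) := by
    have h1 := regTmul_balanced hx hu (Refines.refl s) hy (Subalgebra.inclusion hy.le r) f 1
    rw [mul_comm f] at h1
    exact h1
  map_piece i f hf := regTmul_mem hx hu (Refines.refl s) hy hf (isWeightedHomogeneous_one _ _)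

variable {T : Finset (Fin 4)} {k : Fin 4}

/-- The variable `x_k` as an element of `R_s`. -/
def Splits.var (h : Splits a s T k) : Inv s := ⟨X k, X_mem h.2.1 h.1⟩

/-- The elementary symmetric polynomial `e_j(x_t : t ∈ T)` as an element of `R_s`. -/
def Splits.elem (h : Splits a s T k) (j : ℕ) : Inv s := ⟨esymmOn T j, esymmOn_mem h.2.1 j⟩

/-- The map `m ⊗ n ↦ m Δ n` where
`Δ = ∑_j (-1)^j x_k^{|T| - j} ⊗ e_j(x_t : t ∈ T) ∈ R_s ⊗_{R_a} R_s`. -/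
def comulAdd (h : Splits a s T k) (hx : Refines u x) (hu : Refines u s) (ht : Refines t s)
    (hy : Refines t y) :
    Inv u →+ Inv t →+ TensorCarrier (reg x u a hx (hu.trans h.refines))
      (reg a t y (ht.trans h.refines) hy) :=
  ∑ j ∈ Finset.range (T.card + 1), (-1 : ℤ) ^ j •
    (((regTmul hx (hu.trans h.refines) (ht.trans h.refines) hy).comp
      (AddMonoidHom.mulRight (Subalgebra.inclusion hu.le (h.var ^ (T.card - j))))).compl₂
        (AddMonoidHom.mulLeft (Subalgebra.inclusion ht.le (h.elem j))))

section Comul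

variable (h : Splits a s T k) (hx : Refines u x) (hu : Refines u s) (ht : Refines t s)
  (hy : Refines t y)

theorem comulAdd_apply (m : Inv u) (n : Inv t) :
    comulAdd h hx hu ht hy m n = ∑ j ∈ Finset.range (T.card + 1), (-1 : ℤ) ^ j •
      regTmul hx (hu.trans h.refines) (ht.trans h.refines) hy
        (m * Subalgebra.inclusion hu.le (h.var ^ (T.card - j)))
        (Subalgebra.inclusion ht.le (h.elem j) * n) := by
  simp only [comulAdd, AddMonoidHom.finsetSum_apply]
  rfl

theorem comulAdd_var (m : Inv u) (n : Inv t) :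
    comulAdd h hx hu ht hy (m * Subalgebra.inclusion hu.le h.var) n =
      comulAdd h hx hu ht hy m (Subalgebra.inclusion ht.le h.var * n) := by
  let E (j : ℕ) : Inv a := ⟨esymmOn (insert k T) j, esymmOn_mem h.2.2 j⟩
  let ι : Inv s →ₐ[ℂ] Inv u := Subalgebra.inclusion hu.le
  let ι' : Inv s →ₐ[ℂ] Inv t := Subalgebra.inclusion ht.le
  let τ := regTmul hx (hu.trans h.refines) (ht.trans h.refines) hy
  let c (j : ℕ) : TensorCarrier (reg x u a hx (hu.trans h.refines))
      (reg a t y (ht.trans h.refines) hy) :=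
    (-1 : ℤ) ^ j • τ (m * (ι h.var ^ (T.card + 1 - j) * ι (h.elem j)) : Inv u) n
  let g (j : ℕ) : TensorCarrier (reg x u a hx (hu.trans h.refines))
      (reg a t y (ht.trans h.refines) hy) :=
    (-1 : ℤ) ^ j • τ (m * ι h.var ^ (T.card + 1 - j) : Inv u) (ι' (h.elem j) * n : Inv t)
  have htop : h.elem (T.card + 1) = 0 := Subtype.ext (esymmOn_of_card_lt (Nat.lt_succ_self _))
  have hE : ∀ j, Subalgebra.inclusion h.refines.le (E (j + 1)) =
      h.elem (j + 1) + h.var * h.elem j := fun j => Subtype.ext (esymmOn_insert h.1 j)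
  have h0 : c 0 = g 0 := by
    have : h.elem 0 = 1 := Subtype.ext (esymmOn_zero T)
    simp [c, g, this]
  have hlast : c (T.card + 1) = 0 := by
    simp only [c, htop, map_zero, mul_zero, smul_zero, AddMonoidHom.zero_apply]
  have hglast : g (T.card + 1) = 0 := by
    simp only [g, htop, map_zero, zero_mul, smul_zero]
  have hl : comulAdd h hx hu ht hy (m * ι h.var) n = ∑ j ∈ Finset.range (T.card + 1), g j := by
    rw [comulAdd_apply]
    refine Finset.sum_congr rfl fun j hj => ?_
    have hj' : T.card + 1 - j = T.card - j + 1 := by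
      have := Finset.mem_range.1 hj; omega
    simp only [g, hj']
    congr 2
    rw [map_pow, mul_assoc, pow_succ']
  have hr : comulAdd h hx hu ht hy m (ι' h.var * n) =
      ∑ j ∈ Finset.range (T.card + 1), ((c j - c (j + 1)) + g (j + 1)) := by
    rw [comulAdd_apply]
    refine Finset.sum_congr rfl fun j hj => ?_
    have hj' : T.card + 1 - j = T.card - j + 1 := by
      have := Finset.mem_range.1 hj; omega
    have hj'' : T.card + 1 - (j + 1) = T.card - j := by omega
    have e1 : (ι' (h.elem j) * (ι' h.var * n) : Inv t) =
        Subalgebra.inclusion (ht.trans h.refines).le (E (j + 1)) * n - ι' (h.elem (j + 1)) * n := by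
      have h2 : Subalgebra.inclusion (ht.trans h.refines).le (E (j + 1)) =
          ι' (h.elem (j + 1) + h.var * h.elem j) := by rw [← hE]; rfl
      rw [h2, map_add, map_mul]; ring
    have e2 : ∀ z : Inv u, τ z (Subalgebra.inclusion (ht.trans h.refines).le (E (j + 1)) * n : Inv t)
        = τ (z * ι (h.elem (j + 1)) + z * (ι h.var * ι (h.elem j)) : Inv u) n := by
      intro z
      rw [← map_mul, ← mul_add, ← map_add, ← hE]
      exact (regTmul_balanced hx (hu.trans h.refines) (ht.trans h.refines) hy (E (j + 1)) z n).symm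
    change (-1 : ℤ) ^ j • τ (m * ι (h.var ^ (T.card - j)) : Inv u)
      (ι' (h.elem j) * (ι' h.var * n) : Inv t) = _
    rw [e1, map_sub, e2, map_add, AddMonoidHom.add_apply]
    simp only [c, g, hj', hj'', map_pow, pow_succ, smul_sub, smul_add]
    rw [show m * ι h.var ^ (T.card - j) * (ι h.var * ι (h.elem j)) =
      m * (ι h.var ^ (T.card - j) * ι h.var * ι (h.elem j)) by ring,
      show m * ι h.var ^ (T.card - j) * ι (h.elem (j + 1)) =
      m * (ι h.var ^ (T.card - j) * ι (h.elem (j + 1))) by ring]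
    simp only [mul_neg, mul_one, neg_smul]
    abel
  change comulAdd h hx hu ht hy (m * ι h.var) n = comulAdd h hx hu ht hy m (ι' h.var * n)
  rw [hl, hr, Finset.sum_add_distrib, Finset.sum_range_sub', hlast, sub_zero, h0, add_comm (g 0),
    ← Finset.sum_range_succ' g, Finset.sum_range_succ g (T.card + 1), hglast, add_zero]

theorem comulAdd_balanced (r : Inv s) (m : Inv u) (n : Inv t) :
    comulAdd h hx hu ht hy (m * Subalgebra.inclusion hu.le r) n =
      comulAdd h hx hu ht hy m (Subalgebra.inclusion ht.le r * n) := by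
  have key : ∀ p ∈ Algebra.adjoin ℂ ((Inv a : Set Poly) ∪ {X k}), ∃ hp : p ∈ Inv s,
      ∀ (m : Inv u) (n : Inv t),
        comulAdd h hx hu ht hy (m * Subalgebra.inclusion hu.le ⟨p, hp⟩) n =
        comulAdd h hx hu ht hy m (Subalgebra.inclusion ht.le ⟨p, hp⟩ * n) := by
    have base : ∀ r : Inv a, ∀ (m : Inv u) (n : Inv t),
        comulAdd h hx hu ht hy (m * Subalgebra.inclusion hu.le ⟨r, h.refines.le r.2⟩) n =
        comulAdd h hx hu ht hy m (Subalgebra.inclusion ht.le ⟨r, h.refines.le r.2⟩ * n) := by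
      intro r m n
      rw [comulAdd_apply, comulAdd_apply]
      refine Finset.sum_congr rfl fun j _ => ?_
      have h1 := regTmul_balanced hx (hu.trans h.refines) (ht.trans h.refines) hy r
        (m * Subalgebra.inclusion hu.le (h.var ^ (T.card - j)))
        (Subalgebra.inclusion ht.le (h.elem j) * n)
      rw [mul_right_comm] at h1
      rw [mul_left_comm]
      exact congrArg _ h1
    intro p hp
    induction hp using Algebra.adjoin_induction with
    | mem p hp =>
      rcases hp with hp | rfl
      · exact ⟨h.refines.le hp, base ⟨p, hp⟩⟩
      · exact ⟨h.var.2, comulAdd_var h hx hu ht hy⟩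
    | algebraMap z => exact ⟨(algebraMap ℂ (Inv s) z).2, base (algebraMap ℂ (Inv a) z)⟩
    | add p q _ _ hp hq =>
      obtain ⟨hp, hp'⟩ := hp
      obtain ⟨hq, hq'⟩ := hq
      refine ⟨add_mem hp hq, fun m n => ?_⟩
      have e : (⟨p + q, add_mem hp hq⟩ : Inv s) = ⟨p, hp⟩ + ⟨q, hq⟩ := rfl
      rw [e, map_add, map_add, mul_add, add_mul, map_add, map_add, AddMonoidHom.add_apply, hp', hq']
    | mul p q _ _ hp hq =>
      obtain ⟨hp, hp'⟩ := hp
      obtain ⟨hq, hq'⟩ := hq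
      refine ⟨mul_mem hp hq, fun m n => ?_⟩
      have e : (⟨p * q, mul_mem hp hq⟩ : Inv s) = ⟨p, hp⟩ * ⟨q, hq⟩ := rfl
      rw [e, map_mul (Subalgebra.inclusion hu.le), map_mul (Subalgebra.inclusion ht.le), ← mul_assoc,
        hq', hp', mul_assoc]
  obtain ⟨_, h2⟩ := key r.1 (h.mem_adjoin r.2)
  exact h2 m n

/-- The bimodule map `R_u ⊗_{R_s} R_t → R_u ⊗_{R_a} R_t`, `m ⊗ n ↦ m Δ n`, given by the
comultiplication `Δ : R_s → R_s ⊗_{R_a} R_s`, where `s` splits a block `T ∪ {k}` of `a` into `T` and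
`{k}` and `Δ(1) = ∑_j (-1)^j x_k^{|T| - j} ⊗ e_j(x_t : t ∈ T)`. -/
def comulHom :
    DHom ((reg x u s hx hu).tensor (reg s t y ht hy))
      ((reg x u a hx (hu.trans h.refines)).tensor (reg a t y (ht.trans h.refines) hy))
      (2 * (T.card : ℤ)) :=
  DHom.lift (M := reg x u s hx hu) (N := reg s t y ht hy)
    (P := (reg x u a hx (hu.trans h.refines)).tensor (reg a t y (ht.trans h.refines) hy))
    (comulAdd h hx hu ht hy)
    (fun r (m : Inv u) (n : Inv t) => by
      have h1 := comulAdd_balanced h hx hu ht hy r m n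
      rw [mul_comm m] at h1
      exact h1)
    (fun r (m : Inv u) (n : Inv t) => by
      change comulAdd h hx hu ht hy (Subalgebra.inclusion hx.le r * m) n =
        r • comulAdd h hx hu ht hy m n
      rw [comulAdd_apply, comulAdd_apply, Finset.smul_sum]
      refine Finset.sum_congr rfl fun j _ => ?_
      rw [smul_comm r, mul_assoc]
      rfl)
    (fun r (m : Inv u) (n : Inv t) => by
      change comulAdd h hx hu ht hy m (Subalgebra.inclusion hy.le r * n) =
        op r • comulAdd h hx hu ht hy m n
      rw [comulAdd_apply, comulAdd_apply, Finset.smul_sum]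
      refine Finset.sum_congr rfl fun j _ => ?_
      rw [smul_comm (op r), mul_left_comm]
      rfl)
    (fun i i' (m : Inv u) hm (n : Inv t) hn => by
      change comulAdd h hx hu ht hy m n ∈ tensorPiece _ _ _
      rw [comulAdd_apply]
      refine sum_mem fun j hj => zsmul_mem ?_ _
      have hj' : (((T.card - j : ℕ) : ℕ) : ℤ) = T.card - j :=
        Nat.cast_sub (Nat.lt_succ_iff.1 (Finset.mem_range.1 hj))
      have e : i + i' + 2 * (T.card : ℤ) = (i + (T.card - j : ℕ) • 2) + (2 * j + i') := by
        rw [nsmul_eq_mul, hj']; ring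
      rw [e]
      refine regTmul_mem hx (hu.trans h.refines) (ht.trans h.refines) hy ?_ ?_
      · exact IsWeightedHomogeneous.mul hm
          (IsWeightedHomogeneous.pow (isWeightedHomogeneous_X ℂ _ k) _)
      · exact IsWeightedHomogeneous.mul (esymmOn_isWH T j) hn)

end Comul

end Maps

/-! Complexes -/

open GBimod

section Complexes

variable {a b c : Fin 4 → ℕ}

/-- The complex `X₂ → X₁ → X₀`, with `X₀` in degree `0`. As all complexes here live in nonpositive
cohomological degrees, they are written as chain complexes: the component of cohomological degree
`-n` has index `n`. -/
def threeTerm {X₂ X₁ X₀ : GBimod a b} (d₂ : X₂ ⟶ X₁) (d₁ : X₁ ⟶ X₀) (h : d₂ ≫ d₁ = 0) :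
    ChainComplex (GBimod a b) ℕ where
  X n := match n with
    | 0 => X₀
    | 1 => X₁
    | 2 => X₂
    | _ => GBimod.zero a b
  d i j := match i, j with
    | 1, 0 => d₁
    | 2, 1 => d₂
    | _, _ => 0
  shape i j hij := by
    match i, j with
    | 1, 0 => exact absurd rfl hij
    | 2, 1 => exact absurd rfl hij
    | 0, _ => rfl
    | 1, _ + 1 => rfl
    | 2, 0 => rfl
    | 2, _ + 2 => rfl
    | _ + 3, _ => rfl
  d_comp_d' i j k hij hjk := by
    obtain rfl : j + 1 = i := hij
    obtain rfl : k + 1 = j := hjk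
    match k with
    | 0 => exact h
    | _ + 1 => exact Limits.zero_comp

/-- The tensor product over `R_b` of the two-term complexes `f : X₁ → X₀` and `g : Y₁ → Y₀`
(`X₀` and `Y₀` in degree `0`), with the usual sign rule
`d (x ⊗ y) = d x ⊗ y + (-1)^{deg x} x ⊗ d y`. It is
`X₁ ⊗ Y₁ → (X₀ ⊗ Y₁) ⊕ (X₁ ⊗ Y₀) → X₀ ⊗ Y₀`. -/
def tensorTwoTerm {X₁ X₀ : GBimod a b} {Y₁ Y₀ : GBimod b c} (f : X₁ ⟶ X₀) (g : Y₁ ⟶ Y₀) :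
    ChainComplex (GBimod a c) ℕ :=
  threeTerm (X₂ := X₁.tensor Y₁) (X₁ := (X₀.tensor Y₁).prod (X₁.tensor Y₀)) (X₀ := X₀.tensor Y₀)
    (⟨(DHom.tensorRight f Y₁).toFun.prod (-(DHom.tensorLeft X₁ g).toFun),
      fun r m => Prod.ext ((DHom.tensorRight f Y₁).map_left r m) (by
        change -(DHom.tensorLeft X₁ g).toFun (r • m) = r • -(DHom.tensorLeft X₁ g).toFun m
        rw [(DHom.tensorLeft X₁ g).map_left, smul_neg]),
      fun r m => Prod.ext ((DHom.tensorRight f Y₁).map_right r m) (by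
        change -(DHom.tensorLeft X₁ g).toFun (MulOpposite.op r • m) =
          MulOpposite.op r • -(DHom.tensorLeft X₁ g).toFun m
        rw [(DHom.tensorLeft X₁ g).map_right, smul_neg]),
      fun i m h => ⟨(DHom.tensorRight f Y₁).map_piece i m h,
        ((X₁.tensor Y₀).piece (i + 0)).neg_mem ((DHom.tensorLeft X₁ g).map_piece i m h)⟩⟩ :
      DHom (X₁.tensor Y₁) ((X₀.tensor Y₁).prod (X₁.tensor Y₀)) 0)
    (⟨(DHom.tensorLeft X₀ g).toFun.coprod (DHom.tensorRight f Y₀).toFun,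
      fun r m => by
        change (DHom.tensorLeft X₀ g).toFun (r • m.1) + (DHom.tensorRight f Y₀).toFun (r • m.2) =
          r • ((DHom.tensorLeft X₀ g).toFun m.1 + (DHom.tensorRight f Y₀).toFun m.2)
        rw [DHom.map_left, DHom.map_left, smul_add],
      fun r m => by
        change (DHom.tensorLeft X₀ g).toFun (MulOpposite.op r • m.1) +
            (DHom.tensorRight f Y₀).toFun (MulOpposite.op r • m.2) =
          MulOpposite.op r •
            ((DHom.tensorLeft X₀ g).toFun m.1 + (DHom.tensorRight f Y₀).toFun m.2)
        rw [DHom.map_right, DHom.map_right, smul_add],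
      fun i m h => add_mem ((DHom.tensorLeft X₀ g).map_piece i m.1 h.1)
        ((DHom.tensorRight f Y₀).map_piece i m.2 h.2)⟩ :
      DHom ((X₀.tensor Y₁).prod (X₁.tensor Y₀)) (X₀.tensor Y₀) 0)
    (DHom.ext (tensor_hom_ext fun x y => by
      let z : (X₁.tensor Y₀).carrier := tmul x (g.toFun y)
      change (DHom.tensorRight f Y₀).toFun z + (DHom.tensorRight f Y₀).toFun (-z) = 0
      rw [map_neg, add_neg_cancel]))

end Complexes

/-! The crossings -/

/-- The composition `4` of `4`. -/
abbrev c4 : Fin 4 → ℕ := ![0, 0, 0, 0]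

/-- The composition `3 + 1` of `4`. -/
abbrev c31 : Fin 4 → ℕ := ![0, 0, 0, 1]

/-- The composition `1 + 3` of `4`. -/
abbrev c13 : Fin 4 → ℕ := ![0, 1, 1, 1]

/-- The composition `2 + 2` of `4`. -/
abbrev c22 : Fin 4 → ℕ := ![0, 0, 1, 1]

/-- The composition `2 + 1 + 1` of `4`. -/
abbrev c211 : Fin 4 → ℕ := ![0, 0, 1, 2]

/-- The composition `1 + 2 + 1` of `4`. -/
abbrev c121 : Fin 4 → ℕ := ![0, 1, 1, 2]

/-- The composition `1 + 1 + 2` of `4`. -/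
abbrev c112 : Fin 4 → ℕ := ![0, 1, 2, 2]

/-- The composition `1 + 1 + 1 + 1` of `4`. -/
abbrev c1111 : Fin 4 → ℕ := ![0, 1, 2, 3]

theorem refines_c22_c4 : Refines c22 c4 := by decide
theorem refines_c121_c31 : Refines c121 c31 := by decide
theorem refines_c112_c13 : Refines c112 c13 := by decide
theorem refines_c112_c22 : Refines c112 c22 := by decide
theorem refines_c1111_c211 : Refines c1111 c211 := by decide
theorem refines_c1111_c121 : Refines c1111 c121 := by decide
theorem splits_c31_c211 : Splits c31 c211 {0, 1} 2 := by decide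
theorem splits_c4_c31 : Splits c4 c31 {0, 1, 2} 3 := by decide
theorem splits_c13_c121 : Splits c13 c121 {1, 2} 3 := by decide
theorem merges_c211_c22 : Merges c211 c22 2 3 := by decide
theorem merges_c1111_c121 : Merges c1111 c121 1 2 := by decide
theorem merges_c1111_c112 : Merges c1111 c112 2 3 := by decide

section Cross21

variable {a s t u : Fin 4 → ℕ} {T : Finset (Fin 4)} {k p q : Fin 4}

/-- The bimodule `R_u` of the `H`-shaped web in a crossing of a strand labelled `2` and a strand
labelled `1`, from the composition `s` at the bottom to `t` at the top. For `s = 21`, `t = 12`, this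
is `R₁₁₁ ⊗_{R₂₁} R₂₁ = R₁₁₁`. -/
def hWeb (hM : Merges u t p q) (hu : Refines u s) : GBimod t s :=
  reg t u s hM.refines hu

/-- The bimodule `R_t ⊗_{R_a} R_s` of a dumbbell web; `R₁₂ ⊗_{R₃} R₂₁` for a crossing of a strand
labelled `2` and a strand labelled `1`. -/
def dumbbell (t a s : Fin 4 → ℕ) (ht : Refines t a) (hs : Refines s a) : GBimod t s :=
  (reg t t a (Refines.refl t) ht).tensor (reg a s s hs (Refines.refl s))

/-- The differential of the complex of a positive crossing of a strand labelled `2` with a strand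
labelled `1`. It sends `m ⊗ n ∈ R₁₁₁ ⊗_{R₂₁} R₂₁` to `m ⊗ Δ₂₁(n) ∈ R₁₁₁ ⊗_{R₂₁} R₂₁ ⊗_{R₃} R₂₁`
and then applies to `R₁₁₁` the projection `R₁₁₁ → R₁₂{2}`. -/
def cross21Map (hS : Splits a s T k) (hM : Merges u t p q) (hu : Refines u s) (ht : Refines t a) :
    DHom (hWeb hM hu) (dumbbell t a s ht hS.refines) (0 + 2 * (T.card : ℤ) + -2) :=
  ((unitHom hM.refines hu (Refines.refl s)).comp
    (comulHom hS hM.refines hu (Refines.refl s) (Refines.refl s))).comp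
      (DHom.tensorRight (projHom hM (Refines.refl t) ht) _)

end Cross21

/-- The differential of the two-term complex `R₁₁₁₁{2} → R₁₂₁ ⊗_{R₃₁} R₂₁₁` of a positive crossing
between a strand labelled `2` and a strand labelled `1`, with a strand labelled `1` to the right. -/
def cross21Left : (hWeb merges_c1111_c121 refines_c1111_c211).shift 2 ⟶
    (dumbbell c121 c31 c211 refines_c121_c31 splits_c31_c211.refines).shift 0 :=
  (cross21Map splits_c31_c211 merges_c1111_c121 refines_c1111_c211 refines_c121_c31).toShift 2 0 rfl

/-- The differential of the two-term complex `R₁₁₁₁{2} → R₁₁₂ ⊗_{R₁₃} R₁₂₁` of a positive crossing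
between a strand labelled `2` and a strand labelled `1`, with a strand labelled `1` to the left. -/
def cross21Right : (hWeb merges_c1111_c112 refines_c1111_c121).shift 2 ⟶
    (dumbbell c112 c13 c121 refines_c112_c13 splits_c13_c121.refines).shift 0 :=
  (cross21Map splits_c13_c121 merges_c1111_c112 refines_c1111_c121 refines_c112_c13).toShift 2 0 rfl

/-- The bimodule `R₂₁₁ ⊗_{R₃₁} R₂₁₁` of the square web in a crossing of two strands labelled `2`. -/
def square : GBimod c22 c22 :=
  (reg c22 c211 c31 merges_c211_c22.refines splits_c31_c211.refines).tensor
    (reg c31 c211 c22 splits_c31_c211.refines merges_c211_c22.refines)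

/-- The first differential of the complex of a positive crossing of two strands labelled `2`: the
inclusion `R₂₂ ⊆ R₂₁₁` followed by the comultiplication `Δ₂₁ : R₂₁₁ → R₂₁₁ ⊗_{R₃₁} R₂₁₁`. -/
def cross22Map₁ : DHom (reg c22 c22 c22 (Refines.refl _) (Refines.refl _)) square
    (0 + 0 + 2 * (({0, 1} : Finset (Fin 4)).card : ℤ)) :=
  ((inclHom (Refines.refl _) (Refines.refl _) merges_c211_c22.refines).comp
    (unitHom merges_c211_c22.refines (Refines.refl c211) merges_c211_c22.refines)).comp
      (comulHom splits_c31_c211 merges_c211_c22.refines (Refines.refl c211)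
        (Refines.refl c211) merges_c211_c22.refines)

/-- The second differential of the complex of a positive crossing of two strands labelled `2`: the
map `m ⊗ n ↦ m Δ₃₁(1) n`, `R₂₁₁ ⊗_{R₃₁} R₂₁₁ → R₂₁₁ ⊗_{R₄} R₂₁₁`, followed by the projection
`R₂₁₁ → R₂₂{2}` applied to both factors. -/
def cross22Map₂ : DHom square (dumbbell c22 c4 c22 refines_c22_c4 refines_c22_c4)
    (2 * (({0, 1, 2} : Finset (Fin 4)).card : ℤ) + -2 + -2) :=
  ((comulHom splits_c4_c31 merges_c211_c22.refines splits_c31_c211.refines splits_c31_c211.refines merges_c211_c22.refines).comp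
    (DHom.tensorRight (projHom merges_c211_c22 (Refines.refl c22) refines_c22_c4) _)).comp
      (DHom.tensorLeft _ (projHom merges_c211_c22 refines_c22_c4 (Refines.refl c22)))

theorem divDiff_of_invariant (g : Poly) (hg : g ∈ Inv c22) : divDiff 2 3 g = 0 := by
  apply mul_left_cancel₀ (X_sub_ne (show (2 : Fin 4) ≠ 3 by decide))
  rw [divDiff_spec, merges_c211_c22.rename_swap hg, sub_self, mul_zero]

theorem divDiff_X_mul (g : Poly) (hg : g ∈ Inv c22) : divDiff 2 3 (X 2 * g) = g := by
  apply mul_left_cancel₀ (X_sub_ne (show (2 : Fin 4) ≠ 3 by decide))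
  rw [divDiff_spec, map_mul, merges_c211_c22.rename_swap hg, rename_X, Equiv.swap_apply_left]
  ring

theorem divDiff_antisymm (f : Poly) (hf : f ∈ Inv c22) (i j : ℕ) :
    divDiff 2 3 (f * X 2 ^ i * X 3 ^ j) = -divDiff 2 3 (f * X 2 ^ j * X 3 ^ i) := by
  apply mul_left_cancel₀ (X_sub_ne (show (2 : Fin 4) ≠ 3 by decide))
  rw [mul_neg, divDiff_spec, divDiff_spec]
  simp only [map_mul, map_pow, merges_c211_c22.rename_swap hf, rename_X, Equiv.swap_apply_left,
    Equiv.swap_apply_right]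
  ring

theorem esymmOn_mem_c22 (j : ℕ) : esymmOn {0, 1} j ∈ Inv c22 := fun σ hσ => by
  rw [rename_esymmOn]
  have h : ∀ i : Fin 4, i ∈ ({0, 1} : Finset (Fin 4)) ↔ c22 i = 0 := by decide
  refine congrArg (esymmOn · j) (Finset.eq_of_subset_of_card_le (fun x hx => ?_) (by simp))
  obtain ⟨y, hy, rfl⟩ := Finset.mem_map.1 hx
  exact (h _).2 ((hσ y).trans ((h y).1 hy))

theorem antisymm_sum {A B G : Type} [AddCommGroup A] [CommRing B] [AddCommGroup G]
    (τ : A →+ B →+ G) (w : ℕ → ℕ → A) (e : ℕ → B) (h : ∀ i j, w i j = -w j i)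
    (hd : ∀ i, w i i = 0) : ∑ i ∈ Finset.range 3, (-1 : ℤ) ^ i • ∑ j ∈ Finset.range 3,
      (-1 : ℤ) ^ (j + 1) • τ (w (2 - i) (2 - j)) (e j * e i) = 0 := by
  simp only [Finset.sum_range_succ, Finset.sum_range_zero, Nat.sub_zero, Nat.sub_self,
    Nat.reduceSub, hd, map_zero, AddMonoidHom.zero_apply, h 1 2, h 0 2, h 0 1,
    map_neg, AddMonoidHom.neg_apply, mul_comm (e 1) (e 0), mul_comm (e 2) (e 0),
    mul_comm (e 2) (e 1)]
  module

/-- The inclusion `R₂₂ ⊆ R₂₁₁`. -/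
def ι22 : Inv c22 →ₐ[ℂ] Inv c211 := Subalgebra.inclusion merges_c211_c22.refines.le

/-- The inclusion `R₃₁ ⊆ R₂₁₁`. -/
def ι31 : Inv c31 →ₐ[ℂ] Inv c211 := Subalgebra.inclusion splits_c31_c211.refines.le

/-- The projection `R₂₁₁ → R₂₂`, `g + x₃ h ↦ h`. -/
def proj22 : Inv c211 →+ Inv c22 :=
  (projHom merges_c211_c22 (Refines.refl c22) (Refines.refl c22)).toFun

/-- The elementary symmetric polynomial `e_j(x₁, x₂)` in `R₂₂`. -/
def e22 (j : ℕ) : Inv c22 := ⟨esymmOn {0, 1} j, esymmOn_mem_c22 j⟩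

theorem cross22Map₁_apply (f : Inv c22) : cross22Map₁.toFun f =
    ∑ i ∈ Finset.range 3, (-1 : ℤ) ^ i •
      regTmul merges_c211_c22.refines splits_c31_c211.refines splits_c31_c211.refines
        merges_c211_c22.refines (ι22 f * splits_c31_c211.var ^ (2 - i)) (ι22 (e22 i)) := by
  change comulAdd splits_c31_c211 merges_c211_c22.refines (Refines.refl c211) (Refines.refl c211)
    merges_c211_c22.refines (ι22 f) 1 = _
  rw [comulAdd_apply]
  refine Finset.sum_congr rfl fun i _ => ?_
  rw [mul_one]
  rfl

theorem cross22Map₂_apply (m n : Inv c211) :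
    cross22Map₂.toFun (regTmul merges_c211_c22.refines
      splits_c31_c211.refines splits_c31_c211.refines merges_c211_c22.refines m n) =
    ∑ j ∈ Finset.range 4, (-1 : ℤ) ^ j •
      regTmul (Refines.refl c22) refines_c22_c4 refines_c22_c4 (Refines.refl c22)
        (proj22 (m * ι31 (splits_c4_c31.var ^ (3 - j)))) (proj22 (ι31 (splits_c4_c31.elem j) * n)) := by
  let F := (DHom.tensorLeft (reg c22 c22 c4 (Refines.refl c22) refines_c22_c4)
    (projHom merges_c211_c22 refines_c22_c4 (Refines.refl c22))).toFun.comp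
    (DHom.tensorRight (projHom merges_c211_c22 (Refines.refl c22) refines_c22_c4)
      (reg c4 c211 c22 (merges_c211_c22.refines.trans refines_c22_c4)
        (merges_c211_c22.refines.trans (Refines.refl c22)))).toFun
  refine (congrArg F (comulAdd_apply splits_c4_c31 merges_c211_c22.refines splits_c31_c211.refines
    splits_c31_c211.refines merges_c211_c22.refines m n)).trans ((map_sum F _ _).trans ?_)
  exact Finset.sum_congr rfl fun j _ => map_zsmul F _ _

theorem proj22_val (f : Inv c211) : (proj22 f : Poly) = divDiff 2 3 f := rfl

theorem proj22_elem_succ (j : ℕ) (g : Inv c22) :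
    proj22 (ι31 (splits_c4_c31.elem (j + 1)) * ι22 g) = e22 j * g := by
  apply Subtype.ext
  rw [proj22_val, Subalgebra.coe_mul, ι31, ι22, Subalgebra.coe_inclusion, Subalgebra.coe_inclusion]
  change divDiff 2 3 (esymmOn {0, 1, 2} (j + 1) * g.1) = esymmOn {0, 1} j * g.1
  have e3 : ({0, 1, 2} : Finset (Fin 4)) = insert 2 {0, 1} := by decide
  rw [e3, esymmOn_insert (by decide), add_mul, divDiff_add (by decide),
    divDiff_of_invariant _ (mul_mem (esymmOn_mem_c22 _) g.2), zero_add, mul_assoc,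
    divDiff_X_mul _ (mul_mem (esymmOn_mem_c22 _) g.2)]

theorem proj22_elem_zero (g : Inv c22) :
    proj22 (ι31 (splits_c4_c31.elem 0) * ι22 g) = 0 := by
  apply Subtype.ext
  rw [proj22_val, Subalgebra.coe_mul, ι31, ι22, Subalgebra.coe_inclusion, Subalgebra.coe_inclusion]
  change divDiff 2 3 (esymmOn {0, 1, 2} 0 * g.1) = 0
  rw [esymmOn_zero, one_mul, divDiff_of_invariant _ g.2]

theorem proj22_antisymm (f : Inv c22) (i j : ℕ) :
    proj22 (ι22 f * splits_c31_c211.var ^ i * ι31 (splits_c4_c31.var ^ j)) =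
      -proj22 (ι22 f * splits_c31_c211.var ^ j * ι31 (splits_c4_c31.var ^ i)) := by
  have hc : ∀ i j, ((ι22 f * splits_c31_c211.var ^ i * ι31 (splits_c4_c31.var ^ j) : Inv c211) :
      Poly) = f.1 * X 2 ^ i * X 3 ^ j := by
    intro i j
    rw [Subalgebra.coe_mul, Subalgebra.coe_mul, Subalgebra.coe_pow, ι22, ι31,
      Subalgebra.coe_inclusion, Subalgebra.coe_inclusion, Subalgebra.coe_pow]
    rfl
  apply Subtype.ext
  rw [proj22_val, NegMemClass.coe_neg, proj22_val, hc, hc]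
  exact divDiff_antisymm f.1 f.2 i j

theorem cross22_step (f : Inv c22) (i : ℕ) :
    ∑ j ∈ Finset.range 4, (-1 : ℤ) ^ j •
      regTmul (Refines.refl c22) refines_c22_c4 refines_c22_c4 (Refines.refl c22)
        (proj22 (ι22 f * splits_c31_c211.var ^ (2 - i) * ι31 (splits_c4_c31.var ^ (3 - j))))
        (proj22 (ι31 (splits_c4_c31.elem j) * ι22 (e22 i))) =
    ∑ j ∈ Finset.range 3, (-1 : ℤ) ^ (j + 1) •
      regTmul (Refines.refl c22) refines_c22_c4 refines_c22_c4 (Refines.refl c22)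
        (proj22 (ι22 f * splits_c31_c211.var ^ (2 - i) * ι31 (splits_c4_c31.var ^ (2 - j))))
        (e22 j * e22 i) := by
  rw [Finset.sum_range_succ', proj22_elem_zero, map_zero, smul_zero, add_zero]
  refine Finset.sum_congr rfl fun j _ => ?_
  rw [proj22_elem_succ, show 3 - (j + 1) = 2 - j by omega]

theorem cross22_comp (f : Inv c22) : cross22Map₂.toFun (cross22Map₁.toFun f) = 0 := by
  refine (congrArg cross22Map₂.toFun (cross22Map₁_apply f)).trans
    ((map_sum cross22Map₂.toFun _ _).trans ?_)
  refine (Finset.sum_congr rfl fun i _ => (map_zsmul cross22Map₂.toFun _ _).trans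
    (congrArg _ ((cross22Map₂_apply _ _).trans (cross22_step f i)))).trans ?_
  exact antisymm_sum _ (fun i j =>
    proj22 (ι22 f * splits_c31_c211.var ^ i * ι31 (splits_c4_c31.var ^ j))) e22
    (proj22_antisymm f) (fun i => self_eq_neg.1 (proj22_antisymm f i i))

/-- The complex `R₂₂{6} → (R₂₁₁ ⊗_{R₃₁} R₂₁₁){2} → R₂₂ ⊗_{R₄} R₂₂` of a positive crossing of two
strands labelled `2`. -/
def cross22 : ChainComplex (GBimod c22 c22) ℕ :=
  threeTerm (cross22Map₁.toShift 6 2 rfl) (cross22Map₂.toShift 2 0 rfl)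
    (GBimod.hom_ext cross22_comp)

/-- The bimodule `R₁₁₂ ⊗_{R₂₂} R₂₂ = R₁₁₂` of the web that splits the left one of two strands
labelled `2`. -/
def splitLeft : GBimod c112 c22 := reg c112 c112 c22 (Refines.refl c112) refines_c112_c22

/-- The bimodule `R₂₁₁ ⊗_{R₂₂} R₂₂ = R₂₁₁` of the web that splits the right one of two strands
labelled `2`. -/
def splitRight : GBimod c211 c22 := reg c211 c211 c22 (Refines.refl c211) merges_c211_c22.refines

/-- The complex of the diagram in which two strands labelled `2` cross positively and then, above
the crossing, the strand at the top left splits into two strands labelled `1`. -/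
def splitAfterCrossing : ChainComplex (GBimod c112 c22) ℕ :=
  ((GBimod.tensorLeft splitLeft c22).mapHomologicalComplex (ComplexShape.down ℕ)).obj cross22

/-- The complex of the diagram in which the strand labelled `2` at the bottom right splits into two
strands labelled `1`, each of which then crosses the other strand labelled `2` positively. -/
def splitBeforeCrossing : ChainComplex (GBimod c112 c22) ℕ :=
  ((GBimod.tensorRight c112 splitRight).mapHomologicalComplex (ComplexShape.down ℕ)).obj
    (tensorTwoTerm cross21Right cross21Left)

end ColouredWeb

end

/-! Variables are written x_1, …, x_4 and ∂_1, ∂_2, ∂_3 are the divided differences, so `divDiff 2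
3` is ∂_3; composites of morphisms are read in diagrammatic order. Once tensor factors over equal
rings are contracted, the complex with the split above the crossing becomes R_112{6} → Q{2} → A₀
with Q = R_1111 ⊗_31 R_211 and A₀ = R_112 ⊗_4 R_22. The other complex becomes B₂{4} → P{2} ⊕ Q{2} →
B₀ with B₂ = R_1111 ⊗_121 R_1111, P = R_112 ⊗_13 R_1111 and B₀ = R_112 ⊗_13 R_121 ⊗_31 R_211. The
same Q occurs in both, so the superfluous P has to cancel. Put W = R_112 ⊗_13 R_112. Up to shifts, P
is two copies of W, because R_1111 is free of rank 2 over R_112; B₂ is R_112 ⊕ W, a singular version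
of B_s B_t B_s = B_sts ⊕ B_s; and B₀ is A₀ ⊕ W. One copy of W in P cancels against B₂, the other
against B₀, and what survives is the first complex. The summands W are never named in the proof. The
splittings are recorded by sections and retractions `inclB₀`, `projB₀`, `inclB₂`, `projB₂` and by
two contractions `contractB₀` : B₀ → P and `contractP` : P → B₂, both built from ∂_3. The lemma
`nonempty_homotopyEquiv_of_elimination` isolates the identities between these maps and the
differentials that suffice, and `nonempty_homotopyEquiv_of_isos` allows them to be checked on the
simplified terms. Those identities are computations with Frobenius extensions of invariant rings.
The main inputs are the dual bases for a single divided difference (`divDiff_reconstruct`), the dual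
bases for the trace ∂_2∂_3 of R_121 over R_13 (`trace_reconstruct`), the twisted Leibniz rule
(`trace_mul_pow`) and the factorisation of ∑ (-1)^j t^{2-j} e_j(x_1, x_2) as (t - x_1)(t - x_2)
(`sum_divDiff_esymm`). Right linearity over R_22 reduces the identities on B₀ and B₂ to generators m
⊗ n ⊗ 1 and m ⊗ 1 (`modelB₀_hom_ext`, `modelB₂_hom_ext`). -/

noncomputable section

namespace ColouredWeb

open CategoryTheory MvPolynomial MulOpposite GBimod

/-! ### Gaussian elimination for three-term complexes -/

section Gauss

universe v w

variable {C : Type w} [Category.{v} C] [Preadditive C]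

/-- A morphism of chain complexes concentrated in the degrees `0`, `1`, `2`. -/
def threeTermMap {K L : ChainComplex C ℕ}
    -- Uniqueness of maps out of the terms of degree at least 3 expresses that these terms vanish,
    -- without requiring a zero object in the category.
    (hK : ∀ (n : ℕ) (X : C) (f g : K.X (n + 3) ⟶ X), f = g)
    (f₀ : K.X 0 ⟶ L.X 0) (f₁ : K.X 1 ⟶ L.X 1) (f₂ : K.X 2 ⟶ L.X 2)
    (h₁ : f₁ ≫ L.d 1 0 = K.d 1 0 ≫ f₀) (h₂ : f₂ ≫ L.d 2 1 = K.d 2 1 ≫ f₁) : K ⟶ L :=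
  ChainComplex.ofHom (fun n => match n with
    | 0 => f₀
    | 1 => f₁
    | 2 => f₂
    | _ + 3 => 0) fun n => match n with
    | 0 => h₁
    | 1 => h₂
    | n + 2 => hK n _ _ _

/-- A homotopy between morphisms of chain complexes concentrated in the degrees `0`, `1`, `2`. -/
def threeTermHomotopy {K L : ChainComplex C ℕ}
    (hK : ∀ (n : ℕ) (X : C) (f g : K.X (n + 3) ⟶ X), f = g) {f g : K ⟶ L}
    (s₀ : K.X 0 ⟶ L.X 1) (s₁ : K.X 1 ⟶ L.X 2)
    (h₀ : f.f 0 = s₀ ≫ L.d 1 0 + g.f 0)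
    (h₁ : f.f 1 = K.d 1 0 ≫ s₀ + s₁ ≫ L.d 2 1 + g.f 1)
    (h₂ : f.f 2 = K.d 2 1 ≫ s₁ + g.f 2) : Homotopy f g where
  hom i j := match i, j with
    | 0, 1 => s₀
    | 1, 2 => s₁
    | _, _ => 0
  zero i j hij := by
    match i, j with
    | 0, 1 => exact absurd rfl hij
    | 1, 2 => exact absurd rfl hij
    | 0, 0 => rfl
    | 0, _ + 2 => rfl
    | 1, 0 => rfl
    | 1, 1 => rfl
    | 1, _ + 3 => rfl
    | _ + 2, _ => rfl
  comm i := by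
    match i with
    | 0 =>
      rw [dNext_nat, prevD_eq _ (show (ComplexShape.down ℕ).Rel 1 0 from rfl), h₀]
      simp
    | 1 =>
      rw [dNext_eq _ (show (ComplexShape.down ℕ).Rel 1 0 from rfl),
        prevD_eq _ (show (ComplexShape.down ℕ).Rel 2 1 from rfl)]
      exact h₁
    | 2 =>
      rw [dNext_eq _ (show (ComplexShape.down ℕ).Rel 2 1 from rfl),
        prevD_eq _ (show (ComplexShape.down ℕ).Rel 3 2 from rfl), h₂]
      simp
    | n + 3 => exact hK n _ _ _

/-- Gaussian elimination for complexes in the degrees `0`, `1`, `2`: the middle term of `L` is the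
sum of `P` and the middle term of `K`, and `P` cancels against summands of the two other terms
of `L`. -/
theorem nonempty_homotopyEquiv_of_elimination {K L : ChainComplex C ℕ}
    (hK : ∀ (n : ℕ) (X : C) (f g : K.X (n + 3) ⟶ X), f = g)
    (hL : ∀ (n : ℕ) (X : C) (f g : L.X (n + 3) ⟶ X), f = g)
    {P : C} {iP : P ⟶ L.X 1} {pP : L.X 1 ⟶ P} {iQ : K.X 1 ⟶ L.X 1} {pQ : L.X 1 ⟶ K.X 1}
    (ePP : iP ≫ pP = 𝟙 P) (eQQ : iQ ≫ pQ = 𝟙 _) (ePQ : iP ≫ pQ = 0) (eQP : iQ ≫ pP = 0)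
    (eid : pP ≫ iP + pQ ≫ iQ = 𝟙 _)
    {α : L.X 2 ⟶ P} {β : L.X 2 ⟶ K.X 1} {γ : P ⟶ L.X 0} {δ : K.X 1 ⟶ L.X 0}
    (hα : L.d 2 1 ≫ pP = α) (hβ : L.d 2 1 ≫ pQ = β) (hγ : iP ≫ L.d 1 0 = γ)
    (hδ : iQ ≫ L.d 1 0 = δ)
    (f₀ : K.X 0 ⟶ L.X 0) (g₀ : L.X 0 ⟶ K.X 0) (f₂ : K.X 2 ⟶ L.X 2) (g₂ : L.X 2 ⟶ K.X 2)
    (h₀ : L.X 0 ⟶ P) (h₁ : P ⟶ L.X 2)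
    (fg₀ : f₀ ≫ g₀ = 𝟙 _) (fg₂ : f₂ ≫ g₂ = 𝟙 _) (hh : h₀ ≫ h₁ = 0)
    (H₁ : f₂ ≫ β = -K.d 2 1) (H₂ : δ ≫ g₀ = -K.d 1 0) (H₃ : h₀ ≫ γ + g₀ ≫ f₀ = 𝟙 _)
    (H₄ : (𝟙 P - h₁ ≫ α) ≫ (𝟙 P - γ ≫ h₀) = 0) (H₅ : α ≫ h₁ + g₂ ≫ f₂ = 𝟙 _) :
    Nonempty (HomotopyEquiv K L) := by
  have d2 : L.d 2 1 = α ≫ iP + β ≫ iQ := by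
    rw [← hα, ← hβ, Category.assoc, Category.assoc, ← Preadditive.comp_add, eid, Category.comp_id]
  have d1 : L.d 1 0 = pP ≫ γ + pQ ≫ δ := by
    rw [← hγ, ← hδ, ← Category.assoc, ← Category.assoc, ← Preadditive.add_comp, eid,
      Category.id_comp]
  -- This is d² = 0 for `L`, written in the components of the middle term.
  have dd : β ≫ δ = -(α ≫ γ) := by
    have h := L.d_comp_d 2 1 0
    rw [← hδ, ← hγ, eq_neg_iff_add_eq_zero, ← Category.assoc, ← Category.assoc,
      ← Preadditive.add_comp, add_comm, ← d2, h]
  -- `H₄` expanded. It says that on `P` whatever `h₁ ≫ α` misses is fixed by `γ ≫ h₀`, so that the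
  -- two cancellations together use up all of `P`.
  have H₄' : h₁ ≫ α ≫ γ ≫ h₀ = h₁ ≫ α + γ ≫ h₀ - 𝟙 P := by
    have h := H₄
    simp only [Preadditive.sub_comp, Preadditive.comp_sub, Category.id_comp, Category.comp_id,
      Category.assoc] at h
    rw [← sub_eq_zero, ← h]; abel
  have K2 : K.d 2 1 = -(f₂ ≫ β) := by rw [H₁, neg_neg]
  have K1 : K.d 1 0 = -(δ ≫ g₀) := by rw [H₂, neg_neg]
  have G₃ : g₀ ≫ f₀ = 𝟙 _ - h₀ ≫ γ := by rw [← H₃]; abel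
  have G₅ : g₂ ≫ f₂ = 𝟙 _ - α ≫ h₁ := by rw [← H₅]; abel
  -- The summand of `L.X 2` that survives may still map to `P`, but only into the part cancelled
  -- against `L.X 0`. The equation holds after composing with `g₂` in front, since `g₂ ≫ f₂ = 1 - α
  -- ≫ h₁`, and `g₂` is removed by `f₂ ≫ g₂ = 1`.
  have e2 : f₂ ≫ α ≫ γ ≫ h₀ = f₂ ≫ α := by
    have h : (g₂ ≫ f₂) ≫ α ≫ γ ≫ h₀ = (g₂ ≫ f₂) ≫ α := by
      rw [G₅]
      simp only [Preadditive.sub_comp, Category.id_comp, Category.assoc, H₄', Preadditive.comp_add,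
        Preadditive.comp_sub, Category.comp_id]
      abel
    have h' := congrArg (f₂ ≫ ·) h
    simpa only [← Category.assoc, fg₂, Category.id_comp] using h'
  -- The dual statement, proved after composing with `f₀` and then using `f₀ ≫ g₀ = 1`.
  have e1 : h₁ ≫ α ≫ γ ≫ g₀ = γ ≫ g₀ := by
    have h : h₁ ≫ α ≫ γ ≫ g₀ ≫ f₀ = γ ≫ g₀ ≫ f₀ := by
      have h'' := congrArg (· ≫ γ) H₄'
      simp only [Preadditive.sub_comp, Preadditive.add_comp, Category.id_comp,
        Category.assoc] at h''
      rw [G₃]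
      simp only [Category.comp_id, Preadditive.comp_sub, h'']
      abel
    have h' := congrArg (· ≫ g₀) h
    simpa only [Category.assoc, fg₀, Category.comp_id] using h'
  have hh' : ∀ {X : C} (z : L.X 2 ⟶ X), h₀ ≫ h₁ ≫ z = 0 := fun z => by
    rw [← Category.assoc, hh, Limits.zero_comp]
  have ePP' : ∀ {X : C} (z : P ⟶ X), iP ≫ pP ≫ z = z := fun z => by
    rw [← Category.assoc, ePP, Category.id_comp]
  have eQQ' : ∀ {X : C} (z : K.X 1 ⟶ X), iQ ≫ pQ ≫ z = z := fun z => by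
    rw [← Category.assoc, eQQ, Category.id_comp]
  have ePQ' : ∀ {X : C} (z : K.X 1 ⟶ X), iP ≫ pQ ≫ z = 0 := fun z => by
    rw [← Category.assoc, ePQ, Limits.zero_comp]
  have eQP' : ∀ {X : C} (z : P ⟶ X), iQ ≫ pP ≫ z = 0 := fun z => by
    rw [← Category.assoc, eQP, Limits.zero_comp]
  have dd' : ∀ {X : C} (z : L.X 0 ⟶ X), β ≫ δ ≫ z = -(α ≫ γ ≫ z) := fun z => by
    rw [← Category.assoc, dd, Preadditive.neg_comp, Category.assoc]
  -- In degree 1 the map is the inclusion of `Q` corrected by a component through `P`; the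
  -- correction is the zigzag of Gaussian elimination. The minus sign before `iQ` matches the signs
  -- in `H₁` and `H₂`.
  let F : K ⟶ L := threeTermMap hK f₀ (δ ≫ h₀ ≫ iP - iQ) f₂
    (by
      rw [d1, K1]
      simp only [Preadditive.sub_comp, Preadditive.comp_add, Preadditive.neg_comp, Category.assoc,
        ePP', eQQ', ePQ', eQP', G₃, Preadditive.comp_sub, Category.comp_id, Limits.comp_zero]
      abel)
    (by
      rw [d2, K2]
      simp only [Preadditive.comp_sub, Preadditive.comp_add, Preadditive.neg_comp, Category.assoc,
        dd', Preadditive.comp_neg]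
      have h := congrArg (· ≫ iP) e2
      simp only [Category.assoc] at h
      rw [h]
      abel)
  let G : L ⟶ K := threeTermMap hL g₀ (pP ≫ h₁ ≫ β - pQ) g₂
    (by
      rw [d1, K1]
      simp only [Preadditive.sub_comp, Preadditive.add_comp, Preadditive.comp_neg, Category.assoc,
        dd', e1]
      abel)
    (by
      rw [d2, K2]
      have h := congrArg (· ≫ β) G₅
      simp only [Preadditive.sub_comp, Category.assoc, Category.id_comp] at h
      simp only [Preadditive.comp_sub, Preadditive.add_comp, Preadditive.comp_neg, Category.assoc,
        ePP', eQQ, ePQ, eQP', h, Limits.comp_zero, Category.comp_id]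
      abel)
  refine ⟨⟨F, G, ?_, ?_⟩⟩
  -- `F ≫ G` is the identity on the nose: in degree 1 the product of the two corrections contains
  -- `h₀ ≫ h₁ = 0`. Thus `K` is a deformation retract of `L`.
  · refine threeTermHomotopy hK 0 0 ?_ ?_ ?_
    · change f₀ ≫ g₀ = _
      simp [fg₀]
    · change (δ ≫ h₀ ≫ iP - iQ) ≫ (pP ≫ h₁ ≫ β - pQ) = _
      simp only [Preadditive.sub_comp, Preadditive.comp_sub, Category.assoc, ePP', eQP', ePQ, eQQ,
        hh']
      simp
    · change f₂ ≫ g₂ = _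
      simp [fg₂]
  · refine threeTermHomotopy hL (-(h₀ ≫ iP)) (-(pP ≫ h₁)) ?_ ?_ ?_
    · change g₀ ≫ f₀ = _ + 𝟙 _
      rw [G₃, d1]
      simp only [Preadditive.neg_comp, Preadditive.comp_add, Category.assoc, ePP', ePQ',
        Limits.comp_zero]
      abel
    · change (pP ≫ h₁ ≫ β - pQ) ≫ (δ ≫ h₀ ≫ iP - iQ) = _ + 𝟙 _
      have h := congrArg (· ≫ iP) H₄'
      simp only [Category.assoc, Preadditive.sub_comp, Preadditive.add_comp,
        Category.id_comp] at h
      rw [d1, d2, ← eid]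
      simp only [Preadditive.sub_comp, Preadditive.comp_sub, Preadditive.add_comp,
        Preadditive.comp_add, Preadditive.neg_comp, Preadditive.comp_neg, Category.assoc, dd', h]
      abel
    · change g₂ ≫ f₂ = _ + 𝟙 _
      rw [G₅, d2]
      simp only [Preadditive.comp_neg, Preadditive.add_comp, Category.assoc, ePP', eQP',
        Limits.comp_zero]
      abel

end Gauss

/-! Canonical isomorphisms of graded bimodules -/

section Isos

open TensorProduct

variable {a b c d x y s t u v : Fin 4 → ℕ}

theorem tensor_hom_ext_left {M : GBimod a b} {N : GBimod b c} {K : GBimod c d} {P : Type}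
    [AddCommGroup P] {f g : TensorCarrier (M.tensor N) K →+ P}
    (h : ∀ (m : M.carrier) (n : N.carrier) (k : K.carrier),
      f (tmul (M := M.tensor N) (tmul m n) k) = g (tmul (M := M.tensor N) (tmul m n) k)) :
    f = g :=
  AddMonoidHom.ext fun w => tensor_induction (p := fun w => f w = g w)
    (fun z k => DFunLike.congr_fun (tensor_hom_ext
      (f := f.comp (show TensorCarrier M N →+ _ from (tmulHom (M.tensor N) K).flip k))
      (g := g.comp (show TensorCarrier M N →+ _ from (tmulHom (M.tensor N) K).flip k))
      fun m n => h m n k) z)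
    (fun w w' hw hw' => by rw [map_add, map_add, hw, hw']) w

theorem tensor_hom_ext_right {M : GBimod a b} {N : GBimod b c} {K : GBimod c d} {P : Type}
    [AddCommGroup P] {f g : TensorCarrier M (N.tensor K) →+ P}
    (h : ∀ (m : M.carrier) (n : N.carrier) (k : K.carrier),
      f (tmul (N := N.tensor K) m (tmul n k)) = g (tmul (N := N.tensor K) m (tmul n k))) :
    f = g :=
  AddMonoidHom.ext fun w => tensor_induction (p := fun w => f w = g w)
    (fun m z => DFunLike.congr_fun (tensor_hom_ext
      (f := f.comp (show TensorCarrier N K →+ _ from tmulHom M (N.tensor K) m))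
      (g := g.comp (show TensorCarrier N K →+ _ from tmulHom M (N.tensor K) m))
      fun n k => h m n k) z)
    (fun w w' hw hw' => by rw [map_add, map_add, hw, hw']) w

/-- The associativity map `(M ⊗ N) ⊗ K → M ⊗ (N ⊗ K)`. -/
def assocHom (M : GBimod a b) (N : GBimod b c) (K : GBimod c d) :
    DHom ((M.tensor N).tensor K) (M.tensor (N.tensor K)) 0 :=
  -- The universal property is applied twice: first to `M ⊗ N` with `k` fixed, then to the result as
  -- a function of `k`.
  let F (k : K.carrier) : TensorCarrier M N →+ TensorCarrier M (N.tensor K) :=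
    tlift ((tmulHom M (N.tensor K)).compl₂ ((tmulHom N K).flip k)) fun r m n =>
      smul_tmul (M := M) (N := N.tensor K) r m (tmul n k)
  let G : TensorCarrier M N →+ K.carrier →+ TensorCarrier M (N.tensor K) :=
    (AddMonoidHom.mk' F fun k k' => tensor_hom_ext fun m n =>
      (congrArg (tmul (M := M) (N := N.tensor K) m) (tmul_add n k k')).trans
        (tmul_add (N := N.tensor K) m _ _)).flip
  DHom.lift (M := M.tensor N) (N := K) (P := M.tensor (N.tensor K)) G
    (fun r z k => tensor_induction (p := fun z => G (op r • z) k = G z (r • k))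
      (fun m n => congrArg (tmul (M := M) (N := N.tensor K) m) (smul_tmul r n k))
      (fun z z' hz hz' => by
        rw [smul_add, map_add, map_add, AddMonoidHom.add_apply, AddMonoidHom.add_apply, hz, hz']) z)
    (fun r z k => tensor_induction (p := fun z => G (r • z) k = r • G z k)
      (fun m n => rfl)
      (fun z z' hz hz' => by
        rw [smul_add, map_add, map_add, AddMonoidHom.add_apply, AddMonoidHom.add_apply, hz, hz',
          smul_add]) z)
    (fun r z k => tensor_induction (p := fun z => G z (op r • k) = op r • G z k)
      (fun m n => rfl)
      (fun z z' hz hz' => by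
        rw [map_add, AddMonoidHom.add_apply, AddMonoidHom.add_apply, hz, hz', smul_add]) z)
    (fun i j z hz k hk => by
      -- A homogeneous element of `M ⊗ N` is a sum of tensors of homogeneous elements, so the degree
      -- need only be checked on such tensors.
      have h : tensorPiece M N i ≤ ((M.tensor (N.tensor K)).piece (i + j)).comap
          (show TensorCarrier M N →+ _ from G.flip k) := (AddSubgroup.closure_le _).2 (by
        rintro _ ⟨i, i', rfl, m, hm, n, hn, rfl⟩
        change tmul (M := M) (N := N.tensor K) m (tmul n k) ∈ tensorPiece _ _ _
        rw [add_assoc]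
        exact tmul_mem (M := M) (N := N.tensor K) hm (tmul_mem hn hk))
      rw [add_zero]
      exact h hz)

/-- The associativity map `M ⊗ (N ⊗ K) → (M ⊗ N) ⊗ K`. -/
def assocInv (M : GBimod a b) (N : GBimod b c) (K : GBimod c d) :
    DHom (M.tensor (N.tensor K)) ((M.tensor N).tensor K) 0 :=
  let F (m : M.carrier) : TensorCarrier N K →+ TensorCarrier (M.tensor N) K :=
    tlift ((tmulHom (M.tensor N) K).comp (tmulHom M N m)) fun r n k =>
      smul_tmul (M := M.tensor N) (N := K) r (tmul m n) k
  let G : M.carrier →+ TensorCarrier N K →+ TensorCarrier (M.tensor N) K :=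
    AddMonoidHom.mk' F fun m m' => tensor_hom_ext fun n k =>
      (congrArg (fun z => tmul (M := M.tensor N) (N := K) z k) (add_tmul m m' n)).trans
        (add_tmul (M := M.tensor N) _ _ k)
  DHom.lift (M := M) (N := N.tensor K) (P := (M.tensor N).tensor K) G
    (fun r m z => tensor_induction (p := fun z => G (op r • m) z = G m (r • z))
      (fun n k => congrArg (fun w => tmul (M := M.tensor N) (N := K) w k) (smul_tmul r m n))
      (fun z z' hz hz' => by rw [smul_add, map_add, map_add, hz, hz']) z)
    (fun r m z => tensor_induction (p := fun z => G (r • m) z = r • G m z)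
      (fun n k => rfl)
      (fun z z' hz hz' => by rw [map_add, map_add, hz, hz', smul_add]) z)
    (fun r m z => tensor_induction (p := fun z => G m (op r • z) = op r • G m z)
      (fun n k => rfl)
      (fun z z' hz hz' => by rw [smul_add, map_add, map_add, hz, hz', smul_add]) z)
    (fun i j m hm z hz => by
      have h : tensorPiece N K j ≤ (((M.tensor N).tensor K).piece (i + j)).comap
          (show TensorCarrier N K →+ _ from G m) := (AddSubgroup.closure_le _).2 (by
        rintro _ ⟨i', j', rfl, n, hn, k, hk, rfl⟩
        change tmul (M := M.tensor N) (N := K) (tmul m n) k ∈ tensorPiece _ _ _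
        rw [← add_assoc]
        exact tmul_mem (M := M.tensor N) (N := K) (tmul_mem hm hn) hk)
      rw [add_zero]
      exact h hz)

/-- The associativity isomorphism `(M ⊗ N) ⊗ K ≅ M ⊗ (N ⊗ K)`. -/
def assocIso (M : GBimod a b) (N : GBimod b c) (K : GBimod c d) :
    (M.tensor N).tensor K ≅ M.tensor (N.tensor K) where
  hom := assocHom M N K
  inv := assocInv M N K
  hom_inv_id := DHom.ext (tensor_hom_ext_left fun _ _ _ => rfl)
  inv_hom_id := DHom.ext (tensor_hom_ext_right fun _ _ _ => rfl)

/-- The multiplication `R_u ⊗_{R_s} R_t → R_v`, for `v` refining `u` and `t`. -/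
def mulHom (hx : Refines u x) (hu : Refines u s) (ht : Refines t s) (hy : Refines t y)
    (hvu : Refines v u) (hvt : Refines v t) :
    DHom ((reg x u s hx hu).tensor (reg s t y ht hy)) (reg x v y (hvu.trans hx) (hvt.trans hy)) 0 :=
  DHom.lift (M := reg x u s hx hu) (N := reg s t y ht hy)
    (P := reg x v y (hvu.trans hx) (hvt.trans hy))
    ((AddMonoidHom.mul (R := Inv v)).compl₂ (Subalgebra.inclusion hvt.le : Inv t →+ Inv v)
      |>.comp (Subalgebra.inclusion hvu.le : Inv u →+ Inv v))
    (fun r (m : Inv u) (n : Inv t) => Subtype.ext (by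
      change (r.1 * m.1) * n.1 = m.1 * (r.1 * n.1)
      ring))
    (fun r (m : Inv u) (n : Inv t) => Subtype.ext (mul_assoc r.1 m.1 n.1))
    (fun r (m : Inv u) (n : Inv t) => Subtype.ext (mul_left_comm m.1 r.1 n.1))
    (fun i j m hm n hn => by
      rw [add_zero]
      exact IsWeightedHomogeneous.mul hm hn)

theorem mulHom_apply (hx : Refines u x) (hu : Refines u s) (ht : Refines t s) (hy : Refines t y)
    (hvu : Refines v u) (hvt : Refines v t) (m : Inv u) (n : Inv t) :
    (mulHom hx hu ht hy hvu hvt).toFun (regTmul hx hu ht hy m n) =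
      (⟨m.1 * n.1, mul_mem (hvu.le m.2) (hvt.le n.2)⟩ : Inv v) := rfl

/-- The canonical map `R_u → R_s ⊗_{R_s} R_u`, `f ↦ 1 ⊗ f`, for `u` refining `s`. -/
def unitHomLeft (hx : Refines s x) (hu : Refines u s) (hy : Refines u y) :
    DHom (reg x u y (hu.trans hx) hy)
      ((reg x s s hx (Refines.refl s)).tensor (reg s u y hu hy)) 0 where
  toFun := regTmul hx (Refines.refl s) hu hy 1
  map_left r (f : Inv u) := by
    have h1 := regTmul_balanced hx (Refines.refl s) hu hy (Subalgebra.inclusion hx.le r) 1 f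
    rw [mul_comm 1] at h1
    exact h1.symm
  map_right r f := rfl
  map_piece i f hf := by
    rw [add_comm]
    exact regTmul_mem hx (Refines.refl s) hu hy (isWeightedHomogeneous_one _ _) hf

/-- `R_u ⊗_{R_s} R_s ≅ R_u`. -/
def rightUnitIso (hx : Refines u x) (hu : Refines u s) (hy : Refines s y) :
    (reg x u s hx hu).tensor (reg s s y (Refines.refl s) hy) ≅ reg x u y hx (hu.trans hy) where
  hom := mulHom hx hu (Refines.refl s) hy (Refines.refl u) hu
  inv := unitHom hx hu hy
  hom_inv_id := DHom.ext (tensor_hom_ext fun (m : Inv u) (n : Inv s) => by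
    change regTmul hx hu (Refines.refl s) hy (m * Subalgebra.inclusion hu.le n) 1 =
      regTmul hx hu (Refines.refl s) hy m n
    rw [regTmul_balanced, mul_one]
    rfl)
  inv_hom_id := DHom.ext (AddMonoidHom.ext fun (m : Inv u) => mul_one m)

/-- `R_s ⊗_{R_s} R_u ≅ R_u`. -/
def leftUnitIso (hx : Refines s x) (hu : Refines u s) (hy : Refines u y) :
    (reg x s s hx (Refines.refl s)).tensor (reg s u y hu hy) ≅ reg x u y (hu.trans hx) hy where
  hom := mulHom hx (Refines.refl s) hu hy hu (Refines.refl u)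
  inv := unitHomLeft hx hu hy
  hom_inv_id := DHom.ext (tensor_hom_ext fun (m : Inv s) (n : Inv u) => by
    change regTmul hx (Refines.refl s) hu hy 1 (Subalgebra.inclusion hu.le m * n) =
      regTmul hx (Refines.refl s) hu hy m n
    rw [← regTmul_balanced, one_mul]
    rfl)
  inv_hom_id := DHom.ext (AddMonoidHom.ext fun (m : Inv u) => one_mul m)

/-- An isomorphism between unshifted bimodules, seen as one between shifts. -/
def shiftIso {M N : GBimod a b} (e : M ≅ N) (k : ℤ) : M.shift k ≅ N.shift k where
  hom := DHom.toShift e.hom k k (add_zero k).symm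
  inv := DHom.toShift e.inv k k (add_zero k).symm
  hom_inv_id := DHom.ext (congrArg DHom.toFun e.hom_inv_id :)
  inv_hom_id := DHom.ext (congrArg DHom.toFun e.inv_hom_id :)

/-- Both subgroups are generated by the same pure tensors; only the labelling by pairs of degrees
changes, from (p, q) to (p - i, q - j). Shifting does not touch the underlying group, so the
identity map gives the isomorphism of the shifted bimodules. -/
theorem tensor_shift_piece (M : GBimod a b) (N : GBimod b c) {i j k : ℤ} (h : i + j = k) (n : ℤ) :
    ((M.shift i).tensor (N.shift j)).piece n = ((M.tensor N).shift k).piece n := by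
  change AddSubgroup.closure _ = AddSubgroup.closure _
  congr 1
  ext z
  constructor
  · rintro ⟨p, q, rfl, m, hm, n, hn, rfl⟩
    exact ⟨p - i, q - j, by rw [← h]; ring, m, hm, n, hn, rfl⟩
  · rintro ⟨p, q, e, m, hm, n', hn, rfl⟩
    refine ⟨p + i, q + j, by rw [← h] at e; linarith, m, ?_, n', ?_, rfl⟩
    · change m ∈ M.piece (p + i - i)
      rwa [add_sub_cancel_right]
    · change n' ∈ N.piece (q + j - j)
      rwa [add_sub_cancel_right]

/-- `M{i} ⊗ N{j} ≅ (M ⊗ N){i + j}`. -/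
def tensorShiftIso (M : GBimod a b) (N : GBimod b c) {i j k : ℤ} (h : i + j = k) :
    (M.shift i).tensor (N.shift j) ≅ (M.tensor N).shift k where
  hom := (⟨AddMonoidHom.id _, fun _ _ => rfl, fun _ _ => rfl, fun n m hm => by
    rw [add_zero, ← tensor_shift_piece M N h]; exact hm⟩ :
      DHom ((M.shift i).tensor (N.shift j)) ((M.tensor N).shift k) 0)
  inv := (⟨AddMonoidHom.id _, fun _ _ => rfl, fun _ _ => rfl, fun n m hm => by
    rw [add_zero, tensor_shift_piece M N h]; exact hm⟩ :
      DHom ((M.tensor N).shift k) ((M.shift i).tensor (N.shift j)) 0)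
  hom_inv_id := rfl
  inv_hom_id := rfl

/-- `M ≅ M{0}`. -/
def shiftZeroIso (M : GBimod a b) : M ≅ M.shift 0 where
  hom := (⟨AddMonoidHom.id _, fun _ _ => rfl, fun _ _ => rfl, fun n m hm => by
    change m ∈ M.piece (n + 0 - 0); rwa [add_zero, sub_zero]⟩ : DHom M (M.shift 0) 0)
  inv := (⟨AddMonoidHom.id _, fun _ _ => rfl, fun _ _ => rfl, fun n m hm => by
    change m ∈ M.piece (n - 0) at hm; rwa [add_zero, ← sub_zero n]⟩ : DHom (M.shift 0) M 0)
  hom_inv_id := rfl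
  inv_hom_id := rfl

end Isos

/-! Divided differences -/

section DivDiff

open TensorProduct

theorem divDiff_eq {p q : Fin 4} (h : p ≠ q) {f g : Poly}
    (e : (X p - X q) * g = f - rename (Equiv.swap p q) f) : divDiff p q f = g :=
  mul_left_cancel₀ (X_sub_ne h) ((divDiff_spec p q f).trans e.symm)

/-- The divided difference is a Frobenius trace onto the polynomials symmetric in x_p and x_q, with
dual bases (x_p, 1) and (1, -x_q). This is the expansion of f in the basis (1, -x_q). -/
theorem divDiff_reconstruct {p q : Fin 4} (h : p ≠ q) (f : Poly) :
    divDiff p q (X p * f) - X q * divDiff p q f = f := by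
  apply mul_left_cancel₀ (X_sub_ne h)
  rw [mul_sub, mul_left_comm, divDiff_spec, divDiff_spec, map_mul, rename_X, Equiv.swap_apply_left]
  ring

/-- The expansion with the two dual bases interchanged. -/
theorem divDiff_reconstruct' {p q : Fin 4} (h : p ≠ q) (f : Poly) :
    X p * divDiff p q f - divDiff p q (X q * f) = f := by
  apply mul_left_cancel₀ (X_sub_ne h)
  rw [mul_sub, mul_left_comm, divDiff_spec, divDiff_spec, map_mul, rename_X,
    Equiv.swap_apply_right]
  ring

/-- The twisted Leibniz rule: fg - s(f)s(g) = (f - s(f))s(g) + f(g - s(g)) for the transposition s.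
-/
theorem divDiff_mul {p q : Fin 4} (h : p ≠ q) (f g : Poly) :
    divDiff p q (f * g) = divDiff p q f * rename (Equiv.swap p q) g + f * divDiff p q g := by
  apply mul_left_cancel₀ (X_sub_ne h)
  rw [mul_add, ← mul_assoc, mul_left_comm, divDiff_spec, divDiff_spec, divDiff_spec, map_mul]
  ring

/-- Divided differences as additive maps. -/
def divDiffHom {p q : Fin 4} (h : p ≠ q) : Poly →+ Poly :=
  AddMonoidHom.mk' (divDiff p q) (divDiff_add h)

theorem divDiff_zero {p q : Fin 4} (h : p ≠ q) : divDiff p q 0 = 0 := map_zero (divDiffHom h)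

theorem divDiff_sub {p q : Fin 4} (h : p ≠ q) (f g : Poly) :
    divDiff p q (f - g) = divDiff p q f - divDiff p q g := map_sub (divDiffHom h) f g

theorem divDiff_neg {p q : Fin 4} (h : p ≠ q) (f : Poly) :
    divDiff p q (-f) = -divDiff p q f := map_neg (divDiffHom h) f

theorem divDiff_zsmul {p q : Fin 4} (h : p ≠ q) (n : ℤ) (f : Poly) :
    divDiff p q (n • f) = n • divDiff p q f := map_zsmul (divDiffHom h) n f

theorem divDiff_sum {p q : Fin 4} (h : p ≠ q) {ι : Type} (S : Finset ι) (f : ι → Poly) :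
    divDiff p q (∑ i ∈ S, f i) = ∑ i ∈ S, divDiff p q (f i) := map_sum (divDiffHom h) f S

theorem divDiff_of_fixed {p q : Fin 4} (h : p ≠ q) {f : Poly}
    (hf : rename (Equiv.swap p q) f = f) : divDiff p q f = 0 :=
  divDiff_eq h (by rw [hf, sub_self, mul_zero])

/-- The composition `∂₂ ∂₃` of divided differences. -/
def trace (f : Poly) : Poly := divDiff 1 2 (divDiff 2 3 f)

/-- Clears denominators in ∂_2∂_3: the factor on the left is the Vandermonde product of x_2, x_3,
x_4. Later identities for the trace thereby become polynomial identities in f and its conjugates. -/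
theorem trace_spec {f : Poly} :
    (X 1 - X 2) * (X 1 - X 3) * (X 2 - X 3) * trace f =
      (X 1 - X 3) * (f - rename (Equiv.swap 2 3) f) -
        (X 2 - X 3) * (rename (Equiv.swap 1 2) f -
          rename (Equiv.swap 1 2) (rename (Equiv.swap 2 3) f)) := by
  have h1 := divDiff_spec 1 2 (divDiff 2 3 f)
  have h2 := divDiff_spec 2 3 f
  have h3 := congrArg (rename (Equiv.swap (1 : Fin 4) 2)) h2
  simp only [map_mul, map_sub, rename_X, Equiv.swap_apply_right,
    Equiv.swap_apply_of_ne_of_ne (show (3 : Fin 4) ≠ 1 by decide) (show (3 : Fin 4) ≠ 2 by decide)]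
    at h3
  unfold trace
  linear_combination (X 1 - X 3) * (X 2 - X 3) * h1 + (X 1 - X 3) * h2 - (X 2 - X 3) * h3

end DivDiff

/-! ### The Frobenius extension of R_121 over R_13 -/

theorem merges_c1111_c211 : Merges c1111 c211 0 1 := by decide
theorem refines_c1111_c112 : Refines c1111 c112 := by decide
theorem refines_c121_c13 : Refines c121 c13 := by decide
theorem refines_c13_c4 : Refines c13 c4 := by decide
theorem refines_c211_c22 : Refines c211 c22 := by decide
theorem splits_c121_c1111 : Splits c121 c1111 {1} 2 := by decide

theorem mem_Inv_c1111 (f : Poly) : f ∈ Inv c1111 := fun σ h => by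
  have : σ = 1 := Equiv.ext fun i => by
    have h' : ∀ i j : Fin 4, c1111 i = c1111 j → i = j := by decide
    exact h' _ _ (h i)
  rw [this]; exact congrFun (congrArg DFunLike.coe rename_id) f

theorem rename_swap_c121 {f : Poly} (hf : f ∈ Inv c121) : rename (Equiv.swap 1 2) f = f :=
  merges_c1111_c121.rename_swap hf

theorem X_zero_mem_c13 : (X 0 : Poly) ∈ Inv c13 := X_mem splits_c13_c121.2.2 (by decide)
theorem X_three_mem_c121 : (X 3 : Poly) ∈ Inv c121 := X_mem splits_c13_c121.2.1 (by decide)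

theorem X_one_mem_c112 : (X 1 : Poly) ∈ Inv c112 :=
  X_mem (U := {2, 3}) (by decide) (by decide)

/-- The permutations of x_2, x_3, x_4 are generated by two adjacent transpositions. Invariance under
the first holds because the trace is an image of ∂_2; for the second, the numerator in `trace_spec`
and the Vandermonde product both change sign. -/
theorem trace_mem {f : Poly} (hf : f ∈ Inv c121) : trace f ∈ Inv c13 := by
  have key : ∀ σ : Equiv.Perm (Fin 4), (∀ i, c13 (σ i) = c13 i) → σ = 1 ∨ σ = Equiv.swap 1 2 ∨
    σ = Equiv.swap 2 3 ∨ σ = Equiv.swap 1 2 * Equiv.swap 2 3 ∨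
    σ = Equiv.swap 2 3 * Equiv.swap 1 2 ∨
    σ = Equiv.swap 1 2 * (Equiv.swap 2 3 * Equiv.swap 1 2) := by decide
  have h12 : rename (Equiv.swap 1 2) (trace f) = trace f := rename_divDiff_swap (by decide) _
  have h23 : rename (Equiv.swap 2 3) (trace f) = trace f := by
    have hne : ((X 1 - X 2) * (X 1 - X 3) * (X 2 - X 3) : Poly) ≠ 0 :=
      mul_ne_zero (mul_ne_zero (X_sub_ne (by decide)) (X_sub_ne (by decide)))
        (X_sub_ne (by decide))
    apply mul_left_cancel₀ hne
    have h := trace_spec (f := f)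
    rw [rename_swap_c121 hf] at h
    have h' := congrArg (rename (Equiv.swap (2 : Fin 4) 3)) h
    have e1 : ∀ g : Poly, rename (Equiv.swap 2 3) (rename (Equiv.swap (2 : Fin 4) 3) g) = g :=
      fun g => by rw [rename_rename, ← Equiv.coe_trans, Equiv.swap_swap]; simp
    -- The braid relation: as f is fixed by the swap of x_2 and x_3, a copy of that swap can be
    -- inserted in front of f on the right-hand side.
    have e2 : rename (Equiv.swap 2 3) (rename (Equiv.swap 1 2) (rename (Equiv.swap 2 3) f)) =
        rename (Equiv.swap 1 2) (rename (Equiv.swap 2 3) f) := by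
      nth_rewrite 2 [← rename_swap_c121 hf]
      simp only [rename_rename]
      congr 2
      funext i; revert i; decide
    simp only [map_mul, map_sub, rename_X, Equiv.swap_apply_right, Equiv.swap_apply_left, e1, e2,
      Equiv.swap_apply_of_ne_of_ne (show (1 : Fin 4) ≠ 2 by decide)
        (show (1 : Fin 4) ≠ 3 by decide)] at h'
    rw [h]
    linear_combination -h'
  intro σ hσ
  rcases key σ hσ with rfl | rfl | rfl | rfl | rfl | rfl
  · simp
  · exact h12
  · exact h23
  · rw [Equiv.Perm.coe_mul, ← rename_rename, h23, h12]
  · rw [Equiv.Perm.coe_mul, ← rename_rename, h12, h23]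
  · rw [Equiv.Perm.coe_mul, Equiv.Perm.coe_mul, ← rename_rename, ← rename_rename, h12, h23, h12]

theorem trace_add (f g : Poly) : trace (f + g) = trace f + trace g := by
  unfold trace
  rw [divDiff_add (by decide), divDiff_add (by decide)]

theorem trace_mul {f : Poly} (hf : f ∈ Inv c13) (g : Poly) : trace (f * g) = f * trace g := by
  unfold trace
  rw [Merges.divDiff_mul (s := ![0, 1, 2, 3]) (t := ![0, 1, 2, 2]) (by decide)
      (Refines.le (by decide) hf),
    Merges.divDiff_mul (s := ![0, 1, 2, 3]) (t := ![0, 1, 1, 2]) (by decide)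
      (Refines.le (by decide) hf)]

/-- The trace `R₁₂₁ → R₁₃`. -/
def traceHom {x y : Fin 4 → ℕ} (hx : Refines c13 x) (hy : Refines c13 y) :
    DHom (reg x c121 y (refines_c121_c13.trans hx) (refines_c121_c13.trans hy))
      (reg x c13 y hx hy) (-4) where
  toFun := AddMonoidHom.mk' (fun f : Inv c121 => (⟨trace f, trace_mem f.2⟩ : Inv c13))
    fun f g => Subtype.ext (trace_add f.1 g.1)
  map_left r f := Subtype.ext (trace_mul (hx.le r.2) f.1)
  map_right r f := Subtype.ext (trace_mul (hy.le r.2) f.1)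
  map_piece i f hf := by
    have h := divDiff_isWH (p := 1) (q := 2) (by decide)
      (divDiff_isWH (p := 2) (q := 3) (by decide) hf)
    rw [add_assoc] at h
    exact h

/-- The families x_4^{2-j} and (-1)^j e_j(x_2, x_3) are dual bases for the trace. Indeed ∑ (-1)^j
x_4^{2-j} e_j(y, z) = (x_4 - y)(x_4 - z). By `trace_spec` the sum involves three conjugates of f,
with {y, z} equal to {x_2, x_3}, {x_2, x_4} and {x_3, x_4}; the last two factors vanish and the
first, multiplied by x_2 - x_3, cancels the Vandermonde product. -/
theorem trace_reconstruct {f : Poly} (hf : f ∈ Inv c121) :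
    ∑ j ∈ Finset.range 3, (-1) ^ j * (X 3 ^ (2 - j) * trace (esymmOn {1, 2} j * f)) = f := by
  have hne : ((X 1 - X 2) * (X 1 - X 3) * (X 2 - X 3) : Poly) ≠ 0 :=
    mul_ne_zero (mul_ne_zero (X_sub_ne (by decide)) (X_sub_ne (by decide)))
      (X_sub_ne (by decide))
  apply mul_left_cancel₀ hne
  have e0 : esymmOn ({1, 2} : Finset (Fin 4)) 0 = 1 := esymmOn_zero _
  have e1 : esymmOn ({1, 2} : Finset (Fin 4)) 1 = X 1 + X 2 := by
    simp [esymmOn, Finset.powersetCard_one]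
  have e2 : esymmOn ({1, 2} : Finset (Fin 4)) 2 = X 1 * X 2 := by
    have : Finset.powersetCard 2 ({1, 2} : Finset (Fin 4)) = {{1, 2}} := by decide
    simp [esymmOn, this]
  have s12 := rename_swap_c121 hf
  simp only [Finset.sum_range_succ, Finset.sum_range_zero, e0, e1, e2]
  have t0 := trace_spec (f := 1 * f)
  have t1 := trace_spec (f := (X 1 + X 2) * f)
  have t2 := trace_spec (f := X 1 * X 2 * f)
  simp only [map_mul, map_add, map_one, rename_X, s12, Equiv.swap_apply_left,
    Equiv.swap_apply_right,
    Equiv.swap_apply_of_ne_of_ne (show (1 : Fin 4) ≠ 2 by decide) (show (1 : Fin 4) ≠ 3 by decide),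
    Equiv.swap_apply_of_ne_of_ne (show (3 : Fin 4) ≠ 1 by decide) (show (3 : Fin 4) ≠ 2 by decide)]
    at t0 t1 t2
  linear_combination X 3 ^ 2 * t0 - X 3 * t1 + t2

/-! ### The isomorphism R_112 ⊗_22 R_211 ≅ R_1111 -/

section

variable {a b c x y : Fin 4 → ℕ}

/-- A degree-preserving bimodule map with a degree-preserving additive inverse is an
isomorphism. -/
def isoOfInverse {M N : GBimod a b} (φ : DHom M N 0) (ψ : N.carrier →+ M.carrier)
    (h₁ : ∀ m, ψ (φ.toFun m) = m) (h₂ : ∀ n, φ.toFun (ψ n) = n)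
    (h : ∀ i, ∀ n ∈ N.piece i, ψ n ∈ M.piece i) : M ≅ N where
  hom := φ
  inv := (⟨ψ, fun r n => by
      have e := φ.map_left r (ψ n)
      rw [h₂] at e
      rw [← e, h₁], fun r n => by
      have e := φ.map_right r (ψ n)
      rw [h₂] at e
      rw [← e, h₁], fun i n hn => by rw [add_zero]; exact h i n hn⟩ : DHom N M 0)
  hom_inv_id := GBimod.hom_ext h₁
  inv_hom_id := GBimod.hom_ext h₂

/-- The divided difference `∂₁ : R₁₁₁₁ → R₂₁₁`. -/
def divDiff211 : Inv c1111 →+ Inv c211 :=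
  AddMonoidHom.mk' (fun f => ⟨divDiff 0 1 f.1, merges_c1111_c211.divDiff_mem f.2⟩)
    fun f g => Subtype.ext (divDiff_add (by decide) f.1 g.1)

/-- The map `R₁₁₁₁ → R₁₁₂ ⊗_{R₂₂} R₂₁₁`, `f ↦ 1 ⊗ ∂₁(x₁ f) - x₂ ⊗ ∂₁(f)`. -/
def splitComul (hx : Refines c112 x) (hy : Refines c211 y) :
    Inv c1111 →+ TensorCarrier (reg x c112 c22 hx refines_c112_c22)
      (reg c22 c211 y refines_c211_c22 hy) :=
  (regTmul hx refines_c112_c22 refines_c211_c22 hy 1).comp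
      (divDiff211.comp (AddMonoidHom.mulLeft ⟨X 0, mem_Inv_c1111 _⟩)) -
    (regTmul hx refines_c112_c22 refines_c211_c22 hy ⟨X 1, X_one_mem_c112⟩).comp divDiff211

theorem splitComul_apply (hx : Refines c112 x) (hy : Refines c211 y) (f : Inv c1111) :
    splitComul hx hy f = regTmul hx refines_c112_c22 refines_c211_c22 hy 1
          ⟨divDiff 0 1 (X 0 * f.1), merges_c1111_c211.divDiff_mem (mem_Inv_c1111 _)⟩ -
        regTmul hx refines_c112_c22 refines_c211_c22 hy ⟨X 1, X_one_mem_c112⟩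
          ⟨divDiff 0 1 f.1, merges_c1111_c211.divDiff_mem f.2⟩ := rfl

/-- As n is symmetric in x_1 and x_2, it comes out of ∂_1. The remaining coefficients ∂_1(x_1 m) and
∂_1(m) lie in R_22, so they cross the tensor sign, where `divDiff_reconstruct` reassembles m. -/
theorem splitComul_mul (hx : Refines c112 x) (hy : Refines c211 y) (m : Inv c112) (n : Inv c211) :
    splitComul hx hy ⟨m.1 * n.1, mem_Inv_c1111 _⟩ =
      regTmul hx refines_c112_c22 refines_c211_c22 hy m n := by
  have hM : Merges c112 c22 0 1 := by decide
  let r : Inv c22 := ⟨divDiff 0 1 m.1, hM.divDiff_mem m.2⟩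
  let r' : Inv c22 := ⟨divDiff 0 1 (X 0 * m.1), hM.divDiff_mem
    (mul_mem (X_mem (U := {2, 3}) (by decide) (by decide)) m.2)⟩
  have e1 : (⟨divDiff 0 1 (X 0 * (m.1 * n.1)),
      merges_c1111_c211.divDiff_mem (mem_Inv_c1111 _)⟩ : Inv c211) =
      Subalgebra.inclusion refines_c211_c22.le r' * n := Subtype.ext (by
    change divDiff 0 1 (X 0 * (m.1 * n.1)) = divDiff 0 1 (X 0 * m.1) * n.1
    rw [← mul_assoc, mul_comm, merges_c1111_c211.divDiff_mul n.2, mul_comm])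
  have e2 : (⟨divDiff 0 1 (m.1 * n.1),
      merges_c1111_c211.divDiff_mem (mem_Inv_c1111 _)⟩ : Inv c211) =
      Subalgebra.inclusion refines_c211_c22.le r * n := Subtype.ext (by
    change divDiff 0 1 (m.1 * n.1) = divDiff 0 1 m.1 * n.1
    rw [mul_comm, merges_c1111_c211.divDiff_mul n.2, mul_comm])
  rw [splitComul_apply, e1, e2, ← regTmul_balanced, ← regTmul_balanced, ← AddMonoidHom.sub_apply,
    ← map_sub]
  refine congrArg (fun w => regTmul hx refines_c112_c22 refines_c211_c22 hy w n)
    (Subtype.ext ?_)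
  change 1 * divDiff 0 1 (X 0 * m.1) - X 1 * divDiff 0 1 m.1 = m.1
  rw [one_mul, divDiff_reconstruct (by decide)]

/-- The multiplication `R₁₁₂ ⊗_{R₂₂} R₂₁₁ → R₁₁₁₁`. -/
def splitMul (hx : Refines c112 x) (hy : Refines c211 y) :
    DHom ((reg x c112 c22 hx refines_c112_c22).tensor (reg c22 c211 y refines_c211_c22 hy))
      (reg x c1111 y (refines_c1111_c112.trans hx) (refines_c1111_c211.trans hy)) 0 :=
  mulHom hx refines_c112_c22 refines_c211_c22 hy refines_c1111_c112 refines_c1111_c211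

theorem splitMul_regTmul (hx : Refines c112 x) (hy : Refines c211 y) (m : Inv c112)
    (n : Inv c211) : (splitMul hx hy).toFun (regTmul hx refines_c112_c22 refines_c211_c22 hy m n) =
      (⟨m.1 * n.1, mem_Inv_c1111 _⟩ : Inv c1111) :=
  mulHom_apply hx refines_c112_c22 refines_c211_c22 hy refines_c1111_c112 refines_c1111_c211 m n

theorem splitComul_splitMul (hx : Refines c112 x) (hy : Refines c211 y)
    (z : TensorCarrier (reg x c112 c22 hx refines_c112_c22)
      (reg c22 c211 y refines_c211_c22 hy)) :
    splitComul hx hy ((splitMul hx hy).toFun z) = z :=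
  tensor_induction (p := fun z => splitComul hx hy ((splitMul hx hy).toFun z) = z)
    (fun m n => (congrArg (splitComul hx hy) (splitMul_regTmul hx hy m n)).trans
      (splitComul_mul hx hy m n))
    (fun z z' hz hz' => (congrArg (splitComul hx hy) (map_add (splitMul hx hy).toFun z z')).trans
      ((map_add (splitComul hx hy) _ _).trans (congrArg₂ _ hz hz'))) z

theorem splitMul_splitComul (hx : Refines c112 x) (hy : Refines c211 y) (f : Inv c1111) :
    (splitMul hx hy).toFun (splitComul hx hy f) = f := by
  refine (congrArg _ (splitComul_apply hx hy f)).trans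
    ((map_sub (splitMul hx hy).toFun _ _).trans ((congrArg₂ _ (splitMul_regTmul hx hy _ _)
      (splitMul_regTmul hx hy _ _)).trans (Subtype.ext ?_)))
  change 1 * divDiff 0 1 (X 0 * f.1) - X 1 * divDiff 0 1 f.1 = f.1
  rw [one_mul, divDiff_reconstruct (by decide)]

theorem splitComul_mem (hx : Refines c112 x) (hy : Refines c211 y) (i : ℤ) (f : Inv c1111)
    (hf : f ∈ Inv.piece c1111 i) : splitComul hx hy f ∈
      tensorPiece (reg x c112 c22 hx refines_c112_c22) (reg c22 c211 y refines_c211_c22 hy) i := by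
  rw [splitComul_apply]
  refine AddSubgroup.sub_mem _ ?_ ?_
  · have e : i = 0 + (2 + i + -2) := by ring
    rw [e]
    exact regTmul_mem hx refines_c112_c22 refines_c211_c22 hy
      (isWeightedHomogeneous_one _ _) (divDiff_isWH (by decide)
        (IsWeightedHomogeneous.mul (isWeightedHomogeneous_X ℂ _ 0) hf))
  · have e : i = 2 + (i + -2) := by ring
    rw [e]
    exact regTmul_mem hx refines_c112_c22 refines_c211_c22 hy
      (isWeightedHomogeneous_X ℂ _ 1) (divDiff_isWH (by decide) hf)

/-- `R₁₁₂ ⊗_{R₂₂} R₂₁₁ ≅ R₁₁₁₁`. -/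
def splitMulIso (hx : Refines c112 x) (hy : Refines c211 y) :
    (reg x c112 c22 hx refines_c112_c22).tensor (reg c22 c211 y refines_c211_c22 hy) ≅
      reg x c1111 y (refines_c1111_c112.trans hx) (refines_c1111_c211.trans hy) :=
  isoOfInverse (splitMul hx hy) (splitComul hx hy) (splitComul_splitMul hx hy)
    (splitMul_splitComul hx hy) (splitComul_mem hx hy)

/-! Direct sums -/

/-- The first inclusion. -/
def prodInl (M N : GBimod a b) : M ⟶ M.prod N :=
  (⟨AddMonoidHom.inl _ _, fun r m => Prod.ext rfl (smul_zero r).symm,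
    fun r m => Prod.ext rfl (smul_zero (op r)).symm, fun i m hm => by
      rw [add_zero]; exact ⟨hm, zero_mem _⟩⟩ : DHom M (M.prod N) 0)

/-- The second inclusion. -/
def prodInr (M N : GBimod a b) : N ⟶ M.prod N :=
  (⟨AddMonoidHom.inr _ _, fun r m => Prod.ext (smul_zero r).symm rfl,
    fun r m => Prod.ext (smul_zero (op r)).symm rfl, fun i m hm => by
      rw [add_zero]; exact ⟨zero_mem _, hm⟩⟩ : DHom N (M.prod N) 0)

/-- The first projection. -/
def prodFst (M N : GBimod a b) : M.prod N ⟶ M :=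
  (⟨AddMonoidHom.fst _ _, fun _ _ => rfl, fun _ _ => rfl, fun i m hm => by
      rw [add_zero]; exact hm.1⟩ : DHom (M.prod N) M 0)

/-- The second projection. -/
def prodSnd (M N : GBimod a b) : M.prod N ⟶ N :=
  (⟨AddMonoidHom.snd _ _, fun _ _ => rfl, fun _ _ => rfl, fun i m hm => by
      rw [add_zero]; exact hm.2⟩ : DHom (M.prod N) N 0)

theorem prod_total (M N : GBimod a b) :
    prodFst M N ≫ prodInl M N + prodSnd M N ≫ prodInr M N = 𝟙 _ :=
  GBimod.hom_ext fun m => Prod.ext (add_zero m.1) (zero_add m.2)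

end

/-! Composite isomorphisms -/

section

variable {a b c d : Fin 4 → ℕ}

theorem assocHom_tmul {M : GBimod a b} {N : GBimod b c} {K : GBimod c d}
    (m : M.carrier) (n : N.carrier) (k : K.carrier) :
    (assocHom M N K).toFun (tmul (M := M.tensor N) (tmul m n) k) =
      tmul (N := N.tensor K) m (tmul n k) := rfl

/-- `M ⊗ (N ⊗ K) ≅ L ⊗ K` if `M ⊗ N ≅ L`. -/
def contractLeft {M : GBimod a b} {N : GBimod b c} {L : GBimod a c} (e : M.tensor N ≅ L)
    (K : GBimod c d) : M.tensor (N.tensor K) ≅ L.tensor K :=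
  (assocIso M N K).symm ≪≫ (GBimod.tensorRight a K).mapIso e

theorem contractLeft_hom {M : GBimod a b} {N : GBimod b c} {L : GBimod a c} (e : M.tensor N ≅ L)
    (K : GBimod c d) (m : M.carrier) (n : N.carrier) (k : K.carrier) :
    (contractLeft e K).hom.toFun (tmul (N := N.tensor K) m (tmul n k)) =
      tmul (e.hom.toFun (tmul m n)) k := rfl

theorem contractLeft_inv {M : GBimod a b} {N : GBimod b c} {L : GBimod a c} (e : M.tensor N ≅ L)
    (K : GBimod c d) (l : L.carrier) (k : K.carrier) :
    (contractLeft e K).inv.toFun (tmul l k) =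
      (assocHom M N K).toFun (tmul (M := M.tensor N) (e.inv.toFun l) k) := rfl

/-- Reassociation is explicit only on pure tensors. The hypothesis on `e.inv` is satisfied by the
unit isomorphisms, but not by `splitMulIso`, whose inverse produces two terms. -/
theorem contractLeft_inv_of_eq {M : GBimod a b} {N : GBimod b c} {L : GBimod a c}
    (e : M.tensor N ≅ L) (K : GBimod c d) (l : L.carrier) (k : K.carrier) (m : M.carrier)
    (n : N.carrier) (h : e.inv.toFun l = tmul m n) :
    (contractLeft e K).inv.toFun (tmul l k) = tmul (N := N.tensor K) m (tmul n k) :=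
  congrArg (fun z => (assocHom M N K).toFun (tmul (M := M.tensor N) z k)) h

/-- `(M ⊗ N) ⊗ K ≅ M ⊗ L` if `N ⊗ K ≅ L`. -/
def contractRight (M : GBimod a b) {N : GBimod b c} {K : GBimod c d} {L : GBimod b d}
    (e : N.tensor K ≅ L) : (M.tensor N).tensor K ≅ M.tensor L :=
  assocIso M N K ≪≫ (GBimod.tensorLeft M d).mapIso e

theorem contractRight_hom (M : GBimod a b) {N : GBimod b c} {K : GBimod c d} {L : GBimod b d}
    (e : N.tensor K ≅ L) (m : M.carrier) (n : N.carrier) (k : K.carrier) :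
    (contractRight M e).hom.toFun (tmul (M := M.tensor N) (tmul m n) k) =
      tmul m (e.hom.toFun (tmul n k)) := rfl

theorem contractRight_inv (M : GBimod a b) {N : GBimod b c} {K : GBimod c d} {L : GBimod b d}
    (e : N.tensor K ≅ L) (m : M.carrier) (l : L.carrier) (n : N.carrier) (k : K.carrier)
    (h : e.inv.toFun l = tmul n k) :
    (contractRight M e).inv.toFun (tmul m l) = tmul (M := M.tensor N) (tmul m n) k :=
  congrArg (fun z => (assocInv M N K).toFun (tmul (N := N.tensor K) m z)) h

/-- `M ⊗ N{k} ≅ (M ⊗ N){k}`. -/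
def shiftRightIso (M : GBimod a b) (N : GBimod b c) (k : ℤ) :
    M.tensor (N.shift k) ≅ (M.tensor N).shift k :=
  (GBimod.tensorRight a (N.shift k)).mapIso (shiftZeroIso M) ≪≫ tensorShiftIso M N (zero_add k)

theorem shiftRightIso_hom (M : GBimod a b) (N : GBimod b c) (k : ℤ) (m : M.carrier)
    (n : N.carrier) : (shiftRightIso M N k).hom.toFun (tmul (N := N.shift k) m n) = tmul m n := rfl

theorem shiftRightIso_inv (M : GBimod a b) (N : GBimod b c) (k : ℤ) (m : M.carrier)
    (n : N.carrier) : (shiftRightIso M N k).inv.toFun (tmul m n) = tmul (N := N.shift k) m n := rfl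

/-- `(M{i} ⊗ N{j}) ⊗ K ≅ (M ⊗ L){i + j}` if `N ⊗ K ≅ L`. -/
def shiftPairIso (M : GBimod a b) {N : GBimod b c} {K : GBimod c d} {L : GBimod b d}
    (e : N.tensor K ≅ L) {i j k : ℤ} (h : i + j = k) :
    ((M.shift i).tensor (N.shift j)).tensor K ≅ (M.tensor L).shift k :=
  (GBimod.tensorRight a K).mapIso (tensorShiftIso M N h) ≪≫
    (GBimod.tensorLeft ((M.tensor N).shift k) d).mapIso (shiftZeroIso K) ≪≫
    tensorShiftIso (M.tensor N) K (add_zero k) ≪≫ shiftIso (contractRight M e) k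

theorem shiftPairIso_hom (M : GBimod a b) {N : GBimod b c} {K : GBimod c d} {L : GBimod b d}
    (e : N.tensor K ≅ L) {i j k : ℤ} (h : i + j = k) (m : M.carrier) (n : N.carrier)
    (q : K.carrier) :
    (shiftPairIso M e h).hom.toFun (tmul (M := (M.shift i).tensor (N.shift j))
      (tmul (M := M.shift i) (N := N.shift j) m n) q) = tmul m (e.hom.toFun (tmul n q)) := rfl

theorem shiftPairIso_inv (M : GBimod a b) {N : GBimod b c} {K : GBimod c d} {L : GBimod b d}
    (e : N.tensor K ≅ L) {i j k : ℤ} (h : i + j = k) (m : M.carrier) (l : L.carrier)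
    (n : N.carrier) (q : K.carrier) (hl : e.inv.toFun l = tmul n q) :
    (shiftPairIso M e h).inv.toFun (tmul m l) = tmul (M := (M.shift i).tensor (N.shift j))
      (tmul (M := M.shift i) (N := N.shift j) m n) q :=
  congrArg (fun z => ((GBimod.tensorRight a K).mapIso (tensorShiftIso M N h) ≪≫
    (GBimod.tensorLeft ((M.tensor N).shift k) d).mapIso (shiftZeroIso K) ≪≫
    tensorShiftIso (M.tensor N) K (add_zero k)).inv.toFun z) (contractRight_inv M e m l n q hl)

end

/-! The terms of the two complexes -/

/-- `R₁₁₂ ⊗_{R₄} R₂₂`. -/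
def modelA₀ : GBimod c112 c22 :=
  (reg c112 c112 c4 (Refines.refl _) (refines_c112_c22.trans refines_c22_c4)).tensor
    (reg c4 c22 c22 refines_c22_c4 (Refines.refl _))

/-- `R₁₁₁₁ ⊗_{R₃₁} R₂₁₁`. -/
def modelQ : GBimod c112 c22 :=
  (reg c112 c1111 c31 refines_c1111_c112
    (refines_c1111_c211.trans splits_c31_c211.refines)).tensor
    (reg c31 c211 c22 splits_c31_c211.refines refines_c211_c22)

/-- `R₁₁₂`. -/
def modelA₂ : GBimod c112 c22 := reg c112 c112 c22 (Refines.refl _) refines_c112_c22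

/-- `R₁₂₁ ⊗_{R₃₁} R₂₁₁`. -/
def modelE : GBimod c13 c22 :=
  (reg c13 c121 c31 refines_c121_c13 refines_c121_c31).tensor
    (reg c31 c211 c22 splits_c31_c211.refines refines_c211_c22)

/-- `R₁₁₂ ⊗_{R₁₃} R₁₂₁ ⊗_{R₃₁} R₂₁₁`. -/
def modelB₀ : GBimod c112 c22 :=
  (reg c112 c112 c13 (Refines.refl _) refines_c112_c13).tensor modelE

/-- `R₁₁₂ ⊗_{R₁₃} R₁₁₁₁`. -/
def modelP : GBimod c112 c22 :=
  (reg c112 c112 c13 (Refines.refl _) refines_c112_c13).tensor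
    (reg c13 c1111 c22 (refines_c1111_c121.trans refines_c121_c13)
      (refines_c1111_c211.trans refines_c211_c22))

/-- `R₁₁₁₁ ⊗_{R₁₂₁} R₁₁₁₁`. -/
def modelB₂ : GBimod c112 c22 :=
  (reg c112 c1111 c121 refines_c1111_c112 refines_c1111_c121).tensor
    (reg c121 c1111 c22 refines_c1111_c121 (refines_c1111_c211.trans refines_c211_c22))

/-- The term of degree `0` of `splitAfterCrossing`. -/
def isoA₀ : splitAfterCrossing.X 0 ≅ modelA₀.shift 0 :=
  shiftRightIso splitLeft (dumbbell c22 c4 c22 refines_c22_c4 refines_c22_c4) 0 ≪≫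
    shiftIso (contractLeft (rightUnitIso (Refines.refl c112) refines_c112_c22 refines_c22_c4)
      (reg c4 c22 c22 refines_c22_c4 (Refines.refl _))) 0

/-- The term of degree `1` of `splitAfterCrossing`. -/
def isoA₁ : splitAfterCrossing.X 1 ≅ modelQ.shift 2 :=
  shiftRightIso splitLeft square 2 ≪≫
    shiftIso (contractLeft (splitMulIso (Refines.refl c112) splits_c31_c211.refines)
      (reg c31 c211 c22 splits_c31_c211.refines merges_c211_c22.refines)) 2

/-- The term of degree `2` of `splitAfterCrossing`. -/
def isoA₂ : splitAfterCrossing.X 2 ≅ modelA₂.shift 6 :=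
  shiftRightIso splitLeft (reg c22 c22 c22 (Refines.refl _) (Refines.refl _)) 6 ≪≫
    shiftIso (rightUnitIso (Refines.refl c112) refines_c112_c22 (Refines.refl c22)) 6

/-- The bimodule of the dumbbell web of the upper crossing. -/
abbrev upperDumbbell : GBimod c112 c121 :=
  dumbbell c112 c13 c121 refines_c112_c13 splits_c13_c121.refines

/-- The bimodule of the dumbbell web of the lower crossing. -/
abbrev lowerDumbbell : GBimod c121 c211 :=
  dumbbell c121 c31 c211 refines_c121_c31 splits_c31_c211.refines

/-- The bimodule of the `H`-shaped web of the upper crossing. -/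
abbrev upperWeb : GBimod c112 c121 := hWeb merges_c1111_c112 refines_c1111_c121

/-- The bimodule of the `H`-shaped web of the lower crossing. -/
abbrev lowerWeb : GBimod c121 c211 := hWeb merges_c1111_c121 refines_c1111_c211

/-- `(R₁₂₁ ⊗_{R₃₁} R₂₁₁) ⊗_{R₂₁₁} R₂₁₁ ≅ R₁₂₁ ⊗_{R₃₁} R₂₁₁`. -/
def lowerDumbbellSplit : lowerDumbbell.tensor splitRight ≅
    (reg c121 c121 c31 (Refines.refl _) refines_c121_c31).tensor
      (reg c31 c211 c22 splits_c31_c211.refines refines_c211_c22) :=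
  contractRight (reg c121 c121 c31 (Refines.refl _) refines_c121_c31)
    (rightUnitIso splits_c31_c211.refines (Refines.refl c211) refines_c211_c22)

/-- `R₁₁₁₁ ⊗_{R₂₁₁} R₂₁₁ ≅ R₁₁₁₁`. -/
def lowerWebSplit : lowerWeb.tensor splitRight ≅
    reg c121 c1111 c22 refines_c1111_c121 (refines_c1111_c211.trans refines_c211_c22) :=
  rightUnitIso refines_c1111_c121 refines_c1111_c211 refines_c211_c22

/-- `R₁₂₁ ⊗_{R₁₂₁} (R₁₂₁ ⊗_{R₃₁} R₂₁₁) ≅ R₁₂₁ ⊗_{R₃₁} R₂₁₁`. -/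
def absorbE : (reg c13 c121 c121 splits_c13_c121.refines (Refines.refl _)).tensor
    ((reg c121 c121 c31 (Refines.refl _) refines_c121_c31).tensor
      (reg c31 c211 c22 splits_c31_c211.refines refines_c211_c22)) ≅ modelE :=
  contractLeft (leftUnitIso splits_c13_c121.refines (Refines.refl c121) refines_c121_c31)
    (reg c31 c211 c22 splits_c31_c211.refines refines_c211_c22)

/-- `R₁₂₁ ⊗_{R₁₂₁} R₁₁₁₁ ≅ R₁₁₁₁`. -/
def absorbP : (reg c13 c121 c121 splits_c13_c121.refines (Refines.refl _)).tensor
    (reg c121 c1111 c22 refines_c1111_c121 (refines_c1111_c211.trans refines_c211_c22)) ≅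
    reg c13 c1111 c22 (refines_c1111_c121.trans refines_c121_c13)
      (refines_c1111_c211.trans refines_c211_c22) :=
  leftUnitIso splits_c13_c121.refines refines_c1111_c121
    (refines_c1111_c211.trans refines_c211_c22)

/-- The term of degree `0` of `splitBeforeCrossing`. -/
def isoB₀ : splitBeforeCrossing.X 0 ≅ modelB₀.shift 0 :=
  shiftPairIso upperDumbbell lowerDumbbellSplit (add_zero 0) ≪≫
    shiftIso (contractRight (reg c112 c112 c13 (Refines.refl _) refines_c112_c13) absorbE) 0

/-- The term of degree `2` of `splitBeforeCrossing`. -/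
def isoB₂ : splitBeforeCrossing.X 2 ≅ modelB₂.shift 4 :=
  shiftPairIso upperWeb lowerWebSplit (show (2 : ℤ) + 2 = 4 by norm_num)

/-- The first summand of the term of degree `1` of `splitBeforeCrossing`. -/
def isoP : ((upperDumbbell.shift 0).tensor (lowerWeb.shift 2)).tensor splitRight ≅
    modelP.shift 2 :=
  shiftPairIso upperDumbbell lowerWebSplit (zero_add 2) ≪≫
    shiftIso (contractRight (reg c112 c112 c13 (Refines.refl _) refines_c112_c13) absorbP) 2

/-- The second summand of the term of degree `1` of `splitBeforeCrossing`. -/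
def isoQ : ((upperWeb.shift 2).tensor (lowerDumbbell.shift 0)).tensor splitRight ≅
    modelQ.shift 2 :=
  shiftPairIso upperWeb lowerDumbbellSplit (add_zero 2) ≪≫
    shiftIso (contractLeft (rightUnitIso refines_c1111_c112 refines_c1111_c121 refines_c121_c31)
      (reg c31 c211 c22 splits_c31_c211.refines refines_c211_c22)) 2

/-- The projection `(M ⊕ N) ⊗ K → M ⊗ K`. -/
abbrev tensorFst {a b c : Fin 4 → ℕ} (M N : GBimod a b) (K : GBimod b c) :
    (M.prod N).tensor K ⟶ M.tensor K := (GBimod.tensorRight a K).map (prodFst M N)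

/-- The projection `(M ⊕ N) ⊗ K → N ⊗ K`. -/
abbrev tensorSnd {a b c : Fin 4 → ℕ} (M N : GBimod a b) (K : GBimod b c) :
    (M.prod N).tensor K ⟶ N.tensor K := (GBimod.tensorRight a K).map (prodSnd M N)

/-- The inclusion `M ⊗ K → (M ⊕ N) ⊗ K`. -/
abbrev tensorInl {a b c : Fin 4 → ℕ} (M N : GBimod a b) (K : GBimod b c) :
    M.tensor K ⟶ (M.prod N).tensor K := (GBimod.tensorRight a K).map (prodInl M N)

/-- The inclusion `N ⊗ K → (M ⊕ N) ⊗ K`. -/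
abbrev tensorInr {a b c : Fin 4 → ℕ} (M N : GBimod a b) (K : GBimod b c) :
    N.tensor K ⟶ (M.prod N).tensor K := (GBimod.tensorRight a K).map (prodInr M N)

/-- The first inclusion into the term of degree `1` of `splitBeforeCrossing`. -/
def inclP : modelP.shift 2 ⟶ splitBeforeCrossing.X 1 :=
  isoP.inv ≫ tensorInl ((upperDumbbell.shift 0).tensor (lowerWeb.shift 2))
      ((upperWeb.shift 2).tensor (lowerDumbbell.shift 0)) splitRight

/-- The second inclusion into the term of degree `1` of `splitBeforeCrossing`. -/
def inclQ : modelQ.shift 2 ⟶ splitBeforeCrossing.X 1 :=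
  isoQ.inv ≫ tensorInr ((upperDumbbell.shift 0).tensor (lowerWeb.shift 2))
      ((upperWeb.shift 2).tensor (lowerDumbbell.shift 0)) splitRight

/-- The first projection of the term of degree `1` of `splitBeforeCrossing`. -/
def projP : splitBeforeCrossing.X 1 ⟶ modelP.shift 2 :=
  tensorFst ((upperDumbbell.shift 0).tensor (lowerWeb.shift 2))
      ((upperWeb.shift 2).tensor (lowerDumbbell.shift 0)) splitRight ≫ isoP.hom

/-- The second projection of the term of degree `1` of `splitBeforeCrossing`. -/
def projQ : splitBeforeCrossing.X 1 ⟶ modelQ.shift 2 :=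
  tensorSnd ((upperDumbbell.shift 0).tensor (lowerWeb.shift 2))
      ((upperWeb.shift 2).tensor (lowerDumbbell.shift 0)) splitRight ≫ isoQ.hom

/-! ### Elementwise formulas for the unit isomorphisms and the maps of a 2-1 crossing -/

section

variable {a b c d x y s t u v : Fin 4 → ℕ}

theorem rightUnitIso_hom (hx : Refines u x) (hu : Refines u s) (hy : Refines s y) (m : Inv u)
    (n : Inv s) : (rightUnitIso hx hu hy).hom.toFun (regTmul hx hu (Refines.refl s) hy m n) =
      m * Subalgebra.inclusion hu.le n := rfl

theorem rightUnitIso_inv (hx : Refines u x) (hu : Refines u s) (hy : Refines s y) (m : Inv u) :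
    (rightUnitIso hx hu hy).inv.toFun m = regTmul hx hu (Refines.refl s) hy m 1 := rfl

theorem leftUnitIso_hom (hx : Refines s x) (hu : Refines u s) (hy : Refines u y) (m : Inv s)
    (n : Inv u) : (leftUnitIso hx hu hy).hom.toFun (regTmul hx (Refines.refl s) hu hy m n) =
      Subalgebra.inclusion hu.le m * n := rfl

theorem leftUnitIso_inv (hx : Refines s x) (hu : Refines u s) (hy : Refines u y) (n : Inv u) :
    (leftUnitIso hx hu hy).inv.toFun n = regTmul hx (Refines.refl s) hu hy 1 n := rfl

theorem iso_trans_shiftIso_hom {M N N' : GBimod a b} {k : ℤ} (e : M ≅ N.shift k) (e' : N ≅ N')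
    (z : M.carrier) : (e ≪≫ shiftIso e' k).hom.toFun z = e'.hom.toFun (e.hom.toFun z) := rfl

theorem iso_trans_shiftIso_inv {M N N' : GBimod a b} {k : ℤ} (e : M ≅ N.shift k) (e' : N ≅ N')
    (z : N'.carrier) : (e ≪≫ shiftIso e' k).inv.toFun z = e.inv.toFun (e'.inv.toFun z) := rfl

end

/-- Every differential comes from a comultiplication, hence is an alternating sum; an additive map
is evaluated on it term by term. -/
theorem map_sum_zsmul {A B : Type} [AddCommGroup A] [AddCommGroup B] (F : A →+ B) (n : ℕ)
    (z : ℕ → A) (w : ℕ → B) (h : ∀ i, F (z i) = w i) :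
    F (∑ i ∈ Finset.range n, (-1 : ℤ) ^ i • z i) = ∑ i ∈ Finset.range n, (-1 : ℤ) ^ i • w i := by
  simp only [map_sum, map_zsmul, h]

theorem cross21Map_apply {a s t u : Fin 4 → ℕ} {T : Finset (Fin 4)} {k p q : Fin 4}
    (hS : Splits a s T k) (hM : Merges u t p q) (hu : Refines u s) (ht : Refines t a)
    (m : Inv u) :
    (cross21Map hS hM hu ht).toFun m = ∑ j ∈ Finset.range (T.card + 1), (-1 : ℤ) ^ j •
      regTmul (Refines.refl t) ht hS.refines (Refines.refl s)
        ⟨divDiff p q (m.1 * X k ^ (T.card - j)), hM.divDiff_mem (mul_mem m.2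
          (pow_mem (hu.le (X_mem hS.2.1 hS.1)) _))⟩ (hS.elem j) := by
  let F := (DHom.tensorRight (projHom hM (Refines.refl t) ht)
    (reg a s s hS.refines (Refines.refl s))).toFun
  refine (congrArg F (comulAdd_apply hS hM.refines hu (Refines.refl s) (Refines.refl s) m 1)).trans
    (map_sum_zsmul F _ _ _ fun j => ?_)
  rw [mul_one]
  rfl

/-! Pure tensors -/

/-- The pure tensors of `R₁₁₂ ⊗_{R₄} R₂₂`. -/
def tmulA₀ : Inv c112 →+ Inv c22 →+ modelA₀.carrier := regTmul _ _ _ _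

/-- The pure tensors of `R₁₁₁₁ ⊗_{R₃₁} R₂₁₁`. -/
def tmulQ : Inv c1111 →+ Inv c211 →+ modelQ.carrier := regTmul _ _ _ _

/-- The pure tensors of `R₁₂₁ ⊗_{R₃₁} R₂₁₁`. -/
def tmulE : Inv c121 →+ Inv c211 →+ modelE.carrier := regTmul _ _ _ _

/-- The pure tensors of `R₁₁₂ ⊗_{R₁₃} R₁₂₁ ⊗_{R₃₁} R₂₁₁`. -/
def tmulB₀ : Inv c112 →+ modelE.carrier →+ modelB₀.carrier :=
  tmulHom (reg c112 c112 c13 (Refines.refl _) refines_c112_c13) modelE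

/-- The pure tensors of `R₁₁₂ ⊗_{R₁₃} R₁₁₁₁`. -/
def tmulP : Inv c112 →+ Inv c1111 →+ modelP.carrier := regTmul _ _ _ _

/-- The pure tensors of `R₁₁₁₁ ⊗_{R₁₂₁} R₁₁₁₁`. -/
def tmulB₂ : Inv c1111 →+ Inv c1111 →+ modelB₂.carrier := regTmul _ _ _ _

/-- The pure tensors of `R₁₁₂ ⊗_{R₂₂} (R₂₂ ⊗_{R₄} R₂₂)`. -/
def tmulX₀ (m : Inv c112) : (dumbbell c22 c4 c22 refines_c22_c4 refines_c22_c4).carrier →+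
    (splitAfterCrossing.X 0).carrier :=
  tmulHom splitLeft ((dumbbell c22 c4 c22 refines_c22_c4 refines_c22_c4).shift 0) m

/-- The pure tensors of `R₁₁₂ ⊗_{R₂₂} (R₂₁₁ ⊗_{R₃₁} R₂₁₁)`. -/
def tmulX₁ (m : Inv c112) : square.carrier →+ (splitAfterCrossing.X 1).carrier :=
  tmulHom splitLeft (square.shift 2) m

/-- The pure tensors of `R₁₁₂ ⊗_{R₂₂} R₂₂`. -/
def tmulX₂ (m : Inv c112) : Inv c22 →+ (splitAfterCrossing.X 2).carrier :=
  tmulHom splitLeft ((reg c22 c22 c22 (Refines.refl _) (Refines.refl _)).shift 6) m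

/-- The pure tensors of `R₂₁₁ ⊗_{R₃₁} R₂₁₁`. -/
def tmulSquare : Inv c211 →+ Inv c211 →+ square.carrier :=
  regTmul merges_c211_c22.refines splits_c31_c211.refines splits_c31_c211.refines
    merges_c211_c22.refines

/-- The pure tensors of `R₂₂ ⊗_{R₄} R₂₂`. -/
def tmulDumbbell : Inv c22 →+ Inv c22 →+
    (dumbbell c22 c4 c22 refines_c22_c4 refines_c22_c4).carrier :=
  regTmul (Refines.refl c22) refines_c22_c4 refines_c22_c4 (Refines.refl c22)

/-- The pure tensors of `R₁₁₂ ⊗_{R₁₃} R₁₂₁`. -/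
def tmulUpper : Inv c112 →+ Inv c121 →+ upperDumbbell.carrier :=
  regTmul (Refines.refl c112) refines_c112_c13 splits_c13_c121.refines (Refines.refl c121)

/-- The pure tensors of `R₁₂₁ ⊗_{R₃₁} R₂₁₁`, in the lower crossing. -/
def tmulLower : Inv c121 →+ Inv c211 →+ lowerDumbbell.carrier :=
  regTmul (Refines.refl c121) refines_c121_c31 splits_c31_c211.refines (Refines.refl c211)

/-- The elements `(m ⊗ n) ⊗ 1` of `(M ⊗ N) ⊗ R₂₁₁`. -/
def tmulSplit {M : GBimod c112 c121} {N : GBimod c121 c211} (i j : ℤ) :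
    M.carrier →+ N.carrier →+ (((M.shift i).tensor (N.shift j)).tensor splitRight).carrier :=
  (tmulHom (M.shift i) (N.shift j)).compr₂
    ((tmulHom ((M.shift i).tensor (N.shift j)) splitRight).flip (1 : Inv c211))

/-- An element of `R₁₁₁₁ = R`. -/
abbrev full (f : Poly) : Inv c1111 := ⟨f, mem_Inv_c1111 f⟩

/-- The divided difference `∂₂ : R → R₁₂₁`. -/
abbrev diff121 (f : Poly) : Inv c121 :=
  ⟨divDiff 1 2 f, merges_c1111_c121.divDiff_mem (mem_Inv_c1111 f)⟩

/-- The divided difference `∂₃ : R → R₁₁₂`. -/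
abbrev diff112 (f : Poly) : Inv c112 :=
  ⟨divDiff 2 3 f, merges_c1111_c112.divDiff_mem (mem_Inv_c1111 f)⟩

/-- `e_j(x₁, x₂)` as an element of `R₂₁₁`. -/
abbrev elem12 (j : ℕ) : Inv c211 := splits_c31_c211.elem j

/-- `e_j(x₂, x₃)` as an element of `R₁₂₁`. -/
abbrev elem23 (j : ℕ) : Inv c121 := splits_c13_c121.elem j

/-! The isomorphisms on pure tensors -/

theorem isoA₀_hom (m : Inv c112) (p q : Inv c22) :
    isoA₀.hom.toFun (tmulX₀ m (tmulDumbbell p q)) =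
      tmulA₀ (m * Subalgebra.inclusion refines_c112_c22.le p) q :=
  (iso_trans_shiftIso_hom _ _ _).trans ((congrArg _ (shiftRightIso_hom _ _ _ _ _)).trans
    ((contractLeft_hom _ _ _ _ _).trans
      (congrArg (fun z => tmulA₀ z q) (rightUnitIso_hom _ _ _ _ _))))

theorem isoA₁_hom (m : Inv c112) (p q : Inv c211) :
    isoA₁.hom.toFun (tmulX₁ m (tmulSquare p q)) = tmulQ (full (m.1 * p.1)) q :=
  (iso_trans_shiftIso_hom _ _ _).trans ((congrArg _ (shiftRightIso_hom _ _ _ _ _)).trans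
    ((contractLeft_hom _ _ _ _ _).trans
      (congrArg (fun z => tmulQ z q) (splitMul_regTmul _ _ _ _))))

/-- An element of R_1111 has to be expanded in the basis (1, -x_2) of R_112 over R_22 before it can
be split between the tensor factors, which explains the two terms. -/
theorem isoA₁_inv (m : Inv c1111) (q : Inv c211) : isoA₁.inv.toFun (tmulQ m q) =
    tmulX₁ 1 (tmulSquare ⟨divDiff 0 1 (X 0 * m.1),
      merges_c1111_c211.divDiff_mem (mem_Inv_c1111 _)⟩ q) -
    tmulX₁ ⟨X 1, X_one_mem_c112⟩ (tmulSquare ⟨divDiff 0 1 m.1,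
      merges_c1111_c211.divDiff_mem m.2⟩ q) := by
  -- Collects the reassociation and the shift, with `q` fixed, into one additive map that can be
  -- evaluated on the two terms of `splitComul`.
  let F : TensorCarrier (reg c112 c112 c22 (Refines.refl c112) refines_c112_c22)
      (reg c22 c211 c31 refines_c211_c22 splits_c31_c211.refines) →+
      (splitAfterCrossing.X 1).carrier :=
    ((shiftRightIso splitLeft square 2).inv.toFun.comp
      (assocHom (reg c112 c112 c22 (Refines.refl c112) refines_c112_c22)
        (reg c22 c211 c31 refines_c211_c22 splits_c31_c211.refines)
        (reg c31 c211 c22 splits_c31_c211.refines refines_c211_c22)).toFun).comp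
      ((tmulHom ((reg c112 c112 c22 (Refines.refl c112) refines_c112_c22).tensor
        (reg c22 c211 c31 refines_c211_c22 splits_c31_c211.refines))
        (reg c31 c211 c22 splits_c31_c211.refines refines_c211_c22)).flip q)
  have hF : ∀ (f : Inv c112) (g : Inv c211), F (regTmul (Refines.refl c112) refines_c112_c22
      refines_c211_c22 splits_c31_c211.refines f g) = tmulX₁ f (tmulSquare g q) := fun f g =>
    (congrArg (shiftRightIso splitLeft square 2).inv.toFun (assocHom_tmul _ _ _)).trans
      (shiftRightIso_inv _ _ _ _ _)
  have h : isoA₁.inv.toFun (tmulQ m q) =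
      F (splitComul (Refines.refl c112) splits_c31_c211.refines m) :=
    (iso_trans_shiftIso_inv _ _ _).trans (congrArg (shiftRightIso splitLeft square 2).inv.toFun
      (contractLeft_inv _ _ _ _))
  rw [h, splitComul_apply, map_sub, hF, hF]

theorem isoA₂_inv (m : Inv c112) : isoA₂.inv.toFun m = tmulX₂ m 1 :=
  (iso_trans_shiftIso_inv _ _ _).trans ((congrArg _ (rightUnitIso_inv _ _ _ _)).trans
    (shiftRightIso_inv _ _ _ _ _))

theorem lowerWebSplit_hom (p : Inv c1111) (q : Inv c211) : lowerWebSplit.hom.toFun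
    (tmulHom lowerWeb splitRight p q) =
      p * Subalgebra.inclusion refines_c1111_c211.le q := rightUnitIso_hom _ _ _ _ _

theorem lowerWebSplit_inv (p : Inv c1111) : lowerWebSplit.inv.toFun p =
    tmulHom lowerWeb splitRight p (1 : Inv c211) := rightUnitIso_inv _ _ _ _

theorem lowerDumbbellSplit_hom (n : Inv c121) (p q : Inv c211) : lowerDumbbellSplit.hom.toFun
    (tmulHom lowerDumbbell splitRight (tmulLower n p) q) =
      regTmul (Refines.refl c121) refines_c121_c31 splits_c31_c211.refines refines_c211_c22
        n (p * q) :=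
  (contractRight_hom _ _ _ _ _).trans (congrArg _ (rightUnitIso_hom _ _ _ _ _))

theorem lowerDumbbellSplit_inv (n : Inv c121) (p : Inv c211) : lowerDumbbellSplit.inv.toFun
      (regTmul (Refines.refl c121) refines_c121_c31 splits_c31_c211.refines refines_c211_c22
        n p) = tmulHom lowerDumbbell splitRight (tmulLower n p) (1 : Inv c211) :=
  contractRight_inv _ _ _ _ _ _ (rightUnitIso_inv _ _ _ _)

theorem absorbE_hom (m n : Inv c121) (p : Inv c211) :
    absorbE.hom.toFun (tmulHom (reg c13 c121 c121 splits_c13_c121.refines (Refines.refl _))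
      ((reg c121 c121 c31 (Refines.refl _) refines_c121_c31).tensor
      (reg c31 c211 c22 splits_c31_c211.refines refines_c211_c22)) m
      (regTmul (Refines.refl c121) refines_c121_c31 splits_c31_c211.refines refines_c211_c22
        n p)) = tmulE (m * n) p :=
  (contractLeft_hom _ _ _ _ _).trans
    (congrArg (fun z => tmulE z p) (leftUnitIso_hom _ _ _ _ _))

theorem absorbP_hom (m : Inv c121) (p : Inv c1111) :
    absorbP.hom.toFun (regTmul splits_c13_c121.refines (Refines.refl _) refines_c1111_c121
      (refines_c1111_c211.trans refines_c211_c22) m p) =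
        Subalgebra.inclusion refines_c1111_c121.le m * p :=
  leftUnitIso_hom _ _ _ _ _

theorem absorbP_inv (p : Inv c1111) :
    absorbP.inv.toFun p = regTmul splits_c13_c121.refines (Refines.refl _) refines_c1111_c121
      (refines_c1111_c211.trans refines_c211_c22) 1 p :=
  leftUnitIso_inv _ _ _ _

/-- The included 1 is the trace of the factor R_211 of the splitting web; it is kept because the
formula then follows from the definitions. -/
theorem isoP_hom (m : Inv c112) (n : Inv c121) (p : Inv c1111) :
    isoP.hom.toFun (tmulSplit (M := upperDumbbell) (N := lowerWeb) 0 2 (tmulUpper m n) p) =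
      tmulP m (Subalgebra.inclusion refines_c1111_c121.le n *
        (p * Subalgebra.inclusion refines_c1111_c211.le 1)) :=
  (iso_trans_shiftIso_hom _ _ _).trans ((congrArg _ ((shiftPairIso_hom _ _ _ _ _ _).trans
    (congrArg (tmulHom _ _ _) (lowerWebSplit_hom _ _)))).trans
      ((contractRight_hom _ _ _ _ _).trans (congrArg (tmulP m) (absorbP_hom _ _))))

theorem isoP_inv (m : Inv c112) (p : Inv c1111) : isoP.inv.toFun (tmulP m p) =
    tmulSplit (M := upperDumbbell) (N := lowerWeb) 0 2 (tmulUpper m 1) p :=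
  (iso_trans_shiftIso_inv _ _ _).trans
    ((congrArg _ (contractRight_inv _ _ _ _ _ _ (absorbP_inv p))).trans
      (shiftPairIso_inv _ _ _ _ _ _ _ (lowerWebSplit_inv p)))

theorem isoQ_hom (m : Inv c1111) (n : Inv c121) (p : Inv c211) :
    isoQ.hom.toFun (tmulSplit (M := upperWeb) (N := lowerDumbbell) 2 0 m (tmulLower n p)) =
      tmulQ (m * Subalgebra.inclusion refines_c1111_c121.le n) (p * 1) :=
  (iso_trans_shiftIso_hom _ _ _).trans ((congrArg _ ((shiftPairIso_hom _ _ _ _ _ _).trans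
    (congrArg (tmulHom _ _ _) (lowerDumbbellSplit_hom _ _ _)))).trans
      ((contractLeft_hom _ _ _ _ _).trans
        (congrArg (fun z => tmulQ z (p * 1)) (rightUnitIso_hom _ _ _ _ _))))

theorem isoQ_inv (m : Inv c1111) (p : Inv c211) : isoQ.inv.toFun (tmulQ m p) =
    tmulSplit (M := upperWeb) (N := lowerDumbbell) 2 0 m (tmulLower 1 p) :=
  (iso_trans_shiftIso_inv _ _ _).trans
    ((congrArg _ (contractLeft_inv_of_eq _ _ _ _ _ _ (rightUnitIso_inv _ _ _ _))).trans
      (shiftPairIso_inv _ _ _ _ _ _ _ (lowerDumbbellSplit_inv _ _)))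

theorem isoB₂_inv (m p : Inv c1111) : isoB₂.inv.toFun (tmulB₂ m p) =
    tmulSplit (M := upperWeb) (N := lowerWeb) 2 2 m p :=
  shiftPairIso_inv _ _ _ _ _ _ _ (lowerWebSplit_inv p)

theorem isoB₀_hom (m : Inv c112) (n n' : Inv c121) (p : Inv c211) :
    isoB₀.hom.toFun (tmulSplit (M := upperDumbbell) (N := lowerDumbbell) 0 0 (tmulUpper m n)
      (tmulLower n' p)) = tmulB₀ m (tmulE (n * n') (p * 1)) :=
  (iso_trans_shiftIso_hom _ _ _).trans ((congrArg _ ((shiftPairIso_hom _ _ _ _ _ _).trans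
    (congrArg (tmulHom _ _ _) (lowerDumbbellSplit_hom _ _ _)))).trans
      ((contractRight_hom _ _ _ _ _).trans (congrArg (tmulB₀ m) (absorbE_hom _ _ _))))

/-! The differentials on pure tensors -/

theorem dX₂ (m : Inv c112) (n : Inv c22) :
    (splitAfterCrossing.d 2 1).toFun (tmulX₂ m n) = tmulX₁ m (cross22Map₁.toFun n) := rfl

theorem dX₁ (m : Inv c112) (z : square.carrier) :
    (splitAfterCrossing.d 1 0).toFun (tmulX₁ m z) = tmulX₀ m (cross22Map₂.toFun z) := rfl

/-- The middle term of the tensor product of the complexes of the two crossings. -/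
abbrev middle : GBimod c112 c211 := ((upperDumbbell.shift 0).tensor (lowerWeb.shift 2)).prod
  ((upperWeb.shift 2).tensor (lowerDumbbell.shift 0))

/-- The elements `z ⊗ 1` of the term of degree `1` of `splitBeforeCrossing`. -/
def middleSplit : middle.carrier →+ (splitBeforeCrossing.X 1).carrier :=
  (tmulHom middle splitRight).flip (1 : Inv c211)

/-- The minus sign is the Koszul sign: the left tensor factor sits in cohomological degree -1. -/
theorem dY₂ (m p : Inv c1111) :
    (splitBeforeCrossing.d 2 1).toFun (tmulSplit (M := upperWeb) (N := lowerWeb) 2 2 m p) =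
      middleSplit (tmulHom (upperDumbbell.shift 0) (lowerWeb.shift 2) (cross21Right.toFun m) p,
        -tmulHom (upperWeb.shift 2) (lowerDumbbell.shift 0) m (cross21Left.toFun p)) := rfl

theorem tensorInl_tmulSplit (z : upperDumbbell.carrier) (p : Inv c1111) :
    (tensorInl ((upperDumbbell.shift 0).tensor (lowerWeb.shift 2))
      ((upperWeb.shift 2).tensor (lowerDumbbell.shift 0)) splitRight).toFun
        (tmulSplit (M := upperDumbbell) (N := lowerWeb) 0 2 z p) =
      middleSplit (tmulHom (upperDumbbell.shift 0) (lowerWeb.shift 2) z p, 0) := rfl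

theorem tensorInr_tmulSplit (m : Inv c1111) (z : lowerDumbbell.carrier) :
    (tensorInr ((upperDumbbell.shift 0).tensor (lowerWeb.shift 2))
      ((upperWeb.shift 2).tensor (lowerDumbbell.shift 0)) splitRight).toFun
        (tmulSplit (M := upperWeb) (N := lowerDumbbell) 2 0 m z) =
      middleSplit (0, tmulHom (upperWeb.shift 2) (lowerDumbbell.shift 0) m z) := rfl

theorem dY₁_left (z : upperDumbbell.carrier) (p : Inv c1111) :
    (splitBeforeCrossing.d 1 0).toFun (middleSplit
      (tmulHom (upperDumbbell.shift 0) (lowerWeb.shift 2) z p, 0)) =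
      tmulSplit (M := upperDumbbell) (N := lowerDumbbell) 0 0 z (cross21Left.toFun p) := by
  let G : TensorCarrier (upperDumbbell.shift 0) (lowerDumbbell.shift 0) →+
      (splitBeforeCrossing.X 0).carrier :=
    (tmulHom ((upperDumbbell.shift 0).tensor (lowerDumbbell.shift 0)) splitRight).flip (1 : Inv c211)
  -- With an arbitrary second component both sides agree by definition; setting it to zero
  -- afterwards removes the unwanted summand.
  have h : ∀ y : TensorCarrier (upperWeb.shift 2) (lowerDumbbell.shift 0),
      (splitBeforeCrossing.d 1 0).toFun (middleSplit
      (tmulHom (upperDumbbell.shift 0) (lowerWeb.shift 2) z p, y)) =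
      G ((show TensorCarrier (upperDumbbell.shift 0) (lowerDumbbell.shift 0) from
          tmulHom (upperDumbbell.shift 0) (lowerDumbbell.shift 0) z (cross21Left.toFun p)) +
        (show TensorCarrier (upperDumbbell.shift 0) (lowerDumbbell.shift 0) from
          (DHom.tensorRight cross21Right (lowerDumbbell.shift 0)).toFun y)) := fun _ => rfl
  refine (h 0).trans (congrArg G ((congrArg _ (map_zero _)).trans (add_zero _)))

theorem dY₁_right (m : Inv c1111) (z : lowerDumbbell.carrier) :
    (splitBeforeCrossing.d 1 0).toFun (middleSplit
      (0, tmulHom (upperWeb.shift 2) (lowerDumbbell.shift 0) m z)) =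
      tmulSplit (M := upperDumbbell) (N := lowerDumbbell) 0 0 (cross21Right.toFun m) z := by
  let G : TensorCarrier (upperDumbbell.shift 0) (lowerDumbbell.shift 0) →+
      (splitBeforeCrossing.X 0).carrier :=
    (tmulHom ((upperDumbbell.shift 0).tensor (lowerDumbbell.shift 0)) splitRight).flip (1 : Inv c211)
  have h : ∀ y : TensorCarrier (upperDumbbell.shift 0) (lowerWeb.shift 2),
      (splitBeforeCrossing.d 1 0).toFun (middleSplit
      (y, tmulHom (upperWeb.shift 2) (lowerDumbbell.shift 0) m z)) =
      G ((show TensorCarrier (upperDumbbell.shift 0) (lowerDumbbell.shift 0) from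
          (DHom.tensorLeft (upperDumbbell.shift 0) cross21Left).toFun y) +
        (show TensorCarrier (upperDumbbell.shift 0) (lowerDumbbell.shift 0) from
          tmulHom (upperDumbbell.shift 0) (lowerDumbbell.shift 0) (cross21Right.toFun m) z)) :=
    fun _ => rfl
  refine (h 0).trans (congrArg G ((congrArg (· + _) (map_zero _)).trans (zero_add _)))

theorem cross21Right_apply (m : Inv c1111) : cross21Right.toFun m =
    ∑ j ∈ Finset.range 3, (-1 : ℤ) ^ j • tmulUpper (diff112 (m.1 * X 3 ^ (2 - j))) (elem23 j) :=
  cross21Map_apply splits_c13_c121 merges_c1111_c112 refines_c1111_c121 refines_c112_c13 m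

theorem cross21Left_apply (m : Inv c1111) : cross21Left.toFun m =
    ∑ j ∈ Finset.range 3, (-1 : ℤ) ^ j • tmulLower (diff121 (m.1 * X 2 ^ (2 - j))) (elem12 j) :=
  cross21Map_apply splits_c31_c211 merges_c1111_c121 refines_c1111_c211 refines_c121_c31 m

/-! ### The differentials on the simplified terms -/

/-- The first differential of `splitAfterCrossing`. -/
def dA₂ : modelA₂.carrier →+ modelQ.carrier :=
  (isoA₂.inv ≫ splitAfterCrossing.d 2 1 ≫ isoA₁.hom).toFun

/-- The second differential of `splitAfterCrossing`. -/
def dA₁ : modelQ.carrier →+ modelA₀.carrier :=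
  (isoA₁.inv ≫ splitAfterCrossing.d 1 0 ≫ isoA₀.hom).toFun

/-- The first component of the first differential of `splitBeforeCrossing`. -/
def alpha : modelB₂.carrier →+ modelP.carrier :=
  (isoB₂.inv ≫ splitBeforeCrossing.d 2 1 ≫ projP).toFun

/-- The second component of the first differential of `splitBeforeCrossing`. -/
def beta : modelB₂.carrier →+ modelQ.carrier :=
  (isoB₂.inv ≫ splitBeforeCrossing.d 2 1 ≫ projQ).toFun

/-- The first component of the second differential of `splitBeforeCrossing`. -/
def gamma : modelP.carrier →+ modelB₀.carrier :=
  (inclP ≫ splitBeforeCrossing.d 1 0 ≫ isoB₀.hom).toFun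

/-- The second component of the second differential of `splitBeforeCrossing`. -/
def delta : modelQ.carrier →+ modelB₀.carrier :=
  (inclQ ≫ splitBeforeCrossing.d 1 0 ≫ isoB₀.hom).toFun

theorem dA₂_eq (m : modelA₂.carrier) : dA₂ m =
    isoA₁.hom.toFun ((splitAfterCrossing.d 2 1).toFun (isoA₂.inv.toFun m)) := rfl

theorem dA₁_eq (z : modelQ.carrier) : dA₁ z =
    isoA₀.hom.toFun ((splitAfterCrossing.d 1 0).toFun (isoA₁.inv.toFun z)) := rfl

theorem alpha_eq (z : modelB₂.carrier) : alpha z =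
    isoP.hom.toFun ((tensorFst ((upperDumbbell.shift 0).tensor (lowerWeb.shift 2))
      ((upperWeb.shift 2).tensor (lowerDumbbell.shift 0)) splitRight).toFun
        ((splitBeforeCrossing.d 2 1).toFun (isoB₂.inv.toFun z))) := rfl

theorem beta_eq (z : modelB₂.carrier) : beta z =
    isoQ.hom.toFun ((tensorSnd ((upperDumbbell.shift 0).tensor (lowerWeb.shift 2))
      ((upperWeb.shift 2).tensor (lowerDumbbell.shift 0)) splitRight).toFun
        ((splitBeforeCrossing.d 2 1).toFun (isoB₂.inv.toFun z))) := rfl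

theorem gamma_eq (z : modelP.carrier) : gamma z =
    isoB₀.hom.toFun ((splitBeforeCrossing.d 1 0).toFun
      ((tensorInl ((upperDumbbell.shift 0).tensor (lowerWeb.shift 2))
      ((upperWeb.shift 2).tensor (lowerDumbbell.shift 0)) splitRight).toFun
        (isoP.inv.toFun z))) := rfl

theorem delta_eq (z : modelQ.carrier) : delta z =
    isoB₀.hom.toFun ((splitBeforeCrossing.d 1 0).toFun
      ((tensorInr ((upperDumbbell.shift 0).tensor (lowerWeb.shift 2))
      ((upperWeb.shift 2).tensor (lowerDumbbell.shift 0)) splitRight).toFun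
        (isoQ.inv.toFun z))) := rfl

theorem dA₂_apply (m : Inv c112) : dA₂ m = ∑ j ∈ Finset.range 3, (-1 : ℤ) ^ j •
    tmulQ (full (m.1 * X 2 ^ (2 - j))) (elem12 j) := by
  let F : square.carrier →+ modelQ.carrier := isoA₁.hom.toFun.comp (tmulX₁ m)
  have h : dA₂ m = F (cross22Map₁.toFun (1 : Inv c22)) :=
    (dA₂_eq m).trans (congrArg _ ((congrArg _ (isoA₂_inv m)).trans (dX₂ m 1)))
  refine h.trans ((congrArg F (cross22Map₁_apply 1)).trans (map_sum_zsmul F 3 _ _ fun j => ?_))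
  refine (isoA₁_hom _ _ _).trans (congrArg (fun z => tmulQ z (elem12 j)) (Subtype.ext ?_))
  rw [map_one, one_mul]
  rfl

theorem alpha_apply (m p : Inv c1111) : alpha (tmulB₂ m p) = ∑ j ∈ Finset.range 3, (-1 : ℤ) ^ j •
    tmulP (diff112 (m.1 * X 3 ^ (2 - j)))
      (Subalgebra.inclusion refines_c1111_c121.le (elem23 j) * p) := by
  let F : upperDumbbell.carrier →+ modelP.carrier :=
    isoP.hom.toFun.comp ((tmulSplit (M := upperDumbbell) (N := lowerWeb) 0 2).flip p)
  have h : alpha (tmulB₂ m p) = F (cross21Right.toFun m) :=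
    (alpha_eq _).trans (congrArg _ (congrArg _ ((congrArg _ (isoB₂_inv m p)).trans (dY₂ m p))))
  refine h.trans ((congrArg F (cross21Right_apply m)).trans (map_sum_zsmul F 3 _ _ fun j => ?_))
  refine (isoP_hom _ _ _).trans ?_
  rw [map_one, mul_one]

theorem beta_apply (m p : Inv c1111) : beta (tmulB₂ m p) = -∑ j ∈ Finset.range 3, (-1 : ℤ) ^ j •
    tmulQ (m * Subalgebra.inclusion refines_c1111_c121.le (diff121 (p.1 * X 2 ^ (2 - j))))
      (elem12 j) := by
  let F : lowerDumbbell.carrier →+ modelQ.carrier :=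
    isoQ.hom.toFun.comp (tmulSplit (M := upperWeb) (N := lowerDumbbell) 2 0 m)
  -- `G` is defined on the whole tensor product rather than on one factor, so that the Koszul sign
  -- can be pulled out with `map_neg`.
  let G : TensorCarrier (upperWeb.shift 2) (lowerDumbbell.shift 0) →+ modelQ.carrier :=
    isoQ.hom.toFun.comp ((tmulHom ((upperWeb.shift 2).tensor (lowerDumbbell.shift 0))
      splitRight).flip (1 : Inv c211))
  have h : beta (tmulB₂ m p) =
      G (-tmulHom (upperWeb.shift 2) (lowerDumbbell.shift 0) m (cross21Left.toFun p)) :=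
    (beta_eq _).trans (congrArg _ (congrArg _ ((congrArg _ (isoB₂_inv m p)).trans (dY₂ m p))))
  have h' : G (tmulHom (upperWeb.shift 2) (lowerDumbbell.shift 0) m (cross21Left.toFun p)) =
      F (cross21Left.toFun p) := rfl
  refine h.trans ((map_neg G _).trans (congrArg Neg.neg (h'.trans
    ((congrArg F (cross21Left_apply p)).trans (map_sum_zsmul F 3 _ _ fun j => ?_)))))
  refine (isoQ_hom _ _ _).trans ?_
  rw [mul_one]

theorem gamma_apply (m : Inv c112) (p : Inv c1111) : gamma (tmulP m p) =
    ∑ j ∈ Finset.range 3, (-1 : ℤ) ^ j •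
      tmulB₀ m (tmulE (diff121 (p.1 * X 2 ^ (2 - j))) (elem12 j)) := by
  let F : lowerDumbbell.carrier →+ modelB₀.carrier :=
    isoB₀.hom.toFun.comp (tmulSplit (M := upperDumbbell) (N := lowerDumbbell) 0 0 (tmulUpper m 1))
  have h : gamma (tmulP m p) = F (cross21Left.toFun p) :=
    (gamma_eq _).trans (congrArg isoB₀.hom.toFun
      ((congrArg (splitBeforeCrossing.d 1 0).toFun ((congrArg _ (isoP_inv m p)).trans
        (tensorInl_tmulSplit _ _))).trans (dY₁_left (tmulUpper m 1) p)))
  refine h.trans ((congrArg F (cross21Left_apply p)).trans (map_sum_zsmul F 3 _ _ fun j => ?_))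
  refine (isoB₀_hom _ _ _ _).trans ?_
  rw [one_mul, mul_one]

theorem delta_apply (m : Inv c1111) (p : Inv c211) : delta (tmulQ m p) =
    ∑ j ∈ Finset.range 3, (-1 : ℤ) ^ j •
      tmulB₀ (diff112 (m.1 * X 3 ^ (2 - j))) (tmulE (elem23 j) p) := by
  let F : upperDumbbell.carrier →+ modelB₀.carrier :=
    isoB₀.hom.toFun.comp
      ((tmulSplit (M := upperDumbbell) (N := lowerDumbbell) 0 0).flip (tmulLower 1 p))
  have h : delta (tmulQ m p) = F (cross21Right.toFun m) :=
    (delta_eq _).trans (congrArg isoB₀.hom.toFun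
      ((congrArg (splitBeforeCrossing.d 1 0).toFun ((congrArg _ (isoQ_inv m p)).trans
        (tensorInr_tmulSplit _ _))).trans (dY₁_right m (tmulLower 1 p))))
  refine h.trans ((congrArg F (cross21Right_apply m)).trans (map_sum_zsmul F 3 _ _ fun j => ?_))
  refine (isoB₀_hom _ _ _ _).trans ?_
  rw [mul_one, mul_one]

/-- The differential is computed on the two terms of `isoA₁_inv`. As x_2 and x_4 commute with ∂_3
respectively ∂_1 in the appropriate sense, the expansions of m under ∂_1 recombine inside ∂_3 by
`divDiff_reconstruct`, leaving no trace of ∂_1. -/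
theorem dA₁_apply (m : Inv c1111) (p : Inv c211) : dA₁ (tmulQ m p) =
    ∑ j ∈ Finset.range 4, (-1 : ℤ) ^ j • tmulA₀ (diff112 (m.1 * X 3 ^ (3 - j)))
      (proj22 (ι31 (splits_c4_c31.elem j) * p)) := by
  have hF : ∀ (f : Inv c112) (g : Inv c211),
      isoA₀.hom.toFun ((splitAfterCrossing.d 1 0).toFun (tmulX₁ f (tmulSquare g p))) =
      ∑ j ∈ Finset.range 4, (-1 : ℤ) ^ j • tmulA₀ (f * Subalgebra.inclusion refines_c112_c22.le
        (proj22 (g * ι31 (splits_c4_c31.var ^ (3 - j)))))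
          (proj22 (ι31 (splits_c4_c31.elem j) * p)) := fun f g => by
    let F := isoA₀.hom.toFun.comp (tmulX₀ f)
    refine ((congrArg _ (dX₁ f _)).trans (congrArg F (cross22Map₂_apply g p))).trans
      (map_sum_zsmul F 4 _ _ fun j => ?_)
    exact isoA₀_hom _ _ _
  refine (dA₁_eq _).trans ((congrArg _ (congrArg _ (isoA₁_inv m p))).trans ?_)
  refine (congrArg isoA₀.hom.toFun (map_sub (splitAfterCrossing.d 1 0).toFun _ _)).trans
    ((map_sub isoA₀.hom.toFun _ _).trans ((congrArg₂ (fun z w : modelA₀.carrier => z - w)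
      (hF _ _) (hF _ _)).trans ?_))
  rw [← Finset.sum_sub_distrib]
  refine Finset.sum_congr rfl fun j _ => ?_
  rw [← smul_sub, ← AddMonoidHom.sub_apply, ← map_sub]
  refine congrArg (fun z => (-1 : ℤ) ^ j •
    tmulA₀ z (proj22 (ι31 (splits_c4_c31.elem j) * p))) (Subtype.ext ?_)
  change 1 * divDiff 2 3 (divDiff 0 1 (X 0 * m.1) * X 3 ^ (3 - j)) -
    X 1 * divDiff 2 3 (divDiff 0 1 m.1 * X 3 ^ (3 - j)) = divDiff 2 3 (m.1 * X 3 ^ (3 - j))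
  rw [one_mul, ← merges_c1111_c112.divDiff_mul X_one_mem_c112, ← divDiff_sub (by decide),
    ← mul_assoc, ← sub_mul, divDiff_reconstruct (by decide)]

/-! ### Change of base on both tensor factors -/

section

variable {a b x y s t u u' t' : Fin 4 → ℕ}

/-- The map `R_u ⊗_{R_a} R_t → R_{u'} ⊗_{R_b} R_{t'}`, `m ⊗ n ↦ m ⊗ n`, for `u'`, `t'`, `b` refining
`u`, `t`, `a`. -/
def baseHom (hx : Refines u x) (hua : Refines u a) (hta : Refines t a) (hy : Refines t y)
    (hu : Refines u' u) (ht : Refines t' t) (hba : Refines b a) (hub : Refines u' b)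
    (htb : Refines t' b) :
    DHom ((reg x u a hx hua).tensor (reg a t y hta hy))
      ((reg x u' b (hu.trans hx) hub).tensor (reg b t' y htb (ht.trans hy))) 0 :=
  DHom.lift (M := reg x u a hx hua) (N := reg a t y hta hy)
    (P := (reg x u' b (hu.trans hx) hub).tensor (reg b t' y htb (ht.trans hy)))
    (((regTmul (hu.trans hx) hub htb (ht.trans hy)).compl₂
      (Subalgebra.inclusion ht.le : Inv t →+ Inv t')).comp
        (Subalgebra.inclusion hu.le : Inv u →+ Inv u'))
    (fun r (m : Inv u) (n : Inv t) => by
      have h := regTmul_balanced (hu.trans hx) hub htb (ht.trans hy)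
        (Subalgebra.inclusion hba.le r) (Subalgebra.inclusion hu.le m) (Subalgebra.inclusion ht.le n)
      rw [mul_comm] at h
      exact h)
    (fun r m n => rfl) (fun r m n => rfl)
    (fun i j m hm n hn => by
      rw [add_zero]
      exact regTmul_mem (hu.trans hx) hub htb (ht.trans hy) hm hn)

theorem baseHom_apply (hx : Refines u x) (hua : Refines u a) (hta : Refines t a)
    (hy : Refines t y) (hu : Refines u' u) (ht : Refines t' t) (hba : Refines b a)
    (hub : Refines u' b) (htb : Refines t' b) (m : Inv u) (n : Inv t) :
    (baseHom hx hua hta hy hu ht hba hub htb).toFun (regTmul hx hua hta hy m n) =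
      regTmul (hu.trans hx) hub htb (ht.trans hy) (Subalgebra.inclusion hu.le m)
        (Subalgebra.inclusion ht.le n) := rfl

/-- Identifies negation in the bimodule with negation in the ring, for the maps that are defined
with a minus sign. -/
theorem reg_neg (hx : Refines s x) (hy : Refines s y) (f : Inv s) :
    -(show (reg x s y hx hy).carrier from f) = (-f : Inv s) := rfl

end

/-! The maps of the elimination -/

/-- `R₁₃ ⊗_{R₄} R₂₂`. -/
def modelN : GBimod c13 c22 :=
  (reg c13 c13 c4 (Refines.refl _) refines_c13_c4).tensor
    (reg c4 c22 c22 refines_c22_c4 (Refines.refl _))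

/-- The pure tensors of `R₁₃ ⊗_{R₄} R₂₂`. -/
def tmulN : Inv c13 →+ Inv c22 →+ modelN.carrier := regTmul _ _ _ _

/-- The trace `R₁₂₁ → R₁₃` of a polynomial. -/
abbrev trace13 (n : Inv c121) : Inv c13 := ⟨trace n.1, trace_mem n.2⟩

/-- The variable `x₄` in `R₁₂₁`. -/
abbrev x₄ : Inv c121 := ⟨X 3, X_three_mem_c121⟩

/-- `R₁₁₂ ⊗_{R₁₃} (R₁₃ ⊗_{R₄} R₂₂) ≅ R₁₁₂ ⊗_{R₄} R₂₂`. -/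
def absorbN : (reg c112 c112 c13 (Refines.refl _) refines_c112_c13).tensor modelN ≅ modelA₀ :=
  contractLeft (rightUnitIso (Refines.refl c112) refines_c112_c13 refines_c13_c4)
    (reg c4 c22 c22 refines_c22_c4 (Refines.refl _))

theorem absorbN_hom (m : Inv c112) (f : Inv c13) (n : Inv c22) :
    absorbN.hom.toFun (tmulHom (reg c112 c112 c13 (Refines.refl _) refines_c112_c13) modelN m
      (tmulN f n)) = tmulA₀ (m * Subalgebra.inclusion refines_c112_c13.le f) n :=
  (contractLeft_hom _ _ _ _ _).trans
    (congrArg (fun z => tmulA₀ z n) (rightUnitIso_hom _ _ _ _ _))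

/-- The inclusion `R₁₃ ⊗_{R₄} R₂₂ → R₁₂₁ ⊗_{R₃₁} R₂₁₁`. -/
def inclE : DHom modelN modelE 0 :=
  baseHom (Refines.refl c13) refines_c13_c4 refines_c22_c4 (Refines.refl c22) refines_c121_c13
    refines_c211_c22 splits_c4_c31.refines refines_c121_c31 splits_c31_c211.refines

/-- The projection `R₁₂₁ ⊗_{R₃₁} R₂₁₁ → R₁₃ ⊗_{R₄} R₂₂`. -/
def projE : DHom modelE modelN
    (2 * (({0, 1, 2} : Finset (Fin 4)).card : ℤ) + -4 + -2) :=
  -((comulHom splits_c4_c31 refines_c121_c13 refines_c121_c31 splits_c31_c211.refines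
    refines_c211_c22).comp
    (DHom.tensorRight (traceHom (Refines.refl c13) refines_c13_c4) _)).comp
      (DHom.tensorLeft _ (projHom merges_c211_c22 refines_c22_c4 (Refines.refl c22)))

/-- The map `R₁₂₁ ⊗_{R₃₁} R₂₁₁ → R₁₁₁₁`, `n ⊗ p ↦ -∂₃(n p)`. -/
def contractE : DHom modelE (reg c13 c1111 c22 (refines_c1111_c121.trans refines_c121_c13)
      (refines_c1111_c211.trans refines_c211_c22)) (0 + -2 + 0) :=
  -((mulHom refines_c121_c13 refines_c121_c31 splits_c31_c211.refines refines_c211_c22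
    refines_c1111_c121 refines_c1111_c211).comp
      (projHom merges_c1111_c112 refines_c112_c13 refines_c112_c22)).comp
        (inclHom refines_c112_c13 refines_c112_c22 refines_c1111_c112)

/-- The map `R₁₁₂ ⊗_{R₁₃} R₁₁₁₁ → R₁₁₁₁ ⊗_{R₁₂₁} R₁₁₁₁`, `m ⊗ p ↦ m ⊗ ∂₃(p)`. -/
def contractP : DHom modelP modelB₂ (-2 + 0) :=
  (DHom.tensorLeft _ (projHom merges_c1111_c112 refines_c112_c13 refines_c112_c22)).comp
    (baseHom (Refines.refl c112) refines_c112_c13 refines_c112_c13 refines_c112_c22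
      refines_c1111_c112 refines_c1111_c112 refines_c121_c13 refines_c1111_c121 refines_c1111_c121)

/-- The map `R₁₁₂ → R₁₁₁₁ ⊗_{R₁₂₁} R₁₁₁₁`, `m ↦ m ⊗ x₂ - m x₃ ⊗ 1`. -/
def inclB₂ : DHom modelA₂ modelB₂ (0 + 0 + 2 * (({1} : Finset (Fin 4)).card : ℤ)) :=
  -((inclHom (Refines.refl _) refines_c112_c22 refines_c1111_c112).comp
    (unitHom refines_c1111_c112 (Refines.refl c1111)
      (refines_c1111_c211.trans refines_c211_c22))).comp
      (comulHom splits_c121_c1111 refines_c1111_c112 (Refines.refl c1111)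
        (Refines.refl c1111) (refines_c1111_c211.trans refines_c211_c22))

/-- The map `R₁₁₁₁ ⊗_{R₁₂₁} R₁₁₁₁ → R₁₁₂`, `m ⊗ p ↦ -∂₃(m p)`. -/
def projB₂ : DHom modelB₂ modelA₂ (0 + -2) :=
  -(mulHom refines_c1111_c112 refines_c1111_c121 refines_c1111_c121
    (refines_c1111_c211.trans refines_c211_c22) (Refines.refl c1111) (Refines.refl c1111)).comp
      (projHom merges_c1111_c112 (Refines.refl c112) refines_c112_c22)

theorem inclE_apply (f : Inv c13) (n : Inv c22) : inclE.toFun (tmulN f n) =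
    tmulE (Subalgebra.inclusion refines_c121_c13.le f) (ι22 n) :=
  baseHom_apply _ _ _ _ _ _ _ _ _ _ _

theorem projE_apply (n : Inv c121) (p : Inv c211) : projE.toFun (tmulE n p) =
    -∑ i ∈ Finset.range 4, (-1 : ℤ) ^ i • tmulN (trace13 (n * x₄ ^ (3 - i)))
      (proj22 (ι31 (splits_c4_c31.elem i) * p)) := by
  let F : TensorCarrier (reg c13 c121 c4 refines_c121_c13
      (refines_c121_c31.trans splits_c4_c31.refines))
      (reg c4 c211 c22 (splits_c31_c211.refines.trans splits_c4_c31.refines)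
        refines_c211_c22) →+ modelN.carrier :=
    (DHom.tensorLeft (reg c13 c13 c4 (Refines.refl c13) refines_c13_c4)
      (projHom merges_c211_c22 refines_c22_c4 (Refines.refl c22))).toFun.comp
      (DHom.tensorRight (traceHom (Refines.refl c13) refines_c13_c4)
        (reg c4 c211 c22 (splits_c31_c211.refines.trans splits_c4_c31.refines)
        refines_c211_c22)).toFun
  have h := (congrArg F (comulAdd_apply splits_c4_c31 refines_c121_c13 refines_c121_c31
    splits_c31_c211.refines refines_c211_c22 n p)).trans (map_sum_zsmul F 4 _ (fun i =>
      tmulN (trace13 (n * x₄ ^ (3 - i))) (proj22 (ι31 (splits_c4_c31.elem i) * p))) fun i => rfl)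
  exact congrArg Neg.neg h

theorem contractE_apply (n : Inv c121) (p : Inv c211) : contractE.toFun (tmulE n p) =
    full (-divDiff 2 3 (n.1 * p.1)) := by
  let F : DHom (reg c13 c1111 c22 (refines_c1111_c121.trans refines_c121_c13)
      (refines_c1111_c211.trans refines_c211_c22)) _ _ :=
    projHom merges_c1111_c112 refines_c112_c13 refines_c112_c22
  let G := inclHom refines_c112_c13 refines_c112_c22 refines_c1111_c112
  have h := congrArg (fun z => G.toFun (F.toFun z)) (mulHom_apply refines_c121_c13 refines_c121_c31
    splits_c31_c211.refines refines_c211_c22 refines_c1111_c121 refines_c1111_c211 n p)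
  exact (congrArg Neg.neg h).trans (reg_neg _ _ _)

theorem contractP_apply (m : Inv c112) (p : Inv c1111) : contractP.toFun (tmulP m p) =
    tmulB₂ (Subalgebra.inclusion refines_c1111_c112.le m)
      (Subalgebra.inclusion refines_c1111_c112.le (diff112 p.1)) :=
  baseHom_apply (Refines.refl c112) refines_c112_c13 refines_c112_c13 refines_c112_c22
      refines_c1111_c112 refines_c1111_c112 refines_c121_c13 refines_c1111_c121 refines_c1111_c121
      m (diff112 p.1)

theorem esymmOn_singleton_one (i : Fin 4) : esymmOn {i} 1 = X i := by
  simp [esymmOn, Finset.powersetCard_one]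

theorem elem_c1111_zero : splits_c121_c1111.elem 0 = 1 := by
  refine Subtype.ext ?_
  rw [OneMemClass.coe_one]
  exact esymmOn_zero {1}

theorem elem_c1111_one : splits_c121_c1111.elem 1 = full (X 1) :=
  Subtype.ext (esymmOn_singleton_one 1)

theorem sum_range_two_alternating {A : Type} [AddCommGroup A] (w : ℕ → A) :
    ∑ j ∈ Finset.range (1 + 1), (-1 : ℤ) ^ j • w j = w 0 - w 1 := by
  rw [Finset.sum_range_succ, Finset.sum_range_one, pow_zero, one_zsmul, pow_one, neg_one_zsmul,
    sub_eq_add_neg]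

theorem inclB₂_apply (m : Inv c112) : inclB₂.toFun m =
    tmulB₂ (Subalgebra.inclusion refines_c1111_c112.le m) (full (X 1)) -
      tmulB₂ (Subalgebra.inclusion refines_c1111_c112.le m * full (X 2)) 1 := by
  have h : comulAdd splits_c121_c1111 refines_c1111_c112 (Refines.refl c1111)
        (Refines.refl c1111) (refines_c1111_c211.trans refines_c211_c22)
        (Subalgebra.inclusion refines_c1111_c112.le m) 1 =
      regTmul refines_c1111_c112 refines_c1111_c121 refines_c1111_c121
        (refines_c1111_c211.trans refines_c211_c22)
        (Subalgebra.inclusion refines_c1111_c112.le m * full (X 2)) 1 -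
      regTmul refines_c1111_c112 refines_c1111_c121 refines_c1111_c121
        (refines_c1111_c211.trans refines_c211_c22)
        (Subalgebra.inclusion refines_c1111_c112.le m) (full (X 1)) := by
    refine (comulAdd_apply _ _ _ _ _ _ _).trans ((sum_range_two_alternating _).trans ?_)
    rw [elem_c1111_zero, elem_c1111_one, map_one, mul_one, mul_one, Finset.card_singleton, Nat.sub_self,
      Nat.sub_zero, pow_zero, pow_one,
      map_one (Subalgebra.inclusion (Refines.refl c1111).le), mul_one]
    rfl
  exact (congrArg Neg.neg h).trans (neg_sub (α := TensorCarrier _ _) _ _)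

theorem projB₂_apply (m p : Inv c1111) :
    projB₂.toFun (tmulB₂ m p) = (-diff112 (m.1 * p.1) : Inv c112) := by
  let F := projHom merges_c1111_c112 (Refines.refl c112) refines_c112_c22
  have h := congrArg F.toFun (mulHom_apply refines_c1111_c112 refines_c1111_c121 refines_c1111_c121
    (refines_c1111_c211.trans refines_c211_c22) (Refines.refl c1111) (Refines.refl c1111) m p)
  exact (congrArg Neg.neg h).trans (reg_neg _ _ _)

/-! Polynomial identities -/

theorem divDiff_sq {p q : Fin 4} (h : p ≠ q) (f : Poly) : divDiff p q (divDiff p q f) = 0 :=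
  divDiff_of_fixed h (rename_divDiff_swap h f)

theorem divDiff_X_left {p q : Fin 4} (h : p ≠ q) : divDiff p q (X p) = 1 :=
  divDiff_eq h (by rw [rename_X, Equiv.swap_apply_left, mul_one])

theorem divDiff_X_right {p q : Fin 4} (h : p ≠ q) : divDiff p q (X q) = -1 :=
  divDiff_eq h (by rw [rename_X, Equiv.swap_apply_right]; ring)

theorem divDiff_X_right_sq {p q : Fin 4} (h : p ≠ q) : divDiff p q (X q ^ 2) = -(X p + X q) :=
  divDiff_eq h (by rw [map_pow, rename_X, Equiv.swap_apply_right]; ring)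

theorem divDiff_X_of_ne {p q i : Fin 4} (h : p ≠ q) (hp : i ≠ p) (hq : i ≠ q) :
    divDiff p q (X i) = 0 :=
  divDiff_of_fixed h (by rw [rename_X, Equiv.swap_apply_of_ne_of_ne hp hq])

theorem divDiff_one {p q : Fin 4} (h : p ≠ q) : divDiff p q 1 = 0 :=
  divDiff_of_fixed h (map_one _)

/-- The powers 1, x_4, x_4² have traces 0, 0, 1: the trace lowers the polynomial degree by 2. These
values make all but the leading term of the comultiplication sums disappear. -/
theorem trace_pow_zero : trace (X 3 ^ 0) = 0 := by
  rw [trace, pow_zero, divDiff_one (by decide), divDiff_zero (by decide)]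

theorem trace_pow_one : trace (X 3 ^ 1) = 0 := by
  rw [trace, pow_one, divDiff_X_right (by decide), divDiff_neg (by decide), divDiff_one (by decide),
    neg_zero]

theorem trace_pow_two : trace (X 3 ^ 2) = 1 := by
  rw [trace, divDiff_X_right_sq (by decide), divDiff_neg (by decide), divDiff_add (by decide),
    divDiff_X_right (by decide), divDiff_X_of_ne (by decide) (by decide) (by decide), add_zero,
    neg_neg]

/-- In the Leibniz rule for ∂_3 the swap turns x_4^k into x_3^k in the first term; in the second, n
is symmetric in x_2 and x_3 and comes out of ∂_2. The first term is what the contraction followed by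
`gamma` produces up to sign, the left side is what `projB₀` produces. -/
theorem trace_mul_pow {n : Poly} (hn : n ∈ Inv c121) (k : ℕ) :
    trace (n * X 3 ^ k) = divDiff 1 2 (divDiff 2 3 n * X 2 ^ k) + n * trace (X 3 ^ k) := by
  rw [trace, trace, divDiff_mul (by decide), divDiff_add (by decide),
    merges_c1111_c121.divDiff_mul hn, map_pow, rename_X, Equiv.swap_apply_right]

/-- Expand x_4^k by `trace_reconstruct`, multiply by m and apply ∂_3; the traces lie in R_13, hence
are symmetric in x_3 and x_4 and come out. -/
theorem divDiff_trace_reconstruct (m : Poly) (k : ℕ) :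
    ∑ j ∈ Finset.range 3, (-1 : ℤ) ^ j •
      (divDiff 2 3 (m * X 3 ^ (2 - j)) * trace (esymmOn {1, 2} j * X 3 ^ k)) =
    divDiff 2 3 (m * X 3 ^ k) := by
  conv_rhs => rw [← trace_reconstruct (pow_mem X_three_mem_c121 k), Finset.mul_sum,
    divDiff_sum (by decide)]
  refine Finset.sum_congr rfl fun j _ => ?_
  have h : trace (esymmOn {1, 2} j * X 3 ^ k) ∈ Inv c112 := refines_c112_c13.le
    (trace_mem (mul_mem (splits_c13_c121.elem j).2 (pow_mem X_three_mem_c121 k)))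
  -- The integer sign is rewritten as the polynomial (-1)^j, which is also invariant and so may move
  -- inside ∂_3.
  rw [mul_comm, ← merges_c1111_c112.divDiff_mul h, zsmul_eq_mul, Int.cast_pow, Int.cast_neg,
    Int.cast_one, ← merges_c1111_c112.divDiff_mul (pow_mem (neg_mem (one_mem _)) j)]
  congr 1
  ring

theorem esymmOn_pair_one {p q : Fin 4} (h : p ≠ q) : esymmOn {p, q} 1 = X p + X q := by
  rw [esymmOn_insert (by simpa using h), esymmOn_zero, esymmOn_singleton_one, mul_one, add_comm]

theorem esymmOn_pair_two {p q : Fin 4} (h : p ≠ q) : esymmOn {p, q} 2 = X p * X q := by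
  rw [esymmOn_insert (by simpa using h), esymmOn_of_card_lt (by simp), esymmOn_singleton_one,
    zero_add]

theorem sum_range_three_alternating {A : Type} [AddCommGroup A] (w : ℕ → A) :
    ∑ j ∈ Finset.range 3, (-1 : ℤ) ^ j • w j = w 0 - w 1 + w 2 := by
  rw [Finset.sum_range_succ, sum_range_two_alternating, neg_one_sq, one_zsmul]

/-- Since ∑ (-1)^j t^{2-j} e_j(x_1, x_2) = (t - x_1)(t - x_2), the numerator of the sum of divided
differences is p(x_3 - x_1)(x_3 - x_2); the swapped part has t = x_2 and vanishes. Division by x_2 -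
x_3 leaves the sign. -/
theorem sum_divDiff_esymm (p : Poly) : ∑ j ∈ Finset.range 3, (-1 : ℤ) ^ j •
    (divDiff 1 2 (p * X 2 ^ (2 - j)) * esymmOn {0, 1} j) = -(p * (X 2 - X 0)) := by
  rw [sum_range_three_alternating, esymmOn_zero, esymmOn_pair_one (by decide),
    esymmOn_pair_two (by decide)]
  apply mul_left_cancel₀ (X_sub_ne (p := 1) (q := 2) (by decide))
  have h (k : ℕ) := divDiff_spec 1 2 (p * X 2 ^ k)
  simp only [map_mul, map_pow, rename_X, Equiv.swap_apply_right] at h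
  linear_combination h 2 - (X 0 + X 1) * h 1 + X 0 * X 1 * h 0

theorem hom_inv_apply {a b : Fin 4 → ℕ} {M N : GBimod a b} (e : M ≅ N) (m : M.carrier) :
    e.inv.toFun (e.hom.toFun m) = m :=
  DFunLike.congr_fun (congrArg (fun φ : M ⟶ M => φ.toFun) e.hom_inv_id) m

theorem inv_hom_apply {a b : Fin 4 → ℕ} {M N : GBimod a b} (e : M ≅ N) (n : N.carrier) :
    e.hom.toFun (e.inv.toFun n) = n := hom_inv_apply e.symm n

/-! The maps of the elimination in degree zero -/

/-- The inclusion `R₁₁₂ ⊗_{R₄} R₂₂ → R₁₁₂ ⊗_{R₁₃} R₁₂₁ ⊗_{R₃₁} R₂₁₁`. -/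
def inclB₀ : modelA₀ ⟶ modelB₀ :=
  absorbN.inv ≫ (DHom.tensorLeft (reg c112 c112 c13 (Refines.refl _) refines_c112_c13) inclE :
    (reg c112 c112 c13 (Refines.refl _) refines_c112_c13).tensor modelN ⟶ modelB₀)

/-- The projection `R₁₁₂ ⊗_{R₁₃} R₁₂₁ ⊗_{R₃₁} R₂₁₁ → R₁₁₂ ⊗_{R₄} R₂₂`. -/
def projB₀ : DHom modelB₀ modelA₀
    (2 * (({0, 1, 2} : Finset (Fin 4)).card : ℤ) + -4 + -2 + 0) :=
  (DHom.tensorLeft (reg c112 c112 c13 (Refines.refl _) refines_c112_c13) projE).comp absorbN.hom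

/-- The map `m ⊗ n ⊗ p ↦ -m ⊗ ∂₃(n p)`. -/
def contractB₀ : DHom modelB₀ modelP (0 + -2 + 0) :=
  DHom.tensorLeft (reg c112 c112 c13 (Refines.refl _) refines_c112_c13) contractE

/-- The factor f from R_13 may be moved to the right of the first tensor sign; this is the shape in
which values of `projB₀` appear, with f a trace. -/
theorem inclB₀_apply (m : Inv c112) (f : Inv c13) (n : Inv c22) :
    inclB₀.toFun (tmulA₀ (m * Subalgebra.inclusion refines_c112_c13.le f) n) =
      tmulB₀ m (tmulE (Subalgebra.inclusion refines_c121_c13.le f) (ι22 n)) := by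
  let F : (((reg c112 c112 c13 (Refines.refl _) refines_c112_c13).tensor modelN)).carrier →+
      modelB₀.carrier :=
    (DHom.tensorLeft (reg c112 c112 c13 (Refines.refl _) refines_c112_c13) inclE).toFun
  have h : absorbN.inv.toFun (tmulA₀ (m * Subalgebra.inclusion refines_c112_c13.le f) n) =
      tmulHom (reg c112 c112 c13 (Refines.refl _) refines_c112_c13) modelN m (tmulN f n) :=
    (congrArg absorbN.inv.toFun (absorbN_hom m f n)).symm.trans (hom_inv_apply absorbN _)
  exact (congrArg F h).trans (congrArg (tmulB₀ m) (inclE_apply f n))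

theorem projB₀_apply (m : Inv c112) (n : Inv c121) (p : Inv c211) :
    projB₀.toFun (tmulB₀ m (tmulE n p)) = -∑ i ∈ Finset.range 4, (-1 : ℤ) ^ i •
      tmulA₀ (m * Subalgebra.inclusion refines_c112_c13.le (trace13 (n * x₄ ^ (3 - i))))
        (proj22 (ι31 (splits_c4_c31.elem i) * p)) := by
  let F : modelN.carrier →+ modelA₀.carrier := absorbN.hom.toFun.comp
    (tmulHom (reg c112 c112 c13 (Refines.refl _) refines_c112_c13) modelN m)
  exact (congrArg F (projE_apply n p)).trans ((map_neg F _).trans (congrArg Neg.neg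
    (map_sum_zsmul F 4 _ _ fun i => absorbN_hom _ _ _)))

theorem contractB₀_apply (m : Inv c112) (n : Inv c121) (p : Inv c211) :
    contractB₀.toFun (tmulB₀ m (tmulE n p)) = tmulP m (full (-divDiff 2 3 (n.1 * p.1))) :=
  congrArg (tmulP m) (contractE_apply n p)

/-- For the comultiplication from R_31 to R_31 ⊗_4 R_31: the term with e_0 dies under ∂_3 and the
shift of the index absorbs the minus sign in `projE`. -/
theorem neg_sum_range_four_alternating {A : Type} [AddCommGroup A] (w : ℕ → A) (h : w 0 = 0) :
    -∑ j ∈ Finset.range 4, (-1 : ℤ) ^ j • w j =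
      ∑ j ∈ Finset.range 3, (-1 : ℤ) ^ j • w (j + 1) := by
  rw [Finset.sum_range_succ', h, smul_zero, add_zero, ← Finset.sum_neg_distrib]
  refine Finset.sum_congr rfl fun j _ => ?_
  rw [pow_succ, mul_neg_one, neg_smul, neg_neg]

theorem trace13_mul_x₄_pow (f : Inv c13) (k : ℕ) :
    trace13 (Subalgebra.inclusion refines_c121_c13.le f * x₄ ^ k) = f * trace13 (x₄ ^ k) := by
  refine Subtype.ext ((congrArg trace (Subalgebra.coe_mul _ _ _)).trans ?_)
  rw [Subalgebra.coe_mul, Subalgebra.coe_inclusion, trace_mul f.2]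

theorem trace13_pow_zero : trace13 (x₄ ^ 0) = 0 := Subtype.ext trace_pow_zero

theorem trace13_pow_one : trace13 (x₄ ^ 1) = 0 := Subtype.ext trace_pow_one

theorem trace13_pow_two : trace13 (x₄ ^ 2) = 1 := Subtype.ext trace_pow_two

theorem e22_zero : e22 0 = 1 := by
  refine Subtype.ext ?_
  rw [OneMemClass.coe_one]
  exact esymmOn_zero {0, 1}

/-- From e_{j+1}(x_1, x_2, x_3) = e_{j+1}(x_1, x_2) + x_3 e_j(x_1, x_2), the operator ∂_3 returns
e_j(x_1, x_2), and R_22 is ∂_3-linear. -/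
theorem projE_tmulE (n : Inv c121) (p : Inv c22) : projE.toFun (tmulE n (ι22 p)) =
    ∑ j ∈ Finset.range 3, (-1 : ℤ) ^ j • tmulN (trace13 (n * x₄ ^ (2 - j))) (e22 j * p) := by
  refine (projE_apply n (ι22 p)).trans ((neg_sum_range_four_alternating _ ?_).trans ?_)
  · rw [proj22_elem_zero, map_zero]
  · refine Finset.sum_congr rfl fun j _ => ?_
    rw [proj22_elem_succ, show 3 - (j + 1) = 2 - j by omega]

/-- Only the term with trace of x_4² survives, and it has value 1 and coefficient e_0 = 1. -/
theorem projE_inclE (f : Inv c13) (n : Inv c22) :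
    projE.toFun (inclE.toFun (tmulN f n)) = tmulN f n := by
  refine (congrArg projE.toFun (inclE_apply f n)).trans ((projE_tmulE _ _).trans
    ((sum_range_three_alternating _).trans ?_))
  rw [trace13_mul_x₄_pow, trace13_mul_x₄_pow, trace13_mul_x₄_pow, Nat.sub_zero, Nat.sub_self,
    show 2 - 1 = 1 from rfl, trace13_pow_zero, trace13_pow_one, trace13_pow_two, mul_zero,
    map_zero, AddMonoidHom.zero_apply, AddMonoidHom.zero_apply, sub_zero, add_zero, mul_one,
    e22_zero, one_mul]

/-! Generators -/

theorem op_smul_tmulE (n : Inv c121) (p : Inv c211) (r : Inv c22) :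
    tmulE n (p * ι22 r) = op r • tmulE n p := by
  rw [mul_comm]
  exact (op_smul_regTmul _ _ _ _ _ _ _).symm

/-- The variable x_4 belongs to the base ring R_31. -/
theorem tmulE_x₄ (n : Inv c121) (p : Inv c211) :
    tmulE n (ι31 splits_c4_c31.var * p) = tmulE (n * x₄) p :=
  (regTmul_balanced _ _ _ _ _ _ _).symm

/-- R_211 is spanned by 1 and x_4 over R_22. The coefficients act from the right, while x_4 crosses
the tensor sign. -/
theorem tmulE_eq (n : Inv c121) (p : Inv c211) : ∃ a b : Inv c22,
    tmulE n p = op a • tmulE n 1 + op b • tmulE (n * x₄) 1 := by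
  refine ⟨proj22 (splits_c31_c211.var * p), -proj22 p, ?_⟩
  rw [← op_smul_tmulE, ← op_smul_tmulE, ← tmulE_x₄, ← map_add]
  congr 1
  apply Subtype.ext
  have h := divDiff_reconstruct (p := 2) (q := 3) (by decide) p.1
  rw [one_mul, one_mul, map_neg]
  change p.1 = divDiff 2 3 (X 2 * p.1) + X 3 * -divDiff 2 3 p.1
  rw [mul_neg, ← sub_eq_add_neg, h]

theorem Inv.coe_sub {c : Fin 4 → ℕ} (f g : Inv c) : ((f - g : Inv c) : Poly) = f.1 - g.1 := rfl

theorem Inv.coe_neg {c : Fin 4 → ℕ} (f : Inv c) : ((-f : Inv c) : Poly) = -f.1 := rfl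

theorem Inv.coe_mul {c : Fin 4 → ℕ} (f g : Inv c) : ((f * g : Inv c) : Poly) = f.1 * g.1 := rfl

theorem Inv.coe_one {c : Fin 4 → ℕ} : ((1 : Inv c) : Poly) = 1 := rfl

theorem Inv.coe_add {c : Fin 4 → ℕ} (f g : Inv c) : ((f + g : Inv c) : Poly) = f.1 + g.1 := rfl

theorem Inv.neg_mul {c : Fin 4 → ℕ} (f g : Inv c) : -f * g = -(f * g) := _root_.neg_mul f g

theorem Inv.coe_pow {c : Fin 4 → ℕ} (f : Inv c) (k : ℕ) : ((f ^ k : Inv c) : Poly) = f.1 ^ k := rfl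

theorem ι22_e22 (j : ℕ) : ι22 (e22 j) = elem12 j := Subtype.ext rfl

theorem elem12_zero : elem12 0 = 1 := by
  rw [← ι22_e22, e22_zero, map_one]

theorem elem23_zero : elem23 0 = 1 := by
  refine Subtype.ext ?_
  rw [OneMemClass.coe_one]
  exact esymmOn_zero {1, 2}

theorem gamma_op_smul (r : Inv c22) (z : modelP.carrier) : gamma (op r • z) = op r • gamma z :=
  (inclP ≫ splitBeforeCrossing.d 1 0 ≫ isoB₀.hom).map_right r z

theorem alpha_op_smul (r : Inv c22) (z : modelB₂.carrier) : alpha (op r • z) = op r • alpha z :=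
  (isoB₂.inv ≫ splitBeforeCrossing.d 2 1 ≫ projP).map_right r z

theorem trace13_val (f : Inv c121) : (trace13 f).1 = trace f.1 := rfl

theorem x₄_val : x₄.1 = X 3 := rfl

theorem diff112_val (f : Poly) : (diff112 f).1 = divDiff 2 3 f := rfl

theorem diff121_val (f : Poly) : (diff121 f).1 = divDiff 1 2 f := rfl

theorem full_val (f : Poly) : (full f).1 = f := rfl

theorem modelN_hom_ext {A : Type} [AddCommGroup A] {f g : modelN.carrier →+ A}
    (h : ∀ m n, f (tmulN m n) = g (tmulN m n)) : f = g := tensor_hom_ext h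

theorem modelQ_hom_ext {A : Type} [AddCommGroup A] {f g : modelQ.carrier →+ A}
    (h : ∀ m p, f (tmulQ m p) = g (tmulQ m p)) : f = g := tensor_hom_ext h

theorem modelP_hom_ext {A : Type} [AddCommGroup A] {f g : modelP.carrier →+ A}
    (h : ∀ m p, f (tmulP m p) = g (tmulP m p)) : f = g := tensor_hom_ext h

theorem tmulB₀_hom_ext {A : Type} [AddCommGroup A] {f g : modelB₀.carrier →+ A}
    (h : ∀ m n p, f (tmulB₀ m (tmulE n p)) = g (tmulB₀ m (tmulE n p))) : f = g :=
  tensor_hom_ext_right h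

theorem tmulB₂_hom_ext {A : Type} [AddCommGroup A] {f g : modelB₂.carrier →+ A}
    (h : ∀ m p, f (tmulB₂ m p) = g (tmulB₂ m p)) : f = g := tensor_hom_ext h

theorem op_smul_tmulB₀ (m : Inv c112) (z : modelE.carrier) (r : Inv c22) :
    tmulB₀ m (op r • z) = op r • tmulB₀ m z := rfl

/-- A right linear map out of `R₁₁₂ ⊗_{R₁₃} R₁₂₁ ⊗_{R₃₁} R₂₁₁` is determined by its values on the
elements `m ⊗ n ⊗ 1`. -/
theorem modelB₀_hom_ext {M : GBimod c112 c22} {F G : modelB₀.carrier →+ M.carrier}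
    (hF : ∀ (r : Inv c22) z, F (op r • z) = op r • F z)
    (hG : ∀ (r : Inv c22) z, G (op r • z) = op r • G z)
    (h : ∀ m n, F (tmulB₀ m (tmulE n 1)) = G (tmulB₀ m (tmulE n 1))) : F = G := by
  refine tmulB₀_hom_ext fun m n p => ?_
  obtain ⟨a, b, hp⟩ := tmulE_eq n p
  rw [hp, map_add, map_add, map_add, op_smul_tmulB₀, op_smul_tmulB₀, hF, hF, hG, hG, h, h]

theorem op_smul_tmulB₂ (m p : Inv c1111) (r : Inv c22) :
    tmulB₂ m (p * Subalgebra.inclusion (refines_c1111_c211.trans refines_c211_c22).le r) =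
      op r • tmulB₂ m p := by
  rw [mul_comm]
  exact (op_smul_regTmul _ _ _ _ _ _ _).symm

theorem tmulB₂_balanced (m p : Inv c1111) (r : Inv c121) :
    tmulB₂ m (Subalgebra.inclusion refines_c1111_c121.le r * p) =
      tmulB₂ (m * Subalgebra.inclusion refines_c1111_c121.le r) p :=
  (regTmul_balanced _ _ _ _ _ _ _).symm

/-- R_1111 is spanned over R_121 by 1 and x_1 + x_2: the second basis element can be chosen in R_22,
so that it acts from the right, while coefficients in R_121 cross to the left factor. -/
theorem tmulB₂_eq (m p : Inv c1111) : ∃ (a b : Inv c1111) (r : Inv c22),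
    tmulB₂ m p = tmulB₂ a 1 + op r • tmulB₂ b 1 := by
  let ι := Subalgebra.inclusion refines_c1111_c121.le
  let q : Inv c121 := diff121 p.1
  let q' : Inv c121 := diff121 (X 1 * p.1)
  let y : Inv c121 := elem23 1
  let x : Inv c121 := Subalgebra.inclusion refines_c121_c13.le ⟨X 0, X_zero_mem_c13⟩
  -- In p = ∂_2(x_2 p) - x_3 ∂_2(p), the factor -x_3 is replaced by (x_1 + x_2) - x_1 - (x_2 + x_3),
  -- where x_1 and x_2 + x_3 lie in R_121.
  refine ⟨m * ι (q' - y * q - x * q), m * ι q, e22 1, ?_⟩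
  rw [← op_smul_tmulB₂, ← tmulB₂_balanced, ← tmulB₂_balanced, ← map_add]
  congr 1
  apply Subtype.ext
  have h := divDiff_reconstruct (p := 1) (q := 2) (by decide) p.1
  rw [mul_one, one_mul]
  change p.1 = divDiff 1 2 (X 1 * p.1) - esymmOn {1, 2} 1 * divDiff 1 2 p.1 -
    X 0 * divDiff 1 2 p.1 + divDiff 1 2 p.1 * esymmOn {0, 1} 1
  rw [esymmOn_pair_one (by decide), esymmOn_pair_one (by decide)]
  linear_combination -h

/-- A right linear map out of `R₁₁₁₁ ⊗_{R₁₂₁} R₁₁₁₁` is determined by its values on the elements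
`m ⊗ 1`. -/
theorem modelB₂_hom_ext {M : GBimod c112 c22} {F G : modelB₂.carrier →+ M.carrier}
    (hF : ∀ (r : Inv c22) z, F (op r • z) = op r • F z)
    (hG : ∀ (r : Inv c22) z, G (op r • z) = op r • G z)
    (h : ∀ m, F (tmulB₂ m 1) = G (tmulB₂ m 1)) : F = G := by
  refine tmulB₂_hom_ext fun m p => ?_
  obtain ⟨a, b, r, hp⟩ := tmulB₂_eq m p
  rw [hp, map_add, map_add, hF, hG, h, h]

/-! The identities between the maps of the elimination -/

/-- Multiplying the factors of m ⊗ x_2 - m x_3 ⊗ 1 gives m(x_2 - x_3), and -∂_3 of this is m because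
m is symmetric in x_3 and x_4. -/
theorem projB₂_inclB₂ (m : Inv c112) : projB₂.toFun (inclB₂.toFun m) = m := by
  refine (congrArg projB₂.toFun (inclB₂_apply m)).trans ((map_sub projB₂.toFun _ _).trans
    ((congrArg₂ (fun z w : Inv c112 => z - w) (projB₂_apply _ _) (projB₂_apply _ _)).trans
      (Subtype.ext ?_)))
  rw [Inv.coe_sub, Inv.coe_neg, Inv.coe_neg, diff112_val, diff112_val, Inv.coe_mul, Inv.coe_one,
    Subalgebra.coe_inclusion]
  rw [merges_c1111_c112.divDiff_mul m.2, mul_one, merges_c1111_c112.divDiff_mul m.2,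
    divDiff_X_left (by decide), divDiff_X_of_ne (by decide) (by decide) (by decide)]
  ring

/-- Both maps apply ∂_3 to the last factor, and ∂_3² = 0. -/
theorem contractP_contractB₀ (z : modelB₀.carrier) :
    contractP.toFun (contractB₀.toFun z) = 0 := by
  have h : contractP.toFun.comp contractB₀.toFun = 0 := tmulB₀_hom_ext fun m n p => by
    refine (congrArg contractP.toFun (contractB₀_apply m n p)).trans
      ((contractP_apply _ _).trans ?_)
    have h0 : diff112 (full (-divDiff 2 3 (n.1 * p.1))).1 = 0 := Subtype.ext (by
      change divDiff 2 3 (-divDiff 2 3 (n.1 * p.1)) = 0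
      rw [divDiff_neg (by decide), divDiff_sq (by decide), neg_zero])
    rw [h0, map_zero, map_zero]
    rfl
  exact DFunLike.congr_fun h z

theorem projB₀_inclB₀ (z : modelA₀.carrier) : projB₀.toFun (inclB₀.toFun z) = z := by
  let C := reg c112 c112 c13 (Refines.refl _) refines_c112_c13
  have h1 : projE.toFun.comp inclE.toFun = AddMonoidHom.id modelN.carrier :=
    modelN_hom_ext projE_inclE
  have h2 : (DHom.tensorLeft C projE).toFun.comp (DHom.tensorLeft C inclE).toFun =
      AddMonoidHom.id (C.tensor modelN).carrier :=
    tensor_hom_ext fun m n => congrArg (tmulHom C modelN m) (DFunLike.congr_fun h1 n)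
  exact (congrArg absorbN.hom.toFun (DFunLike.congr_fun h2 (absorbN.inv.toFun z))).trans
    (inv_hom_apply absorbN z)

/-- The two terms of `inclB₂` contribute ∂_2(x_2 g) - x_3 ∂_2(g) with g = x_3^{2-j}, which is g
itself by `divDiff_reconstruct`. -/
theorem beta_inclB₂ (m : Inv c112) : beta (inclB₂.toFun m) = -dA₂ m := by
  refine (congrArg beta (inclB₂_apply m)).trans ((map_sub beta _ _).trans ?_)
  rw [beta_apply, beta_apply, dA₂_apply, ← neg_sub', ← Finset.sum_sub_distrib]
  refine congrArg Neg.neg (Finset.sum_congr rfl fun j _ => ?_)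
  rw [← smul_sub, ← AddMonoidHom.sub_apply, ← map_sub]
  refine congrArg (fun z => (-1 : ℤ) ^ j • tmulQ z (elem12 j)) (Subtype.ext ?_)
  rw [Inv.coe_sub, Inv.coe_mul, Inv.coe_mul, Inv.coe_mul, Subalgebra.coe_inclusion,
    Subalgebra.coe_inclusion, Subalgebra.coe_inclusion, diff121_val, diff121_val, Inv.coe_one]
  rw [one_mul, mul_assoc, ← mul_sub, divDiff_reconstruct (by decide)]

/-- After interchanging the two summations, the sum over the Δ'_21 index contracts the dual bases of
R_121 over R_13 (`divDiff_trace_reconstruct`), and only the sum from Δ_31 remains. -/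
theorem projB₀_delta (z : modelQ.carrier) : projB₀.toFun (delta z) = -dA₁ z := by
  have h : projB₀.toFun.comp delta = -dA₁ := modelQ_hom_ext fun m p => by
    change projB₀.toFun (delta (tmulQ m p)) = -dA₁ (tmulQ m p)
    refine (congrArg projB₀.toFun (delta_apply m p)).trans ((map_sum_zsmul projB₀.toFun 3 _ _
      fun j => projB₀_apply _ _ _).trans ?_)
    rw [dA₁_apply]
    simp only [smul_neg, Finset.sum_neg_distrib, Finset.smul_sum]
    rw [Finset.sum_comm]
    refine congrArg Neg.neg (Finset.sum_congr rfl fun i _ => ?_)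
    simp only [smul_comm _ ((-1 : ℤ) ^ i)]
    rw [← Finset.smul_sum]
    refine congrArg _ ?_
    let τ : Inv c112 →+ modelA₀.carrier :=
      tmulA₀.flip (proj22 (ι31 (splits_c4_c31.elem i) * p))
    refine (map_sum_zsmul τ 3 _ _ fun j => rfl).symm.trans (congrArg τ (Subtype.ext ?_))
    refine Eq.trans ?_ (divDiff_trace_reconstruct m.1 (3 - i))
    rw [AddSubmonoidClass.coe_finsetSum]
    rfl
  exact DFunLike.congr_fun h z

theorem projB₀_tmulE_one (m : Inv c112) (n : Inv c121) : projB₀.toFun (tmulB₀ m (tmulE n 1)) =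
    ∑ j ∈ Finset.range 3, (-1 : ℤ) ^ j •
      tmulA₀ (m * Subalgebra.inclusion refines_c112_c13.le (trace13 (n * x₄ ^ (2 - j)))) (e22 j) := by
  refine (projB₀_apply m n 1).trans ((neg_sum_range_four_alternating _ ?_).trans ?_)
  · rw [← map_one ι22, proj22_elem_zero, map_zero]
  · refine Finset.sum_congr rfl fun j _ => ?_
    rw [← map_one ι22, proj22_elem_succ, mul_one, show 3 - (j + 1) = 2 - j by omega]

/-- The identity `trace_mul_pow` rearranged; the minus sign in `contractE` makes the two
∂_3(n)-terms cancel. -/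
theorem trace13_mul_x₄_pow_eq (n : Inv c121) (k : ℕ) :
    diff121 (-divDiff 2 3 (n.1 * (1 : Inv c211).1) * X 2 ^ k) +
      Subalgebra.inclusion refines_c121_c13.le (trace13 (n * x₄ ^ k)) =
    n * Subalgebra.inclusion refines_c121_c13.le (trace13 (x₄ ^ k)) := by
  apply Subtype.ext
  rw [Inv.coe_add, Inv.coe_mul, Subalgebra.coe_inclusion, Subalgebra.coe_inclusion, trace13_val,
    trace13_val, Inv.coe_mul, Inv.coe_pow, x₄_val, diff121_val, Inv.coe_one, trace_mul_pow n.2,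
    mul_one, neg_mul, divDiff_neg (by decide), neg_add_cancel_left]

theorem gamma_contractB₀_tmul (m : Inv c112) (n : Inv c121) :
    gamma (contractB₀.toFun (tmulB₀ m (tmulE n 1))) = ∑ j ∈ Finset.range 3, (-1 : ℤ) ^ j •
      tmulB₀ m (tmulE (diff121 (-divDiff 2 3 (n.1 * (1 : Inv c211).1) * X 2 ^ (2 - j)))
        (elem12 j)) :=
  (congrArg gamma (contractB₀_apply m n 1)).trans (gamma_apply _ _)

theorem inclB₀_projB₀_tmul (m : Inv c112) (n : Inv c121) :
    inclB₀.toFun (projB₀.toFun (tmulB₀ m (tmulE n 1))) = ∑ j ∈ Finset.range 3, (-1 : ℤ) ^ j •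
      tmulB₀ m (tmulE (Subalgebra.inclusion refines_c121_c13.le (trace13 (n * x₄ ^ (2 - j))))
        (elem12 j)) := by
  refine (congrArg inclB₀.toFun (projB₀_tmulE_one m n)).trans
    (map_sum_zsmul inclB₀.toFun 3 _ _ fun j => (inclB₀_apply _ _ _).trans ?_)
  rw [ι22_e22]

/-- On m ⊗ n ⊗ 1 the two composites are sums over the same elements e_j(x_1, x_2). By
`trace13_mul_x₄_pow_eq` their coefficients add up to n times the trace of x_4^{2-j}, which is n for
j = 0 and zero otherwise. -/
theorem gamma_contractB₀_add (z : modelB₀.carrier) :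
    gamma (contractB₀.toFun z) + inclB₀.toFun (projB₀.toFun z) = z := by
  let F : modelB₀.carrier →+ modelB₀.carrier :=
    gamma.comp contractB₀.toFun + inclB₀.toFun.comp projB₀.toFun
  have hF (z : modelB₀.carrier) : F z =
    gamma (contractB₀.toFun z) + inclB₀.toFun (projB₀.toFun z) := rfl
  have h : F = AddMonoidHom.id modelB₀.carrier := by
    refine modelB₀_hom_ext (fun r z => ?_) (fun _ _ => rfl) fun m n => ?_
    · rw [hF, hF, DHom.map_right, DHom.map_right, DHom.map_right, gamma_op_smul, smul_add]
    · rw [hF, gamma_contractB₀_tmul, inclB₀_projB₀_tmul, ← Finset.sum_add_distrib]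
      have hj (j : ℕ) : (-1 : ℤ) ^ j • tmulB₀ m (tmulE (diff121
          (-divDiff 2 3 (n.1 * (1 : Inv c211).1) * X 2 ^ (2 - j))) (elem12 j)) + (-1 : ℤ) ^ j •
          tmulB₀ m (tmulE (Subalgebra.inclusion refines_c121_c13.le (trace13 (n * x₄ ^ (2 - j))))
          (elem12 j)) = (-1 : ℤ) ^ j • tmulB₀ m (tmulE (n * Subalgebra.inclusion
            refines_c121_c13.le (trace13 (x₄ ^ (2 - j)))) (elem12 j)) := by
        rw [← smul_add, ← map_add, ← AddMonoidHom.add_apply, ← map_add, trace13_mul_x₄_pow_eq]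
      refine (Finset.sum_congr rfl fun j _ => hj j).trans
        ((sum_range_three_alternating _).trans ?_)
      rw [Nat.sub_zero, Nat.sub_self, show 2 - 1 = 1 from rfl, trace13_pow_zero, trace13_pow_one,
        trace13_pow_two, map_zero, mul_zero, map_zero, AddMonoidHom.zero_apply,
        AddMonoidHom.zero_apply, map_zero, sub_zero, add_zero, map_one, mul_one, elem12_zero,
        AddMonoidHom.id_apply]
  exact (hF z).symm.trans (DFunLike.congr_fun h z)

/-- The contraction multiplies the last two factors, so the sum defining `gamma` collapses by
`sum_divDiff_esymm`; its sign cancels the one in `contractE`. -/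
theorem contractB₀_gamma (m : Inv c112) (p : Inv c1111) :
    contractB₀.toFun (gamma (tmulP m p)) =
      tmulP m (full (divDiff 2 3 (p.1 * (X 2 - X 0)))) := by
  refine (congrArg contractB₀.toFun (gamma_apply m p)).trans ((map_sum_zsmul contractB₀.toFun 3 _ _
    fun j => contractB₀_apply _ _ _).trans ((map_sum_zsmul (tmulP m) 3 _ _ fun j => rfl).symm.trans
      (congrArg (tmulP m) (Subtype.ext ?_))))
  rw [← neg_neg (p.1 * _), ← sum_divDiff_esymm, divDiff_neg (by decide), divDiff_sum (by decide),
    ← Finset.sum_neg_distrib, AddSubmonoidClass.coe_finsetSum]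
  refine Finset.sum_congr rfl fun j _ => ?_
  rw [divDiff_zsmul (by decide), ← smul_neg]
  rfl

/-- With p symmetric in x_3 and x_4 only ∂_3(x_3 - x_1) = 1 is left. This shows that the copy of
R_112 ⊗_13 R_112 inside P is the one cancelled against B₀. -/
theorem contractB₀_gamma_of_mem (m : Inv c112) (p : Inv c1111) (hp : p.1 ∈ Inv c112) :
    contractB₀.toFun (gamma (tmulP m p)) = tmulP m p := by
  rw [contractB₀_gamma, merges_c1111_c112.divDiff_mul hp, divDiff_sub (by decide),
    divDiff_X_left (by decide), divDiff_X_of_ne (by decide) (by decide) (by decide), sub_zero,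
    mul_one]

/-- As m is symmetric in x_3 and x_4, ∂_3(m x_4^{2-j}) vanishes for j = 2 and is -m for j = 1; only
j = 0 and j = 1 contribute. -/
theorem alpha_contractP (m : Inv c112) (p : Inv c1111) : alpha (contractP.toFun (tmulP m p)) =
    tmulP m (full ((X 1 + X 2) * divDiff 2 3 p.1)) -
      tmulP (diff112 (-(m.1 * X 3 ^ 2))) (full (divDiff 2 3 p.1)) := by
  refine (congrArg alpha (contractP_apply m p)).trans ((alpha_apply _ _).trans
    ((sum_range_three_alternating _).trans ?_))
  rw [Nat.sub_zero, Nat.sub_self, show 2 - 1 = 1 from rfl, elem23_zero, map_one, one_mul,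
    Subalgebra.coe_inclusion]
  have h0 : diff112 (m.1 * X 3 ^ 0) = 0 := Subtype.ext (by
    rw [diff112_val, pow_zero, mul_one, divDiff_of_fixed (by decide)
      (merges_c1111_c112.rename_swap m.2), ZeroMemClass.coe_zero])
  have h1 : diff112 (m.1 * X 3 ^ 1) = -m := Subtype.ext (by
    rw [diff112_val, pow_one, merges_c1111_c112.divDiff_mul m.2, divDiff_X_right (by decide),
      Inv.coe_neg, mul_neg_one])
  have h2 : diff112 (-(m.1 * X 3 ^ 2)) = -diff112 (m.1 * X 3 ^ 2) := Subtype.ext (by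
    rw [Inv.coe_neg, diff112_val, diff112_val, divDiff_neg (by decide)])
  have e1 : Subalgebra.inclusion refines_c1111_c121.le (elem23 1) *
      Subalgebra.inclusion refines_c1111_c112.le (diff112 p.1) =
      full ((X 1 + X 2) * divDiff 2 3 p.1) := Subtype.ext (by
    rw [Inv.coe_mul, Subalgebra.coe_inclusion, Subalgebra.coe_inclusion, diff112_val, full_val,
      ← esymmOn_pair_one (by decide)]
    rfl)
  have e0 : Subalgebra.inclusion refines_c1111_c112.le (diff112 p.1) = full (divDiff 2 3 p.1) :=
    Subtype.ext rfl
  rw [h0, h1, h2, e1, e0, map_zero, map_neg, map_neg, AddMonoidHom.zero_apply,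
    AddMonoidHom.neg_apply, AddMonoidHom.neg_apply, add_zero, sub_neg_eq_add, sub_neg_eq_add,
    add_comm]

theorem sub_contractB₀_gamma (w : modelP.carrier)
    (h : ∃ (m m' : Inv c112) (p p' : Inv c1111), p.1 ∈ Inv c112 ∧ p'.1 ∈ Inv c112 ∧
      w = tmulP m p + tmulP m' p') : w - contractB₀.toFun (gamma w) = 0 := by
  obtain ⟨m, m', p, p', hp, hp', rfl⟩ := h
  rw [map_add, map_add, contractB₀_gamma_of_mem m p hp, contractB₀_gamma_of_mem m' p' hp', sub_self]

/-- The correction by `alpha` moves every element of P into the copy of R_112 ⊗_13 R_112, where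
`contractB₀_gamma_of_mem` applies. -/
theorem tmulP_sub_alpha_contractP (m : Inv c112) (p : Inv c1111) :
    ∃ (m₁ m₂ : Inv c112) (p₁ p₂ : Inv c1111), p₁.1 ∈ Inv c112 ∧ p₂.1 ∈ Inv c112 ∧
      tmulP m p - alpha (contractP.toFun (tmulP m p)) = tmulP m₁ p₁ + tmulP m₂ p₂ := by
  refine ⟨m, diff112 (-(m.1 * X 3 ^ 2)), full (p.1 - (X 1 + X 2) * divDiff 2 3 p.1),
    full (divDiff 2 3 p.1), ?_, (diff112 p.1).2, ?_⟩
  · have h := divDiff_reconstruct (p := 2) (q := 3) (by decide) p.1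
    -- Substituting p = ∂_3(x_3 p) - x_4 ∂_3(p) makes the coefficient of ∂_3(p) equal to -(x_2 + x_3
    -- + x_4), so the whole expression is symmetric in x_3 and x_4.
    have e : p.1 - (X 1 + X 2) * divDiff 2 3 p.1 = (diff112 (X 2 * p.1)).1 -
        (esymmOn {2, 3} 1 + X 1) * (diff112 p.1).1 := by
      rw [esymmOn_pair_one (by decide), diff112_val, diff112_val]
      linear_combination -h
    rw [full_val, e]
    exact sub_mem (diff112 _).2 (mul_mem (add_mem (esymmOn_mem (by decide) 1) X_one_mem_c112)
      (diff112 _).2)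
  · rw [alpha_contractP, sub_sub_eq_add_sub, add_sub_right_comm, ← map_sub]
    rfl

theorem elimination_degree_one (z : modelP.carrier) :
    (z - alpha (contractP.toFun z)) -
      contractB₀.toFun (gamma (z - alpha (contractP.toFun z))) = 0 := by
  let F : modelP.carrier →+ modelP.carrier :=
    AddMonoidHom.id modelP.carrier - alpha.comp contractP.toFun
  let G : modelP.carrier →+ modelP.carrier :=
    AddMonoidHom.id modelP.carrier - contractB₀.toFun.comp gamma
  have h : G.comp F = 0 := modelP_hom_ext fun m p =>
    sub_contractB₀_gamma _ (tmulP_sub_alpha_contractP m p)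
  exact DFunLike.congr_fun h z

/-- The right factors are ∂_3 of e_0, e_1, e_2 in x_2 and x_3, that is 0, 1 and x_2. -/
theorem contractP_alpha (m : Inv c1111) : contractP.toFun (alpha (tmulB₂ m 1)) =
    tmulB₂ (Subalgebra.inclusion refines_c1111_c112.le (diff112 m.1)) (full (X 1)) -
      tmulB₂ (full (divDiff 2 3 (m.1 * X 3))) 1 := by
  refine (congrArg contractP.toFun (alpha_apply m 1)).trans ((map_sum_zsmul contractP.toFun 3 _ _
    fun j => contractP_apply _ _).trans ((sum_range_three_alternating _).trans ?_))
  have h (j : ℕ) (f : Poly) (hf : divDiff 2 3 (esymmOn {1, 2} j) = f) :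
      Subalgebra.inclusion refines_c1111_c112.le (diff112
      (Subalgebra.inclusion refines_c1111_c121.le (elem23 j) * 1 : Inv c1111).1) = full f :=
    Subtype.ext (by
      rw [mul_one, Subalgebra.coe_inclusion, diff112_val, Subalgebra.coe_inclusion, full_val, ← hf]
      rfl)
  rw [h 0 0 (by rw [esymmOn_zero, divDiff_one (by decide)]),
    h 1 1 (by rw [esymmOn_pair_one (by decide), divDiff_add (by decide),
      divDiff_X_left (by decide), divDiff_X_of_ne (by decide) (by decide) (by decide), zero_add]),
    h 2 (X 1) (by rw [esymmOn_pair_two (by decide), merges_c1111_c112.divDiff_mul X_one_mem_c112,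
      divDiff_X_left (by decide), mul_one])]
  have e0 : full 0 = 0 := rfl
  have e1 : full 1 = 1 := rfl
  rw [e0, e1, map_zero, zero_sub, Nat.sub_self, show 2 - 1 = 1 from rfl, pow_zero, mul_one, pow_one,
    add_comm, ← sub_eq_add_neg]
  rfl

theorem inclB₂_projB₂ (m : Inv c1111) : inclB₂.toFun (projB₂.toFun (tmulB₂ m 1)) =
    tmulB₂ (full (divDiff 2 3 m.1 * X 2)) 1 -
      tmulB₂ (Subalgebra.inclusion refines_c1111_c112.le (diff112 m.1)) (full (X 1)) := by
  refine (congrArg inclB₂.toFun (projB₂_apply m 1)).trans ((inclB₂_apply _).trans ?_)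
  rw [map_neg, Inv.neg_mul, map_neg, map_neg, AddMonoidHom.neg_apply, AddMonoidHom.neg_apply,
    sub_neg_eq_add, add_comm, ← sub_eq_add_neg, Inv.coe_one, mul_one]
  refine congrArg (fun z => tmulB₂ z 1 - _) (Subtype.ext ?_)
  rw [Inv.coe_mul, Subalgebra.coe_inclusion, diff112_val, full_val, full_val]

/-- On m ⊗ 1 the terms ∂_3(m) ⊗ x_2 cancel, and the rest is (x_3 ∂_3(m) - ∂_3(x_4 m)) ⊗ 1, which is
m ⊗ 1 by `divDiff_reconstruct'`. -/
theorem contractP_alpha_add (z : modelB₂.carrier) :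
    contractP.toFun (alpha z) + inclB₂.toFun (projB₂.toFun z) = z := by
  let F : modelB₂.carrier →+ modelB₂.carrier :=
    contractP.toFun.comp alpha + inclB₂.toFun.comp projB₂.toFun
  have hF (z : modelB₂.carrier) : F z =
    contractP.toFun (alpha z) + inclB₂.toFun (projB₂.toFun z) := rfl
  have h : F = AddMonoidHom.id modelB₂.carrier := by
    refine modelB₂_hom_ext (fun r z => ?_) (fun _ _ => rfl) fun m => ?_
    · rw [hF, hF, DHom.map_right, DHom.map_right, alpha_op_smul, DHom.map_right, smul_add]
    · rw [hF, contractP_alpha, inclB₂_projB₂, add_comm, sub_add_sub_cancel, ← AddMonoidHom.sub_apply,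
        ← map_sub]
      refine congrArg (fun z => tmulB₂ z 1) (Subtype.ext ?_)
      rw [Inv.coe_sub, full_val, full_val, mul_comm, mul_comm m.1]
      exact divDiff_reconstruct' (by decide) m.1
  exact (hF z).symm.trans (DFunLike.congr_fun h z)

/-! ### Transport to the simplified terms and conclusion -/

/-- Gaussian elimination with the terms of the complexes replaced by isomorphic objects. -/
theorem nonempty_homotopyEquiv_of_isos {C : Type*} [Category* C] [Preadditive C]
    {K L : ChainComplex C ℕ}
    (hK : ∀ (n : ℕ) (X : C) (f g : K.X (n + 3) ⟶ X), f = g)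
    (hL : ∀ (n : ℕ) (X : C) (f g : L.X (n + 3) ⟶ X), f = g)
    {A₀ A₁ A₂ B₀ B₂ P : C} (a₀ : K.X 0 ≅ A₀) (a₁ : K.X 1 ≅ A₁) (a₂ : K.X 2 ≅ A₂)
    (b₀ : L.X 0 ≅ B₀) (b₂ : L.X 2 ≅ B₂)
    {iP : P ⟶ L.X 1} {pP : L.X 1 ⟶ P} {iQ : A₁ ⟶ L.X 1} {pQ : L.X 1 ⟶ A₁}
    (ePP : iP ≫ pP = 𝟙 P) (eQQ : iQ ≫ pQ = 𝟙 _) (ePQ : iP ≫ pQ = 0) (eQP : iQ ≫ pP = 0)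
    (eid : pP ≫ iP + pQ ≫ iQ = 𝟙 _)
    (f₀ : A₀ ⟶ B₀) (g₀ : B₀ ⟶ A₀) (f₂ : A₂ ⟶ B₂) (g₂ : B₂ ⟶ A₂) (h₀ : B₀ ⟶ P) (h₁ : P ⟶ B₂)
    (fg₀ : f₀ ≫ g₀ = 𝟙 _) (fg₂ : f₂ ≫ g₂ = 𝟙 _) (hh : h₀ ≫ h₁ = 0)
    (H₁ : f₂ ≫ b₂.inv ≫ L.d 2 1 ≫ pQ = -(a₂.inv ≫ K.d 2 1 ≫ a₁.hom))
    (H₂ : (iQ ≫ L.d 1 0 ≫ b₀.hom) ≫ g₀ = -(a₁.inv ≫ K.d 1 0 ≫ a₀.hom))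
    (H₃ : h₀ ≫ (iP ≫ L.d 1 0 ≫ b₀.hom) + g₀ ≫ f₀ = 𝟙 _)
    (H₄ : (𝟙 P - h₁ ≫ b₂.inv ≫ L.d 2 1 ≫ pP) ≫ (𝟙 P - (iP ≫ L.d 1 0 ≫ b₀.hom) ≫ h₀) = 0)
    (H₅ : (b₂.inv ≫ L.d 2 1 ≫ pP) ≫ h₁ + g₂ ≫ f₂ = 𝟙 _) :
    Nonempty (HomotopyEquiv K L) := by
  -- All maps are conjugated by the isomorphisms. `P` needs none, since it is a summand of a term
  -- and its inclusion and projection are given directly.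
  refine nonempty_homotopyEquiv_of_elimination hK hL (iP := iP) (pP := pP) (iQ := a₁.hom ≫ iQ)
    (pQ := pQ ≫ a₁.inv) ePP ?_ ?_ ?_ ?_ rfl rfl rfl rfl (a₀.hom ≫ f₀ ≫ b₀.inv)
    (b₀.hom ≫ g₀ ≫ a₀.inv) (a₂.hom ≫ f₂ ≫ b₂.inv) (b₂.hom ≫ g₂ ≫ a₂.inv) (b₀.hom ≫ h₀)
    (h₁ ≫ b₂.inv) ?_ ?_ ?_ ?_ ?_ ?_ ?_ ?_
  · rw [Category.assoc, reassoc_of% eQQ, Iso.hom_inv_id]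
  · rw [reassoc_of% ePQ, Limits.zero_comp]
  · rw [Category.assoc, eQP, Limits.comp_zero]
  · rw [Category.assoc, Iso.inv_hom_id_assoc, eid]
  · simp only [Category.assoc, Iso.inv_hom_id_assoc, reassoc_of% fg₀, Iso.hom_inv_id]
  · simp only [Category.assoc, Iso.inv_hom_id_assoc, reassoc_of% fg₂, Iso.hom_inv_id]
  · rw [Category.assoc, reassoc_of% hh, Limits.zero_comp, Limits.comp_zero]
  · rw [← cancel_epi a₂.inv, ← cancel_mono a₁.hom]
    simpa only [Category.assoc, Iso.inv_hom_id_assoc, Iso.inv_hom_id, Category.comp_id,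
      Preadditive.comp_neg, Preadditive.neg_comp] using H₁
  · rw [← cancel_epi a₁.inv, ← cancel_mono a₀.hom]
    simpa only [Category.assoc, Iso.inv_hom_id_assoc, Iso.inv_hom_id, Category.comp_id,
      Preadditive.comp_neg, Preadditive.neg_comp] using H₂
  · rw [← cancel_epi b₀.inv, ← cancel_mono b₀.hom]
    simpa only [Category.assoc, Iso.inv_hom_id_assoc, Iso.inv_hom_id, Category.comp_id,
      Preadditive.comp_add, Preadditive.add_comp] using H₃
  · simpa only [Category.assoc] using H₄
  · rw [← cancel_epi b₂.inv, ← cancel_mono b₂.hom]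
    simpa only [Category.assoc, Iso.inv_hom_id_assoc, Iso.inv_hom_id, Category.comp_id,
      Preadditive.comp_add, Preadditive.add_comp] using H₅

section

variable {a b c : Fin 4 → ℕ} (M N : GBimod a b) (K : GBimod b c)

theorem tensorInl_tensorFst : tensorInl M N K ≫ tensorFst M N K = 𝟙 _ :=
  ((GBimod.tensorRight a K).map_comp _ _).symm.trans ((GBimod.tensorRight a K).map_id M)

theorem tensorInr_tensorSnd : tensorInr M N K ≫ tensorSnd M N K = 𝟙 _ :=
  ((GBimod.tensorRight a K).map_comp _ _).symm.trans ((GBimod.tensorRight a K).map_id N)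

theorem tensorInl_tensorSnd : tensorInl M N K ≫ tensorSnd M N K = 0 :=
  ((GBimod.tensorRight a K).map_comp _ _).symm.trans ((GBimod.tensorRight a K).map_zero M N)

theorem tensorInr_tensorFst : tensorInr M N K ≫ tensorFst M N K = 0 :=
  ((GBimod.tensorRight a K).map_comp _ _).symm.trans ((GBimod.tensorRight a K).map_zero N M)

theorem tensor_total : tensorFst M N K ≫ tensorInl M N K + tensorSnd M N K ≫ tensorInr M N K =
    𝟙 ((M.prod N).tensor K) :=
  (congrArg₂ (fun f g : (M.prod N).tensor K ⟶ (M.prod N).tensor K => f + g)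
    ((GBimod.tensorRight a K).map_comp _ _).symm ((GBimod.tensorRight a K).map_comp _ _).symm).trans
    ((GBimod.tensorRight a K).map_add.symm.trans
      ((congrArg (GBimod.tensorRight a K).map (prod_total M N)).trans
        ((GBimod.tensorRight a K).map_id _)))

end

section

variable {C : Type*} [Category* C] {X M N P Q : C} (e : M ≅ P) (e' : N ≅ Q)

theorem conj_comp_eq_id {i : M ⟶ X} {p : X ⟶ M} (h : i ≫ p = 𝟙 M) :
    (e.inv ≫ i) ≫ p ≫ e.hom = 𝟙 P := by
  rw [Category.assoc, reassoc_of% h, e.inv_hom_id]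

theorem conj_comp_eq_zero [Preadditive C] {i : M ⟶ X} {p : X ⟶ N} (h : i ≫ p = 0) :
    (e.inv ≫ i) ≫ p ≫ e'.hom = 0 := by
  rw [Category.assoc, reassoc_of% h, Limits.zero_comp, Limits.comp_zero]

theorem conj_total [Preadditive C] {i : M ⟶ X} {p : X ⟶ M} {i' : N ⟶ X} {p' : X ⟶ N}
    (h : p ≫ i + p' ≫ i' = 𝟙 X) :
    (p ≫ e.hom) ≫ e.inv ≫ i + (p' ≫ e'.hom) ≫ e'.inv ≫ i' = 𝟙 X := by
  rw [Category.assoc, Category.assoc, Iso.hom_inv_id_assoc, Iso.hom_inv_id_assoc, h]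

end

theorem inclP_projP : inclP ≫ projP = 𝟙 _ := conj_comp_eq_id isoP (tensorInl_tensorFst _ _ _)

theorem inclQ_projQ : inclQ ≫ projQ = 𝟙 _ := conj_comp_eq_id isoQ (tensorInr_tensorSnd _ _ _)

theorem inclP_projQ : inclP ≫ projQ = 0 :=
  conj_comp_eq_zero isoP isoQ (tensorInl_tensorSnd _ _ _)

theorem inclQ_projP : inclQ ≫ projP = 0 :=
  conj_comp_eq_zero isoQ isoP (tensorInr_tensorFst _ _ _)

theorem proj_incl_total : projP ≫ inclP + projQ ≫ inclQ = 𝟙 _ :=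
  conj_total isoP isoQ (tensor_total _ _ _)

/-- The terms of degree at least 3 are tensor products with the zero bimodule. They are not
literally zero, but every pure tensor in them vanishes. -/
theorem splitAfterCrossing_hom_eq (n : ℕ) (X : GBimod c112 c22)
    (f g : splitAfterCrossing.X (n + 3) ⟶ X) : f = g :=
  DHom.ext (tensor_hom_ext (M := splitLeft) (N := GBimod.zero c22 c22) fun m _ => by
    have h : (tmul m (0 : (GBimod.zero c22 c22).carrier) :
        TensorCarrier splitLeft (GBimod.zero c22 c22)) = 0 :=
      map_zero (tmulHom splitLeft (GBimod.zero c22 c22) m)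
    exact (congrArg f.toFun h).trans ((map_zero f.toFun).trans
      ((map_zero g.toFun).symm.trans (congrArg g.toFun h.symm))))

theorem splitBeforeCrossing_hom_eq (n : ℕ) (X : GBimod c112 c22)
    (f g : splitBeforeCrossing.X (n + 3) ⟶ X) : f = g :=
  DHom.ext (tensor_hom_ext (M := GBimod.zero c112 c211) (N := splitRight) fun _ m => by
    have h : (tmul (0 : (GBimod.zero c112 c211).carrier) m :
        TensorCarrier (GBimod.zero c112 c211) splitRight) = 0 :=
      DFunLike.congr_fun (map_zero (tmulHom (GBimod.zero c112 c211) splitRight)) m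
    exact (congrArg f.toFun h).trans ((map_zero f.toFun).trans
      ((map_zero g.toFun).symm.trans (congrArg g.toFun h.symm))))

theorem nonempty_homotopyEquiv :
    Nonempty (HomotopyEquiv splitAfterCrossing splitBeforeCrossing) :=
  nonempty_homotopyEquiv_of_isos splitAfterCrossing_hom_eq splitBeforeCrossing_hom_eq isoA₀ isoA₁
    isoA₂ isoB₀ isoB₂ inclP_projP inclQ_projQ inclP_projQ inclQ_projP proj_incl_total
    -- The shifts 6, 4, 2, 0 turn maps of degree 2, -2 and 0 into degree-preserving ones; `projB₀`
    -- has degree 6 - 4 - 2 = 0.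
    (DHom.toShift inclB₀ 0 0 rfl) (projB₀.toShift 0 0 rfl) (inclB₂.toShift 6 4 rfl)
    (projB₂.toShift 4 6 rfl) (contractB₀.toShift 0 2 rfl) (contractP.toShift 2 4 rfl)
    (GBimod.hom_ext projB₀_inclB₀) (GBimod.hom_ext projB₂_inclB₂)
    (GBimod.hom_ext contractP_contractB₀) (GBimod.hom_ext beta_inclB₂)
    (GBimod.hom_ext projB₀_delta) (GBimod.hom_ext gamma_contractB₀_add)
    (GBimod.hom_ext elimination_degree_one) (GBimod.hom_ext contractP_alpha_add)

end ColouredWeb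

end

theorem mainTheorem6 :
    Nonempty (HomotopyEquiv ColouredWeb.splitAfterCrossing ColouredWeb.splitBeforeCrossing) :=
  ColouredWeb.nonempty_homotopyEquiv
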